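/- Let $d\ge 0$ be an integer and $T>0$, and let $V_b:\mathbb R^d\to\mathbb R$ be $C^\infty$ with all derivatives (including $V_b$ itself) bounded. For $\varepsilon>0$ and a Schwartz function $f:\mathbb R^{2d}\to\mathbb C$ of $(x,k)$ put $$D^\varepsilon f(x,k,p)=\tfrac1\varepsilon\big[f(x,k+\tfrac{\varepsilon}{2}p)-f(x,k-\tfrac{\varepsilon}{2}p)\big],\qquad \delta^\varepsilon[V_b](x,y)=\tfrac1\varepsilon\big[V_b(x+\tfrac{\varepsilon}{2}y)-V_b(x-\tfrac{\varepsilon}{2}y)\big],$$ $$\mathcal L^\varepsilon_{V_b}[f](x,k)=\frac{i}{(2\pi)^d}\int_{\mathbb R^d}\delta^\varepsilon[V_b](x,y)\int_{\mathbb R^d}f(x,p)\,e^{iy\cdot(k-p)}\,dp\,dy .$$ A solution (of the Wigner or of the Liouville equation) on $[0,T]$ means a continuous map from $[0,T]$ to the Schwartz space $\mathcal S(\mathbb R^{2d})$ satisfying the equation pointwise on $[0,T]\times\mathbb R^{2d}$, with one-sided time derivatives at $t=0,T$. Let $f_I^\varepsilon,g_T^\varepsilon$ $(\varepsilon>0)$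 and $f_I,g_T$ be Schwartz functions on $\mathbb R^{2d}$ such that, as $\varepsilon\to0^+$, $f_I^\varepsilon\to f_I$ and $g_T^\varepsilon\to g_T$ in $L^2(\mathbb R^{2d})$, and such that for every order $m$ the $m$-th order derivatives of $f_I^\varepsilon$ and of $g_T^\varepsilon$ are bounded in $L^2(\mathbb R^{2d})$ uniformly for all sufficiently small $\varepsilon>0$. For each $\varepsilon>0$ let $f_b^\varepsilon$ and $g^\varepsilon$ be solutions of the background and the adjoint Wigner equation $$\partial_tf_b^\varepsilon+k\cdot\nabla_xf_b^\varepsilon=\mathcal L^\varepsilon_{V_b}[f_b^\varepsilon],\quad f_b^\varepsilon|_{t=0}=f_I^\varepsilon;\qquad \partial_tg^\varepsilon+k\cdot\nabla_xg^\varepsilon=\mathcal L^\varepsilon_{V_b}[g^\varepsilon],\quad g^\varepsilon|_{t=T}=g_T^\varepsilon,$$ and let $f_b$ and $g$ be solutions of the background and the adjoint Liouville equation $$\partial_tf_b+k\cdot\nabla_xf_b-\nabla_xV_b\cdot\nabla_kf_b=0,\quad f_b|_{t=0}=f_I;\qquad \partial_tg+k\cdot\nabla_xg-\nabla_xV_b\cdot\nabla_kg=0,\quad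 g|_{t=T}=g_T.$$ Define the Wigner and the Liouville representatives $$R_W^\varepsilon[f_I^\varepsilon,g_T^\varepsilon](x)=\frac{i}{(2\pi)^d}\int_{\mathbb R^{3d}\times[0,T]}e^{ip\cdot(z-x)}\,\overline{g^\varepsilon}(t,z,k)\,D^\varepsilon f_b^\varepsilon(t,z,k,p)\,dp\,dz\,dk\,dt,$$ $$R_L[f_I,g_T](x)=-\nabla_x\cdot\int_{\mathbb R^d\times[0,T]}\overline g(t,x,k)\,\nabla_kf_b(t,x,k)\,dk\,dt .$$ Then both integrals converge absolutely for every $x\in\mathbb R^d$ (the first one for every $\varepsilon>0$), the vector field under the divergence in $R_L$ is differentiable, and $$\lim_{\varepsilon\to0^+}R_W^\varepsilon[f_I^\varepsilon,g_T^\varepsilon]=R_L[f_I,g_T]$$ uniformly on $\mathbb R^d$ and also in $L^2(\mathbb R^d)$. -/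

import Mathlib

open Filter Topology MeasureTheory
open scoped ContDiff InnerProductSpace ENNReal NNReal

noncomputable section

namespace WignerLiouville

/-- Position space (and momentum space) `ℝᵈ` with its Euclidean structure. -/
abbrev Space (d : ℕ) : Type := EuclideanSpace ℝ (Fin d)

/-- Complex-valued Schwartz functions on the phase space `ℝᵈ × ℝᵈ` of pairs `(x, k)`. -/
abbrev PhaseFun (d : ℕ) : Type := SchwartzMap (Space d × Space d) ℂ

/-- The potential is smooth and all its derivatives, including the one of order `0`,
are bounded on `ℝᵈ`. -/
def IsAdmissiblePotential {d : ℕ} (V : Space d → ℝ) : Prop :=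
  ContDiff ℝ ∞ V ∧ ∀ n : ℕ, ∃ C : ℝ, ∀ x : Space d, ‖iteratedFDeriv ℝ n V x‖ ≤ C

/-- `δ^ε[V](x, y) = ε⁻¹ (V (x + ε y / 2) - V (x - ε y / 2))`. -/
def potentialDiff {d : ℕ} (V : Space d → ℝ) (ε : ℝ) (x y : Space d) : ℝ :=
  (V (x + (ε / 2) • y) - V (x - (ε / 2) • y)) / ε

/-- `D^ε f (x, k, p) = ε⁻¹ (f (x, k + ε p / 2) - f (x, k - ε p / 2))`. -/
def momentumDiff {d : ℕ} (ε : ℝ) (f : PhaseFun d) (x k p : Space d) : ℂ :=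
  (f (x, k + (ε / 2) • p) - f (x, k - (ε / 2) • p)) / (ε : ℂ)

/-- The operator `L_V^ε`,
`L_V^ε[f](x, k) = i (2π)⁻ᵈ ∫∫ δ^ε[V](x, y) f(x, p) e^{i y·(k - p)} dp dy`.
As always for such oscillatory integrals the `p`-integration is carried out first: for a Schwartz
function `f` both iterated integrals then converge absolutely. -/
def wignerOp {d : ℕ} (V : Space d → ℝ) (ε : ℝ) (f : PhaseFun d) (x k : Space d) : ℂ :=
  Complex.I / (2 * (Real.pi : ℂ)) ^ d *
    ∫ y : Space d, (potentialDiff V ε x y : ℂ) *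
      ∫ p : Space d, f (x, p) * Complex.exp (Complex.I * (⟪y, k - p⟫_ℝ : ℂ))

/-- `f` solves the Wigner equation `∂ₜ f + k·∇ₓ f = L_V^ε[f]` on `[0, T] × ℝ²ᵈ`
(with one-sided time derivatives at the end points), as a continuous curve of Schwartz functions. -/
structure SolvesWigner {d : ℕ} (V : Space d → ℝ) (ε T : ℝ) (f : ℝ → PhaseFun d) : Prop where
  continuousOn : ContinuousOn f (Set.Icc 0 T)
  equation : ∀ t ∈ Set.Icc 0 T, ∀ x k : Space d,
    HasDerivWithinAt (fun s : ℝ => f s (x, k))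
      (-(fderiv ℝ (f t) (x, k) (k, 0)) + wignerOp V ε (f t) x k) (Set.Icc 0 T) t

/-- `f` solves the Liouville equation `∂ₜ f + k·∇ₓ f - ∇V·∇ₖ f = 0` on `[0, T] × ℝ²ᵈ`
(with one-sided time derivatives at the end points), as a continuous curve of Schwartz functions. -/
structure SolvesLiouville {d : ℕ} (V : Space d → ℝ) (T : ℝ) (f : ℝ → PhaseFun d) : Prop where
  continuousOn : ContinuousOn f (Set.Icc 0 T)
  equation : ∀ t ∈ Set.Icc 0 T, ∀ x k : Space d,
    HasDerivWithinAt (fun s : ℝ => f s (x, k))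
      (-(fderiv ℝ (f t) (x, k) (k, 0)) + fderiv ℝ (f t) (x, k) (0, gradient V x))
      (Set.Icc 0 T) t

/-- The measure `dp dz dk dt` on `ℝ³ᵈ × [0, T]`. -/
def wignerMeasure (d : ℕ) (T : ℝ) : Measure ((Space d × Space d × Space d) × ℝ) :=
  (volume : Measure (Space d × Space d × Space d)).prod (volume.restrict (Set.Icc 0 T))

/-- The integrand `e^{i p·(z - x)} conj(g(t, z, k)) D^ε f(t, z, k, p)` of the Wigner representative,
as a function of `((p, z, k), t)`. -/
def wignerIntegrand {d : ℕ} (ε : ℝ) (f g : ℝ → PhaseFun d) (x : Space d) :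
    (Space d × Space d × Space d) × ℝ → ℂ :=
  fun ⟨⟨p, z, k⟩, t⟩ =>
    Complex.exp (Complex.I * (⟪p, z - x⟫_ℝ : ℂ)) * (starRingEnd ℂ) (g t (z, k)) *
      momentumDiff ε (f t) z k p

/-- The Wigner representative, built from the background solution `f` and the adjoint
solution `g`:
`R_W^ε(x) = i (2π)⁻ᵈ ∫_{ℝ³ᵈ × [0, T]} e^{i p·(z - x)} conj(g(z, k)) D^ε f(z, k, p) dp dz dk dt`. -/
def wignerRep {d : ℕ} (ε T : ℝ) (f g : ℝ → PhaseFun d) (x : Space d) : ℂ :=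
  Complex.I / (2 * (Real.pi : ℂ)) ^ d * ∫ q, wignerIntegrand ε f g x q ∂(wignerMeasure d T)

/-- The measure `dk dt` on `ℝᵈ × [0, T]`. -/
def liouvilleMeasure (d : ℕ) (T : ℝ) : Measure (Space d × ℝ) :=
  (volume : Measure (Space d)).prod (volume.restrict (Set.Icc 0 T))

/-- The `j`-th component of the vector `conj(g(t, x, k)) ∇ₖ f(t, x, k)`, as a function
of `(k, t)`. -/
def liouvilleIntegrand {d : ℕ} (f g : ℝ → PhaseFun d) (j : Fin d) (x : Space d) :
    Space d × ℝ → ℂ :=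
  fun ⟨k, t⟩ => (starRingEnd ℂ) (g t (x, k)) *
    fderiv ℝ (f t) (x, k) (0, EuclideanSpace.single j (1 : ℝ))

/-- The `j`-th component of the vector field `x ↦ ∫_{ℝᵈ × [0, T]} conj(g) ∇ₖ f dk dt`. -/
def liouvilleFlux {d : ℕ} (T : ℝ) (f g : ℝ → PhaseFun d) (j : Fin d) (x : Space d) : ℂ :=
  ∫ q, liouvilleIntegrand f g j x q ∂(liouvilleMeasure d T)

/-- The Liouville representative, built from the background solution `f` and the adjoint
solution `g`: `R_L(x) = - ∇ₓ · ∫_{ℝᵈ × [0, T]} conj(g) ∇ₖ f dk dt`. -/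
def liouvilleRep {d : ℕ} (T : ℝ) (f g : ℝ → PhaseFun d) (x : Space d) : ℂ :=
  -∑ j : Fin d, fderiv ℝ (liouvilleFlux T f g j) x (EuclideanSpace.single j (1 : ℝ))

/-- As `ε → 0⁺`, the family `u^ε` converges strongly in `L²(ℝ²ᵈ)` to `u`, and it is regular
uniformly in `ε`: for every order `m` the derivatives of order `m` of `u^ε` are bounded
in `L²(ℝ²ᵈ)` for all small `ε > 0`. -/
structure ConvergesRegularly {d : ℕ} (u : ℝ → PhaseFun d) (u₀ : PhaseFun d) : Prop where
  tendsto_L2 : Tendsto (fun ε : ℝ => eLpNorm (fun w => u ε w - u₀ w) 2 volume) (𝓝[>] 0) (𝓝 0)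
  bounded : ∀ m : ℕ, ∃ C : ℝ≥0, ∀ᶠ ε in 𝓝[>] (0 : ℝ),
    eLpNorm (fun w => iteratedFDeriv ℝ m (u ε) w) 2 volume ≤ C

end WignerLiouville

end

/-!
Under the partial Fourier transform in `k`, the operator `L_V^ε` becomes multiplication by `i` times
a real symbol, a difference quotient of `V`. Hence the Wigner generator is the sum of free transport
and a skew-adjoint operator, and its commutators with the coordinate derivatives are bounded
uniformly in `ε` by derivatives of the same order. The energy method and Grönwall's inequality
therefore bound the `L²` norms of all derivatives of the solutions uniformly in `ε`. As `ε → 0` the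
symbol converges to that of `∇V · ∇ₖ`, with an error of size `O(ε)` on regular functions, so the
energy estimate for the difference of a Wigner and a Liouville solution gives `f^ε → f` and
`g^ε → g` in `L²` at every time.

Both representatives are Fourier transforms, over a frequency `p`, of the time integral of the
`L²` pairing of `g` with a force operator applied to `f`, the potential being the plane wave
`e^{i p · x}`. These coefficients converge for each `p`, and integrating by parts in `x` trades
powers of `p` for derivatives of `f` and `g`, so they decay in `p` uniformly in `ε`. Dominated
convergence in `L¹` and in `L²` of the frequency variable then gives the uniform and the `L²`
convergence of the representatives.
-/

noncomputable section

namespace WignerLiouville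

open scoped FourierTransform SchwartzMap LineDeriv
open SchwartzMap

section Slice

variable {E F G : Type*} [NormedAddCommGroup E] [NormedSpace ℝ E]
  [NormedAddCommGroup F] [NormedSpace ℝ F]

theorem hasTemperateGrowth_prodMk_left (x : E) :
    (fun p : F => (x, p)).HasTemperateGrowth := by
  have h : (fun p : F => (x, p)) =
      (fun _ : F => ((x, 0) : E × F)) + ⇑(ContinuousLinearMap.inr ℝ E F) := by
    ext p <;> simp
  rw [h]
  exact (Function.HasTemperateGrowth.const _).add (ContinuousLinearMap.hasTemperateGrowth _)

theorem exists_norm_le_one_add_norm_snd_rpow [NormedAddCommGroup G] [NormedSpace ℝ G]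
    (f : 𝓢(E × F, G)) (k : ℕ) :
    ∃ C : ℝ, ∀ x p, ‖f (x, p)‖ ≤ C * (1 + ‖p‖) ^ (-(k : ℝ)) := by
  refine ⟨2 ^ k * (Finset.Iic (k, 0)).sup (fun m => SchwartzMap.seminorm ℝ m.1 m.2) f,
    fun x p => ?_⟩
  have h := one_add_le_sup_seminorm_apply (𝕜 := ℝ) (m := (k, 0)) le_rfl le_rfl f (x, p)
  simp only [norm_iteratedFDeriv_zero] at h
  have hp : ‖p‖ ≤ ‖(x, p)‖ := le_max_right _ _
  rw [Real.rpow_neg (by positivity), Real.rpow_natCast, ← div_eq_mul_inv,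
    le_div_iff₀ (by positivity), mul_comm]
  exact le_trans (by gcongr) h

variable [NormedAddCommGroup G] [NormedSpace ℂ G]

/-- The restriction of a Schwartz function on `E × F` to the fibre `{x} × F`. -/
def slice (x : E) : 𝓢(E × F, G) →L[ℂ] 𝓢(F, G) :=
  compCLM ℂ (hasTemperateGrowth_prodMk_left x)
    ⟨1, 1, fun p => by
      have : ‖p‖ ≤ ‖(x, p)‖ := le_max_right _ _
      rw [one_mul, pow_one]
      exact this.trans (le_add_of_nonneg_left zero_le_one)⟩

theorem slice_apply (x : E) (f : 𝓢(E × F, G)) (p : F) : slice x f p = f (x, p) := rfl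

theorem ext_slice {f g : 𝓢(E × F, G)} (h : ∀ x, slice x f = slice x g) : f = g := by
  ext w
  exact DFunLike.congr_fun (h w.1) w.2

theorem slice_lineDeriv_snd (x : E) (v : F) (f : 𝓢(E × F, G)) :
    slice x (∂_{((0, v) : E × F)} f) = ∂_{v} (slice x f) := by
  ext p
  have hcomp : HasFDerivAt (slice x f)
      ((fderiv ℝ f (x, p)).comp (ContinuousLinearMap.inr ℝ E F)) p :=
    HasFDerivAt.comp p (f.hasFDerivAt (x, p)) (hasFDerivAt_prodMk_right x p)
  rw [slice_apply, lineDerivOp_apply_eq_fderiv, lineDerivOp_apply_eq_fderiv, hcomp.fderiv]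
  rfl

theorem norm_iteratedFDeriv_slice_le (x : E) (f : 𝓢(E × F, G)) (n : ℕ) (p : F) :
    ‖iteratedFDeriv ℝ n (slice x f) p‖ ≤ ‖iteratedFDeriv ℝ n f (x, p)‖ := by
  have h : (slice x f : F → G) =
      (fun w => f ((x, 0) + w)) ∘ ⇑(ContinuousLinearMap.inr ℝ E F) := by
    ext p
    simp [slice_apply]
  have hs : ContDiff ℝ ∞ (fun w => f ((x, 0) + w)) :=
    (f.smooth ⊤).comp (contDiff_const.add contDiff_id)
  rw [h, ContinuousLinearMap.iteratedFDeriv_comp_right _ hs p (i := n) (mod_cast le_top),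
    iteratedFDeriv_comp_add_left]
  refine (ContinuousMultilinearMap.norm_compContinuousLinearMap_le _ _).trans ?_
  have hprod : ∏ _i : Fin n, ‖ContinuousLinearMap.inr ℝ E F‖ ≤ 1 :=
    Finset.prod_le_one (fun _ _ => ContinuousLinearMap.opNorm_nonneg _)
      fun _ _ => ContinuousLinearMap.norm_inr_le_one ℝ E F
  calc _ ≤ ‖iteratedFDeriv ℝ n f ((x, 0) + ContinuousLinearMap.inr ℝ E F p)‖ * 1 := by gcongr
    _ = _ := by simp

theorem norm_pow_mul_seminorm_slice_le (x : E) (f : 𝓢(E × F, G)) (i a b : ℕ) :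
    ‖x‖ ^ i * SchwartzMap.seminorm ℝ a b (slice x f) ≤ SchwartzMap.seminorm ℝ (i + a) b f := by
  have h : SchwartzMap.seminorm ℝ a b ((‖x‖ ^ i : ℝ) • slice x f) ≤
      SchwartzMap.seminorm ℝ (i + a) b f := by
    refine seminorm_le_bound ℝ a b _ (apply_nonneg _ _) fun p => ?_
    have hsmul : iteratedFDeriv ℝ b (⇑((‖x‖ ^ i : ℝ) • slice x f)) p =
        (‖x‖ ^ i : ℝ) • iteratedFDeriv ℝ b (slice x f) p :=
      iteratedFDeriv_const_smul_apply ((slice x f).contDiffAt b)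
    rw [hsmul, norm_smul, Real.norm_of_nonneg (by positivity)]
    have hx : ‖x‖ ≤ ‖(x, p)‖ := le_max_left _ _
    have hp : ‖p‖ ≤ ‖(x, p)‖ := le_max_right _ _
    calc _ ≤ ‖(x, p)‖ ^ a * (‖(x, p)‖ ^ i * ‖iteratedFDeriv ℝ b f (x, p)‖) := by
            gcongr
            exact norm_iteratedFDeriv_slice_le x f b p
      _ = ‖(x, p)‖ ^ (i + a) * ‖iteratedFDeriv ℝ b f (x, p)‖ := by ring
      _ ≤ _ := le_seminorm ℝ _ _ f _
  simpa [map_smul_eq_mul] using h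

theorem exists_continuous_seminorm_slice_le {p : Seminorm ℝ 𝓢(F, G)} (hp : Continuous p) (i : ℕ) :
    ∃ q : Seminorm ℝ 𝓢(E × F, G), Continuous q ∧ ∀ x f, ‖x‖ ^ i * p (slice x f) ≤ q f := by
  obtain ⟨s, C, -, hC⟩ := Seminorm.bound_of_continuous (schwartz_withSeminorms ℝ F G) p hp
  have hq (f : 𝓢(E × F, G)) : (C • ∑ m ∈ s, SchwartzMap.seminorm ℝ (i + m.1) m.2) f =
      C * ∑ m ∈ s, SchwartzMap.seminorm ℝ (i + m.1) m.2 f := by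
    simp [NNReal.smul_def]
  refine ⟨C • ∑ m ∈ s, SchwartzMap.seminorm ℝ (i + m.1) m.2, ?_, fun x f => ?_⟩
  · refine (continuous_congr hq).2 (continuous_const.mul (continuous_finsetSum _ fun m _ => ?_))
    exact (schwartz_withSeminorms ℝ (E × F) G).continuous_seminorm (i + m.1, m.2)
  · have hsup : p (slice x f) ≤ C * ∑ m ∈ s, SchwartzMap.seminorm ℝ m.1 m.2 (slice x f) := by
      refine (hC (slice x f)).trans ?_
      have hsum := Seminorm.finset_sup_le_sum (schwartzSeminormFamily ℝ F G) s (slice x f)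
      rw [_root_.sum_apply] at hsum
      exact mul_le_mul_of_nonneg_left hsum C.coe_nonneg
    calc _ ≤ ‖x‖ ^ i * (C * ∑ m ∈ s, SchwartzMap.seminorm ℝ m.1 m.2 (slice x f)) := by gcongr
      _ = C * ∑ m ∈ s, ‖x‖ ^ i * SchwartzMap.seminorm ℝ m.1 m.2 (slice x f) := by
            rw [mul_left_comm, Finset.mul_sum]
      _ ≤ C * ∑ m ∈ s, SchwartzMap.seminorm ℝ (i + m.1) m.2 f := by
            gcongr
            exact norm_pow_mul_seminorm_slice_le _ _ _ _ _
      _ = _ := (hq f).symm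

end Slice

section PartialFourier

universe u

variable {E F : Type u} [NormedAddCommGroup E] [NormedSpace ℝ E]
  [NormedAddCommGroup F] [InnerProductSpace ℝ F]
  {G : Type u} [NormedAddCommGroup G] [NormedSpace ℂ G]

/-- The derivative of the integrand `e^{-2πi⟪p, y⟫} f (x, p)` of the partial Fourier transform with
respect to `(x, y)`, evaluated at `(x, p)` and without the phase. -/
def partialFourierDeriv : 𝓢(E × F, G) →L[ℝ] 𝓢(E × F, E × F →L[ℝ] G) :=
  (postcompCLM (𝕜 := ℝ) ((ContinuousLinearMap.compL ℝ (E × F) (E × F) G).flip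
    ((ContinuousLinearMap.inl ℝ E F).comp (ContinuousLinearMap.fst ℝ E F)))).comp
      (fderivCLM ℝ (E × F) G) -
  (2 * Real.pi * Complex.I) • smulRightCLM ℝ G
    ((((innerSL ℝ (E := F)).comp (ContinuousLinearMap.snd ℝ E F)).flip.comp
      (ContinuousLinearMap.snd ℝ E F)).flip)

theorem partialFourierDeriv_apply (f : 𝓢(E × F, G)) (w v : E × F) :
    partialFourierDeriv f w v =
      fderiv ℝ f w (v.1, 0) - (2 * Real.pi * Complex.I) • (⟪w.2, v.2⟫_ℝ • f w) := by
  simp [partialFourierDeriv]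

theorem hasFDerivAt_fourierChar_smul_fibre (f : 𝓢(E × F, G)) (p : F) (w : E × F) :
    HasFDerivAt (fun w : E × F => 𝐞 (-⟪p, w.2⟫_ℝ) • f (w.1, p))
      (𝐞 (-⟪p, w.2⟫_ℝ) • partialFourierDeriv f (w.1, p)) w := by
  have hpair : HasFDerivAt (fun w : E × F => (w.1, p)) ((ContinuousLinearMap.inl ℝ E F).comp
      (ContinuousLinearMap.fst ℝ E F)) w := by
    refine (hasFDerivAt_fst.prodMk (hasFDerivAt_const p w)).congr_fderiv ?_
    ext v <;> simp
  have hfibre : HasFDerivAt (fun w : E × F => f (w.1, p))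
      ((fderiv ℝ f (w.1, p)).comp ((ContinuousLinearMap.inl ℝ E F).comp
        (ContinuousLinearMap.fst ℝ E F))) w :=
    HasFDerivAt.comp w (f.hasFDerivAt (w.1, p)) hpair
  have hphase : HasFDerivAt (fun w : E × F => -⟪p, w.2⟫_ℝ)
      (-((innerSL ℝ p).comp (ContinuousLinearMap.snd ℝ E F))) w :=
    (((innerSL ℝ p).comp (ContinuousLinearMap.snd ℝ E F)).hasFDerivAt).neg
  refine (((Real.hasDerivAt_fourierChar (-⟪p, w.2⟫_ℝ)).hasFDerivAt.comp w hphase).smul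
    hfibre).congr_fderiv (ContinuousLinearMap.ext fun v => ?_)
  have hsmul : (𝐞 (-⟪p, w.2⟫_ℝ) • partialFourierDeriv f (w.1, p)) v =
      𝐞 (-⟪p, w.2⟫_ℝ) • partialFourierDeriv f (w.1, p) v := rfl
  have hinner : ((innerSL ℝ p).comp (ContinuousLinearMap.snd ℝ E F)) v = ⟪p, v.2⟫_ℝ := rfl
  rw [hsmul, partialFourierDeriv_apply, Circle.smul_def]
  simp only [_root_.add_apply, _root_.smul_apply, ContinuousLinearMap.comp_apply,
    ContinuousLinearMap.smulRight_apply, ContinuousLinearMap.coe_fst',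
    ContinuousLinearMap.inl_apply, ContinuousLinearMap.toSpanSingleton_apply, _root_.neg_apply,
    hinner, Complex.real_smul, neg_smul, smul_sub, ← sub_eq_add_neg,
    ← Complex.coe_smul (⟪p, v.2⟫_ℝ) (f (w.1, p)), smul_smul]
  congr 2
  ring

variable [FiniteDimensional ℝ F] [MeasurableSpace F] [BorelSpace F]

theorem integrable_fourierChar_smul_fibre (f : 𝓢(E × F, G)) (w : E × F) :
    Integrable fun p : F => 𝐞 (-⟪p, w.2⟫_ℝ) • f (w.1, p) :=
  (Real.fourierIntegral_convergent_iff w.2).2 (slice w.1 f).integrable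

/-- The function underlying the partial Fourier transform `partialFourier` of a Schwartz function:
at `(x, y)` it is the Fourier transform at `y` of the slice at `x`. -/
def partialFourierFun (f : 𝓢(E × F, G)) (w : E × F) : G := 𝓕 (slice w.1 f) w.2

theorem partialFourierFun_eq_integral (f : 𝓢(E × F, G)) (w : E × F) :
    partialFourierFun f w = ∫ p, 𝐞 (-⟪p, w.2⟫_ℝ) • f (w.1, p) := by
  rw [partialFourierFun, fourier_coe, Real.fourier_eq]
  rfl

theorem exists_continuous_seminorm_partialFourierFun_le (k : ℕ) :
    ∃ q : Seminorm ℝ 𝓢(E × F, G), Continuous q ∧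
      ∀ f w, ‖w‖ ^ k * ‖partialFourierFun f w‖ ≤ q f := by
  have hmixed (i j : ℕ) : ∃ q : Seminorm ℝ 𝓢(E × F, G), Continuous q ∧
      ∀ f w, ‖w.1‖ ^ i * (‖w.2‖ ^ j * ‖partialFourierFun f w‖) ≤ q f := by
    let fourier : 𝓢(F, G) →L[ℝ] 𝓢(F, G) := fourierTransformCLM ℝ
    have hp : Continuous ((SchwartzMap.seminorm ℝ j 0).comp fourier.toLinearMap) :=
      ((schwartz_withSeminorms ℝ F G).continuous_seminorm (j, 0)).comp fourier.continuous
    obtain ⟨q, hq, hle⟩ := exists_continuous_seminorm_slice_le (E := E) hp i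
    exact ⟨q, hq, fun f w => (mul_le_mul_of_nonneg_left (norm_pow_mul_le_seminorm ℝ _ j w.2)
      (by positivity)).trans (hle w.1 f)⟩
  obtain ⟨q₁, hq₁, hfst⟩ := hmixed k 0
  obtain ⟨q₂, hq₂, hsnd⟩ := hmixed 0 k
  refine ⟨q₁ + q₂, hq₁.add hq₂, fun f w => ?_⟩
  have hpow : ‖w‖ ^ k ≤ ‖w.1‖ ^ k + ‖w.2‖ ^ k := by
    rcases max_choice ‖w.1‖ ‖w.2‖ with h | h <;> rw [Prod.norm_def, h] <;> simp
  simp only [pow_zero, one_mul] at hfst hsnd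
  calc _ ≤ (‖w.1‖ ^ k + ‖w.2‖ ^ k) * ‖partialFourierFun f w‖ := by gcongr
    _ ≤ q₁ f + q₂ f := by rw [add_mul]; exact add_le_add (hfst f w) (hsnd f w)

theorem hasFDerivAt_partialFourierFun (f : 𝓢(E × F, G)) (w : E × F) :
    HasFDerivAt (partialFourierFun f)
      (partialFourierFun (G := E × F →L[ℝ] G) (partialFourierDeriv f) w) w := by
  have hfun : partialFourierFun f = fun w => ∫ p, 𝐞 (-⟪p, w.2⟫_ℝ) • f (w.1, p) :=
    funext (partialFourierFun_eq_integral f)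
  rw [hfun, partialFourierFun_eq_integral (G := E × F →L[ℝ] G) (partialFourierDeriv f) w]
  obtain ⟨C, hC⟩ := exists_norm_le_one_add_norm_snd_rpow (partialFourierDeriv f)
    (volume : Measure F).integrablePower
  have hmeas := (integrable_fourierChar_smul_fibre (G := E × F →L[ℝ] G)
    (partialFourierDeriv f) w).aestronglyMeasurable
  have hbound (p : F) (w : E × F) : ‖𝐞 (-⟪p, w.2⟫_ℝ) • partialFourierDeriv f (w.1, p)‖ ≤
      C * (1 + ‖p‖) ^ (-((volume : Measure F).integrablePower : ℝ)) :=
    (Circle.norm_smul (E := E × F →L[ℝ] G) _ _).trans_le (hC _ _)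
  exact hasFDerivAt_integral_of_dominated_of_fderiv_le (𝕜 := ℝ) (s := Set.univ) Filter.univ_mem
    (F := fun (w : E × F) (p : F) => 𝐞 (-⟪p, w.2⟫_ℝ) • f (w.1, p))
    (F' := fun w p => 𝐞 (-⟪p, w.2⟫_ℝ) • partialFourierDeriv f (w.1, p))
    (.of_forall fun w => (integrable_fourierChar_smul_fibre f w).aestronglyMeasurable)
    (integrable_fourierChar_smul_fibre f w) hmeas (.of_forall fun p w _ => hbound p w)
    ((Measure.integrable_pow_neg_integrablePower volume).const_mul C)
    (.of_forall fun p w _ => hasFDerivAt_fourierChar_smul_fibre f p w)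

theorem fderiv_partialFourierFun (f : 𝓢(E × F, G)) :
    fderiv ℝ (partialFourierFun f) =
      partialFourierFun (G := E × F →L[ℝ] G) (partialFourierDeriv f) :=
  funext fun w => (hasFDerivAt_partialFourierFun f w).fderiv

theorem contDiff_partialFourierFun (n : ℕ) :
    ∀ {G : Type u} [NormedAddCommGroup G] [NormedSpace ℂ G] (f : 𝓢(E × F, G)),
      ContDiff ℝ n (partialFourierFun f) := by
  induction n with
  | zero =>
    intro G _ _ f
    exact contDiff_zero.2 (continuous_iff_continuousAt.2 fun w =>
      (hasFDerivAt_partialFourierFun f w).continuousAt)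
  | succ n ih =>
    intro G _ _ f
    rw [Nat.cast_add, Nat.cast_one, contDiff_succ_iff_fderiv, fderiv_partialFourierFun]
    exact ⟨fun w => (hasFDerivAt_partialFourierFun f w).differentiableAt, by simp,
      ih (G := E × F →L[ℝ] G) _⟩

theorem exists_continuous_seminorm_iteratedFDeriv_partialFourierFun_le (k n : ℕ) :
    ∀ {G : Type u} [NormedAddCommGroup G] [NormedSpace ℂ G],
      ∃ q : Seminorm ℝ 𝓢(E × F, G), Continuous q ∧
        ∀ f w, ‖w‖ ^ k * ‖iteratedFDeriv ℝ n (partialFourierFun f) w‖ ≤ q f := by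
  induction n with
  | zero =>
    intro G _ _
    simpa using exists_continuous_seminorm_partialFourierFun_le k
  | succ n ih =>
    intro G _ _
    obtain ⟨q, hq, hle⟩ := ih (G := E × F →L[ℝ] G)
    refine ⟨q.comp (partialFourierDeriv (E := E) (F := F) (G := G)).toLinearMap, ?_,
      fun f w => ?_⟩
    · exact hq.comp (partialFourierDeriv (E := E) (F := F) (G := G)).continuous
    rw [← norm_iteratedFDeriv_fderiv, fderiv_partialFourierFun]
    exact hle _ w

/-- The Fourier transform in the second variable, as an operator on Schwartz functions. -/
def partialFourier : 𝓢(E × F, G) →L[ℂ] 𝓢(E × F, G) :=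
  mkCLM (𝕜 := ℂ) (𝕜' := ℂ) (σ := RingHom.id ℂ) partialFourierFun
    (fun f g w => by simp [partialFourierFun, FourierTransform.fourier_add])
    (fun a f w => by simp [partialFourierFun, FourierTransform.fourier_smul])
    (fun f => contDiff_infty.2 fun n => contDiff_partialFourierFun n f)
    (fun m => by
      obtain ⟨q, hq, hle⟩ :=
        exists_continuous_seminorm_iteratedFDeriv_partialFourierFun_le (E := E) (F := F) (G := G)
          m.1 m.2
      obtain ⟨s, C, -, hC⟩ := Seminorm.bound_of_continuous
        (schwartz_withSeminorms ℝ (E × F) G) q hq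
      refine ⟨s, C, C.coe_nonneg, fun f w => (hle f w).trans ((hC f).trans ?_)⟩
      exact mul_le_mul_of_nonneg_left (Seminorm.finset_sup_apply_le (apply_nonneg _ _)
        fun i hi => Seminorm.le_finset_sup_apply (p := schwartzSeminormFamily ℂ (E × F) G)
          (x := f) hi) C.coe_nonneg)

/-- The inverse Fourier transform in the second variable: the partial Fourier transform followed by
the reflection of the second variable. -/
def partialFourierInv : 𝓢(E × F, G) →L[ℂ] 𝓢(E × F, G) :=
  (compCLMOfContinuousLinearEquiv ℂ ((ContinuousLinearEquiv.refl ℝ E).prodCongr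
    (ContinuousLinearEquiv.neg ℝ))).comp partialFourier

theorem slice_partialFourier (x : E) (f : 𝓢(E × F, G)) :
    slice x (partialFourier f) = 𝓕 (slice x f) := rfl

theorem slice_partialFourierInv (x : E) (f : 𝓢(E × F, G)) :
    slice x (partialFourierInv f) = 𝓕⁻ (slice x f) := rfl

theorem partialFourier_apply (f : 𝓢(E × F, G)) (x : E) (y : F) :
    partialFourier f (x, y) = ∫ p, 𝐞 (-⟪p, y⟫_ℝ) • f (x, p) :=
  partialFourierFun_eq_integral f (x, y)

theorem partialFourierInv_apply (f : 𝓢(E × F, G)) (x : E) (k : F) :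
    partialFourierInv f (x, k) = ∫ p, 𝐞 ⟪p, k⟫_ℝ • f (x, p) := by
  rw [← slice_apply, slice_partialFourierInv, fourierInv_coe, Real.fourierInv_eq]
  rfl

theorem lineDeriv_fst_partialFourier (v : E) (f : 𝓢(E × F, G)) :
    ∂_{((v, 0) : E × F)} (partialFourier f) = partialFourier (∂_{((v, 0) : E × F)} f) := by
  ext w
  have hderiv : fderiv ℝ (partialFourier f) w =
      partialFourierFun (G := E × F →L[ℝ] G) (partialFourierDeriv f) w :=
    congrFun (fderiv_partialFourierFun f) w
  rw [lineDerivOp_apply_eq_fderiv, hderiv, partialFourierFun_eq_integral, partialFourier_apply,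
    ContinuousLinearMap.integral_apply
      (integrable_fourierChar_smul_fibre (G := E × F →L[ℝ] G) (partialFourierDeriv f) w)]
  refine integral_congr_ae (.of_forall fun p => ?_)
  change 𝐞 (-⟪p, w.2⟫_ℝ) • partialFourierDeriv f (w.1, p) (v, 0) = _
  simp [partialFourierDeriv_apply, lineDerivOp_apply_eq_fderiv]

variable [CompleteSpace G]

@[simp]
theorem partialFourierInv_partialFourier (f : 𝓢(E × F, G)) :
    partialFourierInv (partialFourier f) = f :=
  ext_slice fun x => by
    rw [slice_partialFourierInv, slice_partialFourier, FourierTransform.fourierInv_fourier_eq]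

@[simp]
theorem partialFourier_partialFourierInv (f : 𝓢(E × F, G)) :
    partialFourier (partialFourierInv f) = f :=
  ext_slice fun x => by
    rw [slice_partialFourier, slice_partialFourierInv, FourierTransform.fourier_fourierInv_eq]

theorem partialFourier_injective :
    Function.Injective (partialFourier : 𝓢(E × F, G) → 𝓢(E × F, G)) :=
  Function.LeftInverse.injective partialFourierInv_partialFourier

end PartialFourier

section L2

variable {E H : Type*} [NormedAddCommGroup E] [NormedSpace ℝ E] [MeasureSpace E] [BorelSpace E]
  [SecondCountableTopology E] [(volume : Measure E).HasTemperateGrowth]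
  [NormedAddCommGroup H] [InnerProductSpace ℂ H]

/-- The `L²` norm of a Schwartz function. -/
def l2norm (f : 𝓢(E, H)) : ℝ := ‖f.toLp 2 volume‖

/-- The `L²` inner product of Schwartz functions, conjugate linear in the first argument. -/
def l2inner (f g : 𝓢(E, H)) : ℂ := ⟪f.toLp 2 volume, g.toLp 2 volume⟫_ℂ

theorem l2norm_nonneg (f : 𝓢(E, H)) : 0 ≤ l2norm f := norm_nonneg _

theorem l2norm_add_le (f g : 𝓢(E, H)) : l2norm (f + g) ≤ l2norm f + l2norm g :=
  norm_add_le (f.toLp 2 volume) (g.toLp 2 volume)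

theorem l2norm_neg (f : 𝓢(E, H)) : l2norm (-f) = l2norm f :=
  norm_neg (f.toLp 2 volume)

theorem l2inner_conj_symm (f g : 𝓢(E, H)) : (starRingEnd ℂ) (l2inner g f) = l2inner f g :=
  inner_conj_symm _ _

theorem l2inner_add_right (f g h : 𝓢(E, H)) : l2inner f (g + h) = l2inner f g + l2inner f h :=
  inner_add_right _ (g.toLp 2 volume) (h.toLp 2 volume)

theorem l2inner_sub_left (f g h : 𝓢(E, H)) : l2inner (f - g) h = l2inner f h - l2inner g h :=
  inner_sub_left (f.toLp 2 volume) (g.toLp 2 volume) _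

theorem l2inner_sub_right (f g h : 𝓢(E, H)) : l2inner f (g - h) = l2inner f g - l2inner f h :=
  inner_sub_right _ (g.toLp 2 volume) (h.toLp 2 volume)

theorem l2inner_smul_right (c : ℂ) (f g : 𝓢(E, H)) : l2inner f (c • g) = c * l2inner f g :=
  inner_smul_right _ (g.toLp 2 volume) c

theorem l2inner_sum_right {ι : Type*} (s : Finset ι) (f : 𝓢(E, H)) (g : ι → 𝓢(E, H)) :
    l2inner f (∑ i ∈ s, g i) = ∑ i ∈ s, l2inner f (g i) :=
  map_sum ((innerSL ℂ (f.toLp 2 volume)).comp (toLpCLM ℂ H 2 volume)) g s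

theorem norm_l2inner_le (f g : 𝓢(E, H)) : ‖l2inner f g‖ ≤ l2norm f * l2norm g :=
  norm_inner_le_norm _ _

theorem l2norm_sq (f : 𝓢(E, H)) : l2norm f ^ 2 = (l2inner f f).re := by
  rw [l2norm, l2inner, inner_self_eq_norm_sq_to_K]
  norm_cast

theorem l2norm_le_mul_sum {ι : Type*} (s : Finset ι) (f : 𝓢(E, H)) (g : ι → 𝓢(E, H)) (C : ℝ)
    (hC : 0 ≤ C) (hle : ∀ w, ‖f w‖ ≤ C * ∑ i ∈ s, ‖g i w‖) :
    l2norm f ≤ C * ∑ i ∈ s, l2norm (g i) := by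
  have heLpNorm : eLpNorm f 2 volume ≤ ENNReal.ofReal C * ∑ i ∈ s, eLpNorm (g i) 2 volume :=
    calc eLpNorm f 2 volume ≤ eLpNorm (C • ∑ i ∈ s, fun w => ‖g i w‖) 2 volume :=
          eLpNorm_mono_real fun w => by simpa using hle w
      _ ≤ ENNReal.ofReal C * eLpNorm (∑ i ∈ s, fun w => ‖g i w‖) 2 volume := by
          rw [eLpNorm_const_smul, Real.enorm_of_nonneg hC]
      _ ≤ ENNReal.ofReal C * ∑ i ∈ s, eLpNorm (fun w => ‖g i w‖) 2 volume := by
          gcongr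
          exact eLpNorm_sum_le (fun i _ => (g i).continuous.norm.aestronglyMeasurable) (by norm_num)
      _ = ENNReal.ofReal C * ∑ i ∈ s, eLpNorm (g i) 2 volume := by simp only [eLpNorm_norm]
  have hfin (i : ι) : eLpNorm (g i) 2 volume ≠ ⊤ := ((g i).eLpNorm_lt_top 2 volume).ne
  have htoReal := ENNReal.toReal_mono
    (ENNReal.mul_ne_top ENNReal.ofReal_ne_top (ENNReal.sum_ne_top.2 fun i _ => hfin i)) heLpNorm
  rw [ENNReal.toReal_mul, ENNReal.toReal_ofReal hC, ENNReal.toReal_sum fun i _ => hfin i]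
    at htoReal
  simpa [l2norm, norm_toLp] using htoReal

end L2

instance isAddHaarMeasure_volume_prod {E F : Type*} [NormedAddCommGroup E] [MeasureSpace E]
    [BorelSpace E] [NormedAddCommGroup F] [MeasureSpace F] [BorelSpace F]
    [SFinite (volume : Measure E)] [SFinite (volume : Measure F)]
    [(volume : Measure E).IsAddHaarMeasure] [(volume : Measure F).IsAddHaarMeasure] :
    (volume : Measure (E × F)).IsAddHaarMeasure :=
  Measure.prod.instIsAddHaarMeasure volume volume

section Multiplication

variable {E : Type*} [NormedAddCommGroup E] [NormedSpace ℝ E]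

/-- Multiplication of Schwartz functions by a complex-valued function, which is meant to be of
temperate growth. -/
abbrev mulOp (a : E → ℂ) : 𝓢(E, ℂ) →L[ℂ] 𝓢(E, ℂ) := smulLeftCLM ℂ a

theorem mulOp_apply {a : E → ℂ} (ha : a.HasTemperateGrowth) (f : 𝓢(E, ℂ)) (w : E) :
    mulOp a f w = a w * f w :=
  smulLeftCLM_apply_apply ha f w

theorem lineDeriv_mulOp {a a' : E → ℂ} (ha : a.HasTemperateGrowth) (ha' : a'.HasTemperateGrowth)
    (v : E) (hfderiv : ∀ w, fderiv ℝ a w v = a' w) (f : 𝓢(E, ℂ)) :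
    ∂_{v} (mulOp a f) = mulOp a (∂_{v} f) + mulOp a' f := by
  ext w
  have hcoe : (mulOp a f : E → ℂ) = fun w => a w * f w := funext (mulOp_apply ha f)
  have hdiff : DifferentiableAt ℝ a w := (ha.1.differentiable (by simp)) w
  rw [_root_.add_apply, mulOp_apply ha, mulOp_apply ha', lineDerivOp_apply_eq_fderiv,
    lineDerivOp_apply_eq_fderiv, hcoe, fderiv_fun_mul hdiff f.differentiableAt, ← hfderiv w]
  simp only [_root_.add_apply, _root_.smul_apply, smul_eq_mul]
  ring

theorem lineDeriv_mulOp_of_fderiv_eq_zero {a : E → ℂ} (ha : a.HasTemperateGrowth) (v : E)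
    (hfderiv : ∀ w, fderiv ℝ a w v = 0) (f : 𝓢(E, ℂ)) :
    ∂_{v} (mulOp a f) = mulOp a (∂_{v} f) := by
  rw [lineDeriv_mulOp ha (.const 0) v hfderiv, mulOp, mulOp, smulLeftCLM_const]
  simp

theorem lineDeriv_comm {G : Type*} [NormedAddCommGroup G] [NormedSpace ℝ G] (u v : E)
    (f : 𝓢(E, G)) : ∂_{u} (∂_{v} f) = ∂_{v} (∂_{u} f) := by
  ext w
  have hsecond (a b : E) : ∂_{a} (∂_{b} f) w = fderiv ℝ (fderiv ℝ f) w a b := by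
    have hdiff : DifferentiableAt ℝ (fderiv ℝ f) w :=
      ((contDiff_infty_iff_fderiv.1 (f.smooth ⊤)).2.differentiable (by simp)) w
    have hcoe : ((∂_{b} f : 𝓢(E, G)) : E → G) = fun w => fderiv ℝ f w b := rfl
    rw [lineDerivOp_apply_eq_fderiv, hcoe, fderiv_clm_apply hdiff (differentiableAt_const b)]
    simp
  rw [hsecond, hsecond]
  exact (f.contDiffAt 2).isSymmSndFDerivAt (by simp) u v

variable [FiniteDimensional ℝ E] [MeasureSpace E] [BorelSpace E]

section HasTemperateGrowth

variable [(volume : Measure E).HasTemperateGrowth]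

theorem l2inner_eq_integral (f g : 𝓢(E, ℂ)) :
    l2inner f g = ∫ w, (starRingEnd ℂ) (f w) * g w := by
  rw [l2inner, inner_toL2_toL2_eq f g volume]
  simp [mul_comm]

theorem l2inner_mulOp_right {a : E → ℂ} (ha : a.HasTemperateGrowth)
    (hreal : ∀ w, (starRingEnd ℂ) (a w) = a w) (f g : 𝓢(E, ℂ)) :
    l2inner f (mulOp a g) = l2inner (mulOp a f) g := by
  rw [l2inner_eq_integral, l2inner_eq_integral]
  refine integral_congr_ae (.of_forall fun w => ?_)
  simp only [mulOp_apply ha, map_mul, hreal]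
  ring

end HasTemperateGrowth

theorem l2inner_lineDeriv_right [(volume : Measure E).IsAddHaarMeasure] (v : E)
    (f g : 𝓢(E, ℂ)) : l2inner f (∂_{v} g) = -l2inner (∂_{v} f) g := by
  rw [l2inner_eq_integral, l2inner_eq_integral]
  exact integral_bilinear_lineDerivOp_right_eq_neg_left f g
    ((ContinuousLinearMap.mul ℝ ℂ).comp Complex.conjCLE.toContinuousLinearMap) v

end Multiplication

section PartialFourier

variable {E F : Type} [NormedAddCommGroup E] [NormedSpace ℝ E]
  [NormedAddCommGroup F] [InnerProductSpace ℝ F]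

theorem hasTemperateGrowth_inner_snd (v : F) :
    (fun w : E × F => (⟪w.2, v⟫_ℝ : ℂ)).HasTemperateGrowth :=
  (Complex.ofRealCLM.comp (((innerSL ℝ).flip v).comp
    (ContinuousLinearMap.snd ℝ E F))).hasTemperateGrowth

theorem hasTemperateGrowth_comp_fst {a : E → ℂ} (ha : a.HasTemperateGrowth) :
    (fun w : E × F => a w.1).HasTemperateGrowth :=
  ha.comp (ContinuousLinearMap.fst ℝ E F).hasTemperateGrowth

variable [FiniteDimensional ℝ F]

section

variable [MeasurableSpace F] [BorelSpace F]

theorem partialFourier_lineDeriv_snd (v : F) (f : 𝓢(E × F, ℂ)) :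
    partialFourier (∂_{((0, v) : E × F)} f) =
      (2 * Real.pi * Complex.I) • mulOp (fun w => (⟪w.2, v⟫_ℝ : ℂ)) (partialFourier f) := by
  refine ext_slice fun x => ?_
  rw [slice_partialFourier, slice_lineDeriv_snd, fourier_lineDerivOp_eq]
  ext p
  have hinner : (fun p : F => ⟪p, v⟫_ℝ).HasTemperateGrowth := by fun_prop
  rw [slice_apply, _root_.smul_apply, _root_.smul_apply,
    mulOp_apply (hasTemperateGrowth_inner_snd v), smulLeftCLM_apply_apply hinner,
    ← slice_partialFourier, slice_apply]
  simp

theorem partialFourier_mulOp_fst {a : E → ℂ} (ha : a.HasTemperateGrowth) (f : 𝓢(E × F, ℂ)) :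
    partialFourier (mulOp (fun w => a w.1) f) = mulOp (fun w => a w.1) (partialFourier f) := by
  have hslice (x : E) (g : 𝓢(E × F, ℂ)) :
      slice x (mulOp (fun w => a w.1) g) = a x • slice x g := by
    ext p
    rw [slice_apply, mulOp_apply (hasTemperateGrowth_comp_fst ha)]
    rfl
  refine ext_slice fun x => ?_
  rw [slice_partialFourier, hslice, hslice, FourierTransform.fourier_smul, slice_partialFourier]

end

variable [FiniteDimensional ℝ E] [MeasureSpace E] [BorelSpace E]
  [(volume : Measure E).IsAddHaarMeasure]
  [MeasurableSpace F] [BorelSpace F]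
  {H : Type} [NormedAddCommGroup H] [InnerProductSpace ℂ H]

theorem l2inner_eq_integral_slice (f g : 𝓢(E × F, H)) :
    l2inner f g = ∫ x, l2inner (slice x f) (slice x g) := by
  have hint : Integrable (fun w => ⟪f w, g w⟫_ℂ) :=
    (L2.integrable_inner (𝕜 := ℂ) (f.toLp 2 volume) (g.toLp 2 volume)).congr <| by
      filter_upwards [f.coeFn_toLp 2 volume, g.coeFn_toLp 2 volume] with w hf hg
      rw [hf, hg]
  rw [l2inner, inner_toL2_toL2_eq f g volume, Measure.volume_eq_prod, integral_prod _ hint]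
  simp only [l2inner, inner_toL2_toL2_eq, slice_apply]

variable [CompleteSpace H]

theorem l2inner_partialFourier (f g : 𝓢(E × F, H)) :
    l2inner (partialFourier f) (partialFourier g) = l2inner f g := by
  rw [l2inner_eq_integral_slice, l2inner_eq_integral_slice]
  simp only [slice_partialFourier, l2inner, inner_fourier_toL2_eq]

theorem l2norm_partialFourier (f : 𝓢(E × F, H)) : l2norm (partialFourier f) = l2norm f := by
  rw [← sq_eq_sq₀ (l2norm_nonneg _) (l2norm_nonneg _), l2norm_sq, l2norm_sq,
    l2inner_partialFourier]

end PartialFourier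

variable {d : ℕ}

-- Instance search does not see through `Space d` to find this.
instance isAddHaarMeasure_volume_phaseSpace :
    (volume : Measure (Space d × Space d)).IsAddHaarMeasure :=
  isAddHaarMeasure_volume_prod

section Directions

/-- The `j`-th position direction in phase space. -/
def posDir (j : Fin d) : Space d × Space d := (EuclideanSpace.single j 1, 0)

/-- The `j`-th momentum direction in phase space. -/
def momDir (j : Fin d) : Space d × Space d := (0, EuclideanSpace.single j 1)

theorem sum_smul_single (y : Space d) : ∑ j, y j • EuclideanSpace.single j (1 : ℝ) = y := by
  simpa using (EuclideanSpace.basisFun (Fin d) ℝ).sum_repr y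

theorem sum_smul_posDir (y : Space d) : ∑ j, y j • posDir j = (y, 0) := by
  refine Prod.ext ?_ ?_
  · simpa [posDir, Prod.fst_sum] using sum_smul_single y
  · simp [posDir, Prod.snd_sum]

theorem sum_smul_momDir (y : Space d) : ∑ j, y j • momDir j = (0, y) := by
  refine Prod.ext ?_ ?_
  · simp [momDir, Prod.fst_sum]
  · simpa [momDir, Prod.snd_sum] using sum_smul_single y

theorem norm_le_sum_abs_coord (y : Space d) : ‖y‖ ≤ ∑ j, |y j| :=
  calc ‖y‖ = ‖∑ j, y j • EuclideanSpace.single j (1 : ℝ)‖ := by rw [sum_smul_single]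
    _ ≤ ∑ j, ‖y j • EuclideanSpace.single j (1 : ℝ)‖ := norm_sum_le _ _
    _ = ∑ j, |y j| := by simp [norm_smul]

theorem norm_partialFourier_lineDeriv_momDir (j : Fin d) (f : PhaseFun d)
    (w : Space d × Space d) :
    ‖partialFourier (∂_{momDir j} f) w‖ =
      |((2 * Real.pi) • w.2) j| * ‖partialFourier f w‖ := by
  rw [momDir, partialFourier_lineDeriv_snd, _root_.smul_apply,
    mulOp_apply (hasTemperateGrowth_inner_snd _)]
  simp [abs_mul, abs_of_pos Real.pi_pos, EuclideanSpace.inner_single_right]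
  ring

theorem norm_snd_mul_norm_partialFourier_le (f : PhaseFun d) (w : Space d × Space d) :
    ‖(2 * Real.pi) • w.2‖ * ‖partialFourier f w‖ ≤
      ∑ j : Fin d, ‖partialFourier (∂_{momDir j} f) w‖ := by
  simp only [norm_partialFourier_lineDeriv_momDir, ← Finset.sum_mul]
  gcongr
  exact norm_le_sum_abs_coord _

theorem norm_snd_sq_mul_norm_partialFourier (f : PhaseFun d) (w : Space d × Space d) :
    ‖(2 * Real.pi) • w.2‖ ^ 2 * ‖partialFourier f w‖ =
      ∑ j : Fin d, ‖partialFourier (∂_{momDir j} (∂_{momDir j} f)) w‖ := by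
  simp only [norm_partialFourier_lineDeriv_momDir, ← mul_assoc, ← Finset.sum_mul,
    EuclideanSpace.norm_sq_eq, Real.norm_eq_abs, sq_abs, ← sq]

end Directions

section Symbol

/-- The symbol of the Wigner operator of the potential `W`: after the Fourier transform `𝓕` in the
momentum, whose kernel is `exp (-2πi p·y)`, the operator is the multiplication by `i` times this
function of `(x, y)`. -/
def wignerSymbol (W : Space d → ℂ) (ε : ℝ) (w : Space d × Space d) : ℂ :=
  (W (w.1 + (ε / 2) • ((2 * Real.pi) • w.2)) - W (w.1 - (ε / 2) • ((2 * Real.pi) • w.2))) / ε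

/-- The linear map `(x, y) ↦ x + c y`. -/
def fstAddSMulSnd (c : ℝ) : (Space d × Space d) →L[ℝ] Space d :=
  ContinuousLinearMap.fst ℝ (Space d) (Space d) + c • ContinuousLinearMap.snd ℝ (Space d) (Space d)

theorem wignerSymbol_eq_sub_mul (W : Space d → ℂ) (ε : ℝ) :
    wignerSymbol W ε = fun w => (W (fstAddSMulSnd (ε / 2 * (2 * Real.pi)) w) -
      W (fstAddSMulSnd (-(ε / 2 * (2 * Real.pi))) w)) * (ε : ℂ)⁻¹ := by
  ext w
  simp [wignerSymbol, fstAddSMulSnd, smul_smul, div_eq_mul_inv, sub_eq_add_neg]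

theorem hasTemperateGrowth_wignerSymbol {W : Space d → ℂ} (hW : W.HasTemperateGrowth) (ε : ℝ) :
    (wignerSymbol W ε).HasTemperateGrowth := by
  have hcomp (c : ℝ) : (fun w => W (fstAddSMulSnd c w)).HasTemperateGrowth :=
    hW.comp (fstAddSMulSnd c).hasTemperateGrowth
  rw [wignerSymbol_eq_sub_mul]
  exact ((hcomp _).sub (hcomp _)).mul (.const _)

theorem fderiv_wignerSymbol {W : Space d → ℂ} (hW : Differentiable ℝ W) (ε : ℝ) (v : Space d)
    (w : Space d × Space d) :
    fderiv ℝ (wignerSymbol W ε) w (v, 0) = wignerSymbol (fun x => fderiv ℝ W x v) ε w := by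
  have hcomp (c : ℝ) : HasFDerivAt (fun w => W (fstAddSMulSnd c w))
      ((fderiv ℝ W (fstAddSMulSnd c w)).comp (fstAddSMulSnd c)) w :=
    (hW _).hasFDerivAt.comp w (fstAddSMulSnd c).hasFDerivAt
  have hsub := ((hcomp (ε / 2 * (2 * Real.pi))).fun_sub
    (hcomp (-(ε / 2 * (2 * Real.pi))))).mul_const ((ε : ℂ)⁻¹)
  rw [wignerSymbol_eq_sub_mul, wignerSymbol_eq_sub_mul, hsub.fderiv]
  simp [fstAddSMulSnd, mul_comm]

theorem norm_wignerSymbol_le {W : Space d → ℂ} (hW : Differentiable ℝ W) {C : ℝ}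
    (hC : ∀ x, ‖fderiv ℝ W x‖ ≤ C) {ε : ℝ} (hε : 0 < ε) (w : Space d × Space d) :
    ‖wignerSymbol W ε w‖ ≤ C * ‖(2 * Real.pi) • w.2‖ := by
  set y := (2 * Real.pi) • w.2 with hy
  have hdisplacement : w.1 + (ε / 2) • y - (w.1 - (ε / 2) • y) = ε • y := by module
  rw [wignerSymbol, ← hy, norm_div, Complex.norm_real, Real.norm_of_nonneg hε.le, div_le_iff₀ hε]
  calc _ ≤ C * ‖w.1 + (ε / 2) • y - (w.1 - (ε / 2) • y)‖ :=
        convex_univ.norm_image_sub_le_of_norm_fderiv_le (𝕜 := ℝ) (fun x _ => hW x)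
          (fun x _ => hC x) (Set.mem_univ _) (Set.mem_univ _)
    _ = C * ‖y‖ * ε := by rw [hdisplacement, norm_smul, Real.norm_of_nonneg hε.le]; ring

theorem norm_wignerSymbol_sub_fderiv_le {W : Space d → ℂ} (hW : Differentiable ℝ W) {C : ℝ}
    (hC : ∀ x y, ‖fderiv ℝ W x - fderiv ℝ W y‖ ≤ C * ‖x - y‖) (hC0 : 0 ≤ C) {ε : ℝ} (hε : 0 < ε)
    (w : Space d × Space d) :
    ‖wignerSymbol W ε w - fderiv ℝ W w.1 ((2 * Real.pi) • w.2)‖ ≤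
      C * ε * ‖(2 * Real.pi) • w.2‖ ^ 2 := by
  set y := (2 * Real.pi) • w.2 with hy
  set h := (ε / 2) • y with hh
  have hdisplacement : w.1 + h - (w.1 - h) = ε • y := by rw [hh]; module
  have hball : ∀ z ∈ Metric.closedBall w.1 ‖h‖, ‖fderiv ℝ W z - fderiv ℝ W w.1‖ ≤ C * ‖h‖ :=
    fun z hz => (hC z w.1).trans (by rw [mem_closedBall_iff_norm] at hz; gcongr)
  have htaylor := (convex_closedBall w.1 ‖h‖).norm_image_sub_le_of_norm_fderiv_le' (𝕜 := ℝ)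
    (fun x _ => hW x) hball (x := w.1 - h) (y := w.1 + h) (by simp) (by simp)
  rw [hdisplacement, map_smul] at htaylor
  have hsymbol : wignerSymbol W ε w - fderiv ℝ W w.1 y =
      (W (w.1 + h) - W (w.1 - h) - ε • fderiv ℝ W w.1 y) / ε := by
    have : (ε : ℂ) ≠ 0 := by exact_mod_cast hε.ne'
    rw [wignerSymbol, ← hy, ← hh, Complex.real_smul]
    field_simp
  rw [hsymbol, norm_div, Complex.norm_real, Real.norm_of_nonneg hε.le, div_le_iff₀ hε]
  refine htaylor.trans ?_
  rw [hh, norm_smul (ε / 2) y, norm_smul ε y, Real.norm_of_nonneg hε.le,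
    Real.norm_of_nonneg (by positivity : 0 ≤ ε / 2)]
  have : 0 ≤ C * (ε ^ 2 * ‖y‖ ^ 2) := by positivity
  nlinarith

end Symbol

section WignerOperator

/-- The Wigner operator of a potential `W` of temperate growth, as an operator on Schwartz
functions. Complex potentials occur when it is tested against plane waves. -/
def wignerCLM (W : Space d → ℂ) (ε : ℝ) : PhaseFun d →L[ℂ] PhaseFun d :=
  Complex.I • partialFourierInv.comp ((mulOp (wignerSymbol W ε)).comp partialFourier)

theorem wignerCLM_apply (W : Space d → ℂ) (ε : ℝ) (f : PhaseFun d) :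
    wignerCLM W ε f =
      Complex.I • partialFourierInv (mulOp (wignerSymbol W ε) (partialFourier f)) := rfl

theorem partialFourier_wignerCLM (W : Space d → ℂ) (ε : ℝ) (f : PhaseFun d) :
    partialFourier (wignerCLM W ε f) =
      Complex.I • mulOp (wignerSymbol W ε) (partialFourier f) := by
  rw [wignerCLM_apply, map_smul, partialFourier_partialFourierInv]

theorem lineDeriv_fst_wignerCLM {W : Space d → ℂ} (hW : W.HasTemperateGrowth) (ε : ℝ) (v : Space d)
    (hW' : (fun x => fderiv ℝ W x v).HasTemperateGrowth) (f : PhaseFun d) :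
    ∂_{((v, 0) : Space d × Space d)} (wignerCLM W ε f) =
      wignerCLM W ε (∂_{((v, 0) : Space d × Space d)} f) +
        wignerCLM (fun x => fderiv ℝ W x v) ε f := by
  apply partialFourier_injective
  rw [map_add, ← lineDeriv_fst_partialFourier, partialFourier_wignerCLM, partialFourier_wignerCLM,
    partialFourier_wignerCLM, LineDeriv.lineDerivOp_smul,
    lineDeriv_mulOp (hasTemperateGrowth_wignerSymbol hW ε) (hasTemperateGrowth_wignerSymbol hW' ε)
      _ (fderiv_wignerSymbol (hW.1.differentiable (by simp)) ε v),
    smul_add, lineDeriv_fst_partialFourier]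

theorem lineDeriv_snd_wignerCLM {W : Space d → ℂ} (hW : W.HasTemperateGrowth) (ε : ℝ) (v : Space d)
    (f : PhaseFun d) :
    ∂_{((0, v) : Space d × Space d)} (wignerCLM W ε f) =
      wignerCLM W ε (∂_{((0, v) : Space d × Space d)} f) := by
  apply partialFourier_injective
  rw [partialFourier_lineDeriv_snd, partialFourier_wignerCLM, partialFourier_wignerCLM,
    partialFourier_lineDeriv_snd]
  ext w
  simp only [_root_.smul_apply, map_smul, mulOp_apply (hasTemperateGrowth_inner_snd v),
    mulOp_apply (hasTemperateGrowth_wignerSymbol hW ε), smul_eq_mul]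
  ring

theorem hasTemperateGrowth_conj {W : Space d → ℂ} (hW : W.HasTemperateGrowth) :
    (fun x => (starRingEnd ℂ) (W x)).HasTemperateGrowth :=
  Function.HasTemperateGrowth.comp
    (Complex.conjCLE.toContinuousLinearMap.hasTemperateGrowth (E := ℂ) (F := ℂ)) hW

theorem l2inner_wignerCLM_right {W : Space d → ℂ} (hW : W.HasTemperateGrowth) (ε : ℝ)
    (f g : PhaseFun d) :
    l2inner g (wignerCLM W ε f) = -l2inner (wignerCLM (fun x => (starRingEnd ℂ) (W x)) ε g) f := by
  rw [← l2inner_partialFourier, ← l2inner_partialFourier (wignerCLM _ _ _),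
    partialFourier_wignerCLM, partialFourier_wignerCLM, l2inner_eq_integral, l2inner_eq_integral,
    ← integral_neg]
  refine integral_congr_ae (.of_forall fun w => ?_)
  have hsymbol : (starRingEnd ℂ) (wignerSymbol (fun x => (starRingEnd ℂ) (W x)) ε w) =
      wignerSymbol W ε w := by
    simp [wignerSymbol]
  simp only [_root_.smul_apply, mulOp_apply (hasTemperateGrowth_wignerSymbol hW ε),
    mulOp_apply (hasTemperateGrowth_wignerSymbol (hasTemperateGrowth_conj hW) ε),
    smul_eq_mul, map_mul, Complex.conj_I, hsymbol]
  ring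

theorem re_l2inner_wignerCLM_self {V : Space d → ℝ} (hV : (fun x => (V x : ℂ)).HasTemperateGrowth)
    (ε : ℝ) (f : PhaseFun d) : (l2inner f (wignerCLM (fun x => (V x : ℂ)) ε f)).re = 0 := by
  have hskew := congrArg Complex.re (l2inner_wignerCLM_right hV ε f f)
  simp only [Complex.conj_ofReal] at hskew
  rw [← l2inner_conj_symm, Complex.neg_re, Complex.conj_re] at hskew
  rw [← l2inner_conj_symm, Complex.conj_re]
  linarith

theorem l2norm_wignerCLM_le {W : Space d → ℂ} (hW : W.HasTemperateGrowth) {C : ℝ}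
    (hC : ∀ x, ‖fderiv ℝ W x‖ ≤ C) {ε : ℝ} (hε : 0 < ε) (f : PhaseFun d) :
    l2norm (wignerCLM W ε f) ≤ C * ∑ j : Fin d, l2norm (∂_{momDir j} f) := by
  have hC0 : 0 ≤ C := (norm_nonneg _).trans (hC 0)
  have hpointwise (w : Space d × Space d) : ‖partialFourier (wignerCLM W ε f) w‖ ≤
      C * ∑ j : Fin d, ‖partialFourier (∂_{momDir j} f) w‖ :=
    calc ‖partialFourier (wignerCLM W ε f) w‖
        = ‖wignerSymbol W ε w‖ * ‖partialFourier f w‖ := by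
          rw [partialFourier_wignerCLM, _root_.smul_apply,
            mulOp_apply (hasTemperateGrowth_wignerSymbol hW ε)]
          simp
      _ ≤ C * ‖(2 * Real.pi) • w.2‖ * ‖partialFourier f w‖ := by
          gcongr
          exact norm_wignerSymbol_le (hW.1.differentiable (by simp)) hC hε w
      _ ≤ C * ∑ j : Fin d, ‖partialFourier (∂_{momDir j} f) w‖ := by
          rw [mul_assoc]
          gcongr
          exact norm_snd_mul_norm_partialFourier_le f w
  simpa only [l2norm_partialFourier] using l2norm_le_mul_sum _ _ _ C hC0 hpointwise

theorem wignerSymbol_ofReal (V : Space d → ℝ) (ε : ℝ) (x y : Space d) :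
    wignerSymbol (fun x => (V x : ℂ)) ε (x, y) =
      (potentialDiff V ε x ((2 * Real.pi) • y) : ℂ) := by
  simp [wignerSymbol, potentialDiff]

theorem exp_inner_two_pi_smul_sub (y k p : Space d) :
    Complex.exp (Complex.I * (⟪(2 * Real.pi) • y, k - p⟫_ℝ : ℂ)) =
      (𝐞 ⟪y, k⟫_ℝ : ℂ) * (𝐞 (-⟪p, y⟫_ℝ) : ℂ) := by
  rw [Real.fourierChar_apply, Real.fourierChar_apply, ← Complex.exp_add, real_inner_smul_left,
    inner_sub_right, real_inner_comm p y]
  push_cast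
  ring_nf

theorem integral_eq_two_pi_pow_mul_integral_comp_smul (h : Space d → ℂ) :
    ∫ y, h y = (2 * (Real.pi : ℂ)) ^ d * ∫ y : Space d, h ((2 * Real.pi) • y) := by
  have hne : (2 * (Real.pi : ℂ)) ^ d ≠ 0 := by simp [Real.pi_ne_zero]
  rw [Measure.integral_comp_smul, finrank_euclideanSpace, Fintype.card_fin,
    abs_of_pos (by positivity), Complex.real_smul, ← mul_assoc]
  push_cast
  rw [mul_inv_cancel₀ hne, one_mul]

theorem wignerOp_eq_wignerCLM {V : Space d → ℝ} (hV : (fun x => (V x : ℂ)).HasTemperateGrowth)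
    (ε : ℝ) (f : PhaseFun d) (x k : Space d) :
    wignerOp V ε f x k = wignerCLM (fun x => (V x : ℂ)) ε f (x, k) := by
  have hne : (2 * (Real.pi : ℂ)) ^ d ≠ 0 := by simp [Real.pi_ne_zero]
  rw [wignerOp, integral_eq_two_pi_pow_mul_integral_comp_smul, ← mul_assoc, div_mul_cancel₀ _ hne,
    wignerCLM_apply, _root_.smul_apply, partialFourierInv_apply, smul_eq_mul]
  refine congrArg _ (integral_congr_ae (.of_forall fun y => ?_))
  beta_reduce
  rw [mulOp_apply (hasTemperateGrowth_wignerSymbol hV ε), partialFourier_apply,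
    wignerSymbol_ofReal, Circle.smul_def, smul_eq_mul, ← integral_const_mul, ← integral_const_mul,
    ← integral_const_mul]
  refine integral_congr_ae (.of_forall fun p => ?_)
  beta_reduce
  rw [exp_inner_two_pi_smul_sub, Circle.smul_def, smul_eq_mul]
  ring

end WignerOperator

section Force

/-- The force operator `∇W · ∇ₖ`, the classical limit of the Wigner operator. -/
def forceCLM (W : Space d → ℂ) : PhaseFun d →L[ℂ] PhaseFun d :=
  ∑ j, (mulOp fun w => fderiv ℝ W w.1 (EuclideanSpace.single j 1)).comp
    (LineDeriv.lineDerivOpCLM ℂ (PhaseFun d) (momDir j))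

theorem forceCLM_eq_sum (W : Space d → ℂ) (f : PhaseFun d) :
    forceCLM W f = ∑ j, mulOp (fun w => fderiv ℝ W w.1 (EuclideanSpace.single j 1))
      (∂_{momDir j} f) := by
  simp [forceCLM]

theorem partialFourier_forceCLM_apply {W : Space d → ℂ}
    (hW' : ∀ v, (fun x => fderiv ℝ W x v).HasTemperateGrowth) (f : PhaseFun d)
    (w : Space d × Space d) :
    partialFourier (forceCLM W f) w =
      Complex.I * fderiv ℝ W w.1 ((2 * Real.pi) • w.2) * partialFourier f w := by
  rw [forceCLM_eq_sum, map_sum, _root_.sum_apply, ← sum_smul_single ((2 * Real.pi) • w.2), map_sum,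
    Finset.mul_sum, Finset.sum_mul]
  refine Finset.sum_congr rfl fun j _ => ?_
  rw [partialFourier_mulOp_fst (a := fun x => fderiv ℝ W x (EuclideanSpace.single j 1)) (hW' _),
    mulOp_apply (hasTemperateGrowth_comp_fst (hW' _)), momDir, partialFourier_lineDeriv_snd,
    _root_.smul_apply, mulOp_apply (hasTemperateGrowth_inner_snd _), map_smul]
  simp only [EuclideanSpace.inner_single_right, PiLp.smul_apply, smul_eq_mul, Complex.real_smul,
    conj_trivial, one_mul, Complex.ofReal_mul, Complex.ofReal_ofNat]
  ring

theorem l2norm_wignerCLM_sub_forceCLM_le {W : Space d → ℂ} (hW : W.HasTemperateGrowth)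
    (hW' : ∀ v, (fun x => fderiv ℝ W x v).HasTemperateGrowth) {C : ℝ} (hC0 : 0 ≤ C)
    (hC : ∀ x y, ‖fderiv ℝ W x - fderiv ℝ W y‖ ≤ C * ‖x - y‖) {ε : ℝ} (hε : 0 < ε)
    (f : PhaseFun d) :
    l2norm (wignerCLM W ε f - forceCLM W f) ≤
      C * ε * ∑ j : Fin d, l2norm (∂_{momDir j} (∂_{momDir j} f)) := by
  have hpointwise (w : Space d × Space d) : ‖partialFourier (wignerCLM W ε f - forceCLM W f) w‖ ≤
      C * ε * ∑ j : Fin d, ‖partialFourier (∂_{momDir j} (∂_{momDir j} f)) w‖ :=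
    calc ‖partialFourier (wignerCLM W ε f - forceCLM W f) w‖
        = ‖wignerSymbol W ε w - fderiv ℝ W w.1 ((2 * Real.pi) • w.2)‖ * ‖partialFourier f w‖ := by
          rw [map_sub, partialFourier_wignerCLM, _root_.sub_apply, _root_.smul_apply,
            mulOp_apply (hasTemperateGrowth_wignerSymbol hW ε), partialFourier_forceCLM_apply hW',
            smul_eq_mul, ← mul_assoc, ← sub_mul, ← mul_sub, norm_mul, norm_mul, Complex.norm_I,
            one_mul]
      _ ≤ C * ε * ‖(2 * Real.pi) • w.2‖ ^ 2 * ‖partialFourier f w‖ := by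
          gcongr
          exact norm_wignerSymbol_sub_fderiv_le (hW.1.differentiable (by simp)) hC hC0 hε w
      _ = C * ε * ∑ j : Fin d, ‖partialFourier (∂_{momDir j} (∂_{momDir j} f)) w‖ := by
          rw [mul_assoc, norm_snd_sq_mul_norm_partialFourier]
  simpa only [l2norm_partialFourier] using
    l2norm_le_mul_sum _ _ _ (C * ε) (by positivity) hpointwise

end Force

section Transport

theorem hasTemperateGrowth_momCoord (j : Fin d) :
    (fun w : Space d × Space d => (w.2 j : ℂ)).HasTemperateGrowth :=
  (Complex.ofRealCLM.comp ((EuclideanSpace.proj j).comp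
    (ContinuousLinearMap.snd ℝ (Space d) (Space d)))).hasTemperateGrowth

theorem fderiv_momCoord (j : Fin d) (v w : Space d × Space d) :
    fderiv ℝ (fun w : Space d × Space d => (w.2 j : ℂ)) w v = (v.2 j : ℂ) :=
  congrArg (· v) (Complex.ofRealCLM.comp ((EuclideanSpace.proj j).comp
    (ContinuousLinearMap.snd ℝ (Space d) (Space d)))).fderiv

/-- The free transport operator `k · ∇ₓ`. -/
def transportCLM : PhaseFun d →L[ℂ] PhaseFun d :=
  ∑ j, (mulOp fun w => (w.2 j : ℂ)).comp (LineDeriv.lineDerivOpCLM ℂ (PhaseFun d) (posDir j))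

theorem transportCLM_eq_sum (f : PhaseFun d) :
    transportCLM f = ∑ j, mulOp (fun w => (w.2 j : ℂ)) (∂_{posDir j} f) := by
  simp [transportCLM]

theorem transportCLM_apply (f : PhaseFun d) (x k : Space d) :
    transportCLM f (x, k) = fderiv ℝ f (x, k) (k, 0) := by
  rw [transportCLM_eq_sum, _root_.sum_apply, ← sum_smul_posDir, map_sum]
  refine Finset.sum_congr rfl fun j _ => ?_
  rw [mulOp_apply (hasTemperateGrowth_momCoord j), lineDerivOp_apply_eq_fderiv, map_smul,
    Complex.real_smul]

theorem l2inner_momCoord_lineDeriv_posDir_right (j : Fin d) (f g : PhaseFun d) :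
    l2inner f (mulOp (fun w => (w.2 j : ℂ)) (∂_{posDir j} g)) =
      -l2inner (mulOp (fun w => (w.2 j : ℂ)) (∂_{posDir j} f)) g := by
  rw [l2inner_mulOp_right (hasTemperateGrowth_momCoord j) (fun _ => Complex.conj_ofReal _),
    l2inner_lineDeriv_right, lineDeriv_mulOp_of_fderiv_eq_zero (hasTemperateGrowth_momCoord j)]
  exact fun w => by simp [fderiv_momCoord, posDir]

theorem re_l2inner_transportCLM_self (f : PhaseFun d) : (l2inner f (transportCLM f)).re = 0 := by
  rw [transportCLM_eq_sum, l2inner_sum_right, Complex.re_sum]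
  refine Finset.sum_eq_zero fun j _ => ?_
  have hskew := congrArg Complex.re (l2inner_momCoord_lineDeriv_posDir_right j f f)
  rw [← l2inner_conj_symm, Complex.neg_re, Complex.conj_re] at hskew
  rw [← l2inner_conj_symm, Complex.conj_re]
  linarith

theorem lineDeriv_transportCLM (v : Space d × Space d) (f : PhaseFun d) :
    ∂_{v} (transportCLM f) = transportCLM (∂_{v} f) + ∂_{((v.2, 0) : Space d × Space d)} f := by
  rw [transportCLM_eq_sum, transportCLM_eq_sum, LineDeriv.lineDerivOp_sum, ← sum_smul_posDir,
    LineDeriv.lineDerivOp_left_sum, ← Finset.sum_add_distrib]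
  refine Finset.sum_congr rfl fun j _ => ?_
  rw [lineDeriv_mulOp (hasTemperateGrowth_momCoord j) (.const (v.2 j : ℂ)) v (fderiv_momCoord j v),
    lineDeriv_comm, LineDeriv.lineDerivOp_left_smul]
  congr 1
  ext w
  rw [mulOp_apply (.const _)]
  simp

end Transport

section Energy

variable {E H ι : Type*} [NormedAddCommGroup E] [NormedSpace ℝ E] [MeasureSpace E] [BorelSpace E]
  [SecondCountableTopology E] [(volume : Measure E).HasTemperateGrowth]
  [NormedAddCommGroup H] [InnerProductSpace ℂ H] [Fintype ι] (e : ι → E)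

/-- The sum of the squared `L²` norms of all iterated derivatives of order at most `m` in the
directions `e`. -/
def energy : ℕ → 𝓢(E, H) → ℝ
  | 0, f => l2norm f ^ 2
  | m + 1, f => l2norm f ^ 2 + ∑ a, energy m (∂_{e a} f)

/-- Twice the real part of the polar form of `energy`: the derivative of `energy e m` at `f` in the
direction `g`. -/
def energyDot : ℕ → 𝓢(E, H) → 𝓢(E, H) → ℝ
  | 0, f, g => 2 * (l2inner f g).re
  | m + 1, f, g => 2 * (l2inner f g).re + ∑ a, energyDot m (∂_{e a} f) (∂_{e a} g)

theorem l2norm_add_sq_le (f g : 𝓢(E, H)) :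
    l2norm (f + g) ^ 2 ≤ 2 * l2norm f ^ 2 + 2 * l2norm g ^ 2 :=
  calc l2norm (f + g) ^ 2 ≤ (l2norm f + l2norm g) ^ 2 :=
        pow_le_pow_left₀ (l2norm_nonneg _) (l2norm_add_le f g) 2
    _ ≤ 2 * l2norm f ^ 2 + 2 * l2norm g ^ 2 := (add_sq_le).trans_eq (mul_add _ _ _)

theorem abs_two_mul_re_l2inner_le (f g : 𝓢(E, H)) :
    |2 * (l2inner f g).re| ≤ l2norm f ^ 2 + l2norm g ^ 2 :=
  calc |2 * (l2inner f g).re| = 2 * |(l2inner f g).re| := by rw [abs_mul, abs_two]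
    _ ≤ 2 * (l2norm f * l2norm g) := by
        gcongr
        exact (Complex.abs_re_le_norm _).trans (norm_l2inner_le f g)
    _ ≤ l2norm f ^ 2 + l2norm g ^ 2 := by rw [← mul_assoc]; exact two_mul_le_add_sq _ _

theorem energy_nonneg (m : ℕ) (f : 𝓢(E, H)) : 0 ≤ energy e m f := by
  induction m generalizing f with
  | zero => exact sq_nonneg _
  | succ m ih => exact add_nonneg (sq_nonneg _) (Finset.sum_nonneg fun a _ => ih _)

theorem energy_le_succ (m : ℕ) (f : 𝓢(E, H)) : energy e m f ≤ energy e (m + 1) f := by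
  induction m generalizing f with
  | zero => exact le_add_of_nonneg_right (Finset.sum_nonneg fun a _ => sq_nonneg _)
  | succ m ih => exact add_le_add le_rfl (Finset.sum_le_sum fun a _ => ih _)

theorem energy_mono (f : 𝓢(E, H)) : Monotone fun m => energy e m f :=
  monotone_nat_of_le_succ fun m => energy_le_succ e m f

theorem l2norm_sq_le_energy (m : ℕ) (f : 𝓢(E, H)) : l2norm f ^ 2 ≤ energy e m f :=
  energy_mono e f m.zero_le

theorem energy_lineDeriv_le (m : ℕ) (a : ι) (f : 𝓢(E, H)) :
    energy e m (∂_{e a} f) ≤ energy e (m + 1) f :=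
  (Finset.single_le_sum (fun a _ => energy_nonneg e m (∂_{e a} f)) (Finset.mem_univ a)).trans
    (le_add_of_nonneg_left (sq_nonneg _))

theorem energy_add_le (m : ℕ) (f g : 𝓢(E, H)) :
    energy e m (f + g) ≤ 2 * energy e m f + 2 * energy e m g := by
  induction m generalizing f g with
  | zero => exact l2norm_add_sq_le f g
  | succ m ih =>
    simp only [energy, LineDeriv.lineDerivOp_add]
    calc _ ≤ (2 * l2norm f ^ 2 + 2 * l2norm g ^ 2) +
          ∑ a, (2 * energy e m (∂_{e a} f) + 2 * energy e m (∂_{e a} g)) :=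
        add_le_add (l2norm_add_sq_le f g) (Finset.sum_le_sum fun a _ => ih _ _)
      _ = _ := by
        rw [Finset.sum_add_distrib, ← Finset.mul_sum, ← Finset.mul_sum]
        ring

theorem energy_neg (m : ℕ) (f : 𝓢(E, H)) : energy e m (-f) = energy e m f := by
  induction m generalizing f with
  | zero => simp only [energy, l2norm_neg]
  | succ m ih => simp only [energy, l2norm_neg, LineDeriv.lineDerivOp_neg, ih]

theorem abs_energyDot_le (m : ℕ) (f g : 𝓢(E, H)) :
    |energyDot e m f g| ≤ energy e m f + energy e m g := by
  induction m generalizing f g with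
  | zero => exact abs_two_mul_re_l2inner_le f g
  | succ m ih =>
    simp only [energy, energyDot]
    calc _ ≤ |2 * (l2inner f g).re| + ∑ a, |energyDot e m (∂_{e a} f) (∂_{e a} g)| :=
        (abs_add_le _ _).trans (add_le_add_right (Finset.abs_sum_le_sum_abs _ _) _)
      _ ≤ (l2norm f ^ 2 + l2norm g ^ 2) +
          ∑ a, (energy e m (∂_{e a} f) + energy e m (∂_{e a} g)) :=
        add_le_add (abs_two_mul_re_l2inner_le f g) (Finset.sum_le_sum fun a _ => ih _ _)
      _ = _ := by
        rw [Finset.sum_add_distrib]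
        ring

theorem energyDot_add_right (m : ℕ) (f g h : 𝓢(E, H)) :
    energyDot e m f (g + h) = energyDot e m f g + energyDot e m f h := by
  induction m generalizing f g h with
  | zero => simp only [energyDot, l2inner_add_right, Complex.add_re, mul_add]
  | succ m ih =>
    simp only [energyDot, l2inner_add_right, Complex.add_re, LineDeriv.lineDerivOp_add, ih,
      Finset.sum_add_distrib]
    ring

theorem l2norm_le_sqrt_of_energy_le {m : ℕ} {f : 𝓢(E, H)} {B : ℝ} (h : energy e m f ≤ B) :
    l2norm f ≤ √B :=
  Real.le_sqrt_of_sq_le ((l2norm_sq_le_energy e m f).trans h)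

end Energy

section PhaseEnergy

/-- The coordinate directions of phase space. -/
def coordDir : Fin d ⊕ Fin d → Space d × Space d := Sum.elim posDir momDir

theorem energy_lineDeriv_posDir_le (m : ℕ) (j : Fin d) (f : PhaseFun d) :
    energy coordDir m (∂_{posDir j} f) ≤ energy coordDir (m + 1) f :=
  energy_lineDeriv_le coordDir m (.inl j) f

theorem energy_lineDeriv_momDir_le (m : ℕ) (j : Fin d) (f : PhaseFun d) :
    energy coordDir m (∂_{momDir j} f) ≤ energy coordDir (m + 1) f :=
  energy_lineDeriv_le coordDir m (.inr j) f

theorem energy_succ_eq_sum_posDir_add_sum_momDir (m : ℕ) (f : PhaseFun d) :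
    energy coordDir (m + 1) f = l2norm f ^ 2 + (∑ j : Fin d, energy coordDir m (∂_{posDir j} f) +
      ∑ j : Fin d, energy coordDir m (∂_{momDir j} f)) := by
  simp only [energy, Fintype.sum_sum_type, coordDir, Sum.elim_inl, Sum.elim_inr]

theorem energyDot_succ_eq_sum_posDir_add_sum_momDir (m : ℕ) (f g : PhaseFun d) :
    energyDot coordDir (m + 1) f g = 2 * (l2inner f g).re +
      (∑ j : Fin d, energyDot coordDir m (∂_{posDir j} f) (∂_{posDir j} g) +
        ∑ j : Fin d, energyDot coordDir m (∂_{momDir j} f) (∂_{momDir j} g)) := by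
  simp only [energyDot, Fintype.sum_sum_type, coordDir, Sum.elim_inl, Sum.elim_inr]

theorem sum_l2norm_momDir_sq_le (f : PhaseFun d) :
    (∑ j : Fin d, l2norm (∂_{momDir j} f)) ^ 2 ≤ d * energy coordDir 1 f :=
  calc (∑ j : Fin d, l2norm (∂_{momDir j} f)) ^ 2
      ≤ d * ∑ j : Fin d, l2norm (∂_{momDir j} f) ^ 2 := by
        simpa using sq_sum_le_card_mul_sum_sq (s := Finset.univ)
          (f := fun j : Fin d => l2norm (∂_{momDir j} f))
    _ ≤ d * energy coordDir 1 f := by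
        gcongr
        rw [energy_succ_eq_sum_posDir_add_sum_momDir, ← add_assoc]
        exact le_add_of_nonneg_left (add_nonneg (sq_nonneg _)
          (Finset.sum_nonneg fun j _ => energy_nonneg _ _ _))

theorem sum_l2norm_momDir_le_sqrt {f : PhaseFun d} {B : ℝ} (h : energy coordDir 1 f ≤ B) :
    ∑ j : Fin d, l2norm (∂_{momDir j} f) ≤ √(d * B) :=
  Real.le_sqrt_of_sq_le ((sum_l2norm_momDir_sq_le f).trans (by gcongr))

end PhaseEnergy

section BoundedSmooth

/-- Smooth functions all of whose derivatives are bounded: the complex counterpart of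
`IsAdmissiblePotential`, a class which is closed under differentiation and contains the plane
waves. -/
structure IsBoundedSmooth (W : Space d → ℂ) : Prop where
  contDiff : ContDiff ℝ ∞ W
  bounded : ∀ n : ℕ, ∃ C : ℝ, ∀ x, ‖iteratedFDeriv ℝ n W x‖ ≤ C

namespace IsBoundedSmooth

variable {W : Space d → ℂ}

theorem hasTemperateGrowth (hW : IsBoundedSmooth W) : W.HasTemperateGrowth :=
  ⟨hW.contDiff, fun n => by
    obtain ⟨C, hC⟩ := hW.bounded n
    exact ⟨0, C, fun x => by simpa using hC x⟩⟩

theorem fderiv_apply (hW : IsBoundedSmooth W) (v : Space d) :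
    IsBoundedSmooth fun x => fderiv ℝ W x v := by
  have hcontDiff := (contDiff_infty_iff_fderiv.1 hW.contDiff).2
  refine ⟨hcontDiff.clm_apply contDiff_const, fun n => ?_⟩
  obtain ⟨C, hC⟩ := hW.bounded (n + 1)
  refine ⟨‖v‖ * C, fun x => ?_⟩
  calc _ ≤ ‖v‖ * ‖iteratedFDeriv ℝ n (fderiv ℝ W) x‖ :=
        norm_iteratedFDeriv_clm_apply_const (N := ∞) hcontDiff.contDiffAt (mod_cast le_top)
    _ ≤ ‖v‖ * C := by
        rw [norm_iteratedFDeriv_fderiv]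
        gcongr
        exact hC x

theorem exists_norm_fderiv_le (hW : IsBoundedSmooth W) : ∃ C, ∀ x, ‖fderiv ℝ W x‖ ≤ C := by
  simpa only [norm_iteratedFDeriv_one] using hW.bounded 1

theorem exists_lipschitz_fderiv (hW : IsBoundedSmooth W) :
    ∃ C, 0 ≤ C ∧ ∀ x y, ‖fderiv ℝ W x - fderiv ℝ W y‖ ≤ C * ‖x - y‖ := by
  obtain ⟨C, hC⟩ := hW.bounded 2
  have hdifferentiable := (contDiff_infty_iff_fderiv.1 hW.contDiff).2.differentiable (by simp)
  have hC' (x : Space d) : ‖fderiv ℝ (fderiv ℝ W) x‖ ≤ C := by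
    rw [← norm_iteratedFDeriv_one, norm_iteratedFDeriv_fderiv]
    exact hC x
  exact ⟨C, (norm_nonneg _).trans (hC 0), fun x y =>
    convex_univ.norm_image_sub_le_of_norm_fderiv_le (𝕜 := ℝ) (fun x _ => hdifferentiable x)
      (fun x _ => hC' x) (Set.mem_univ y) (Set.mem_univ x)⟩

end IsBoundedSmooth

theorem IsAdmissiblePotential.isBoundedSmooth {V : Space d → ℝ} (hV : IsAdmissiblePotential V) :
    IsBoundedSmooth fun x => (V x : ℂ) := by
  refine ⟨Complex.ofRealCLM.contDiff.comp hV.1, fun n => ?_⟩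
  obtain ⟨C, hC⟩ := hV.2 n
  exact ⟨C, fun x => (Complex.ofRealLI.norm_iteratedFDeriv_comp_left
    (hV.1.contDiffAt (x := x)) (mod_cast le_top)).trans_le (hC x)⟩

end BoundedSmooth

section WignerEnergy

variable {W : Space d → ℂ}

theorem exists_l2norm_wignerCLM_sq_le (hW : IsBoundedSmooth W) :
    ∃ C, 0 ≤ C ∧ ∀ ε, 0 < ε → ∀ f, l2norm (wignerCLM W ε f) ^ 2 ≤ C * energy coordDir 1 f := by
  obtain ⟨C, hC⟩ := hW.exists_norm_fderiv_le
  refine ⟨C ^ 2 * d, by positivity, fun ε hε f => ?_⟩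
  calc _ ≤ (C * ∑ j : Fin d, l2norm (∂_{momDir j} f)) ^ 2 :=
        pow_le_pow_left₀ (l2norm_nonneg _) (l2norm_wignerCLM_le hW.hasTemperateGrowth hC hε f) 2
    _ = C ^ 2 * (∑ j : Fin d, l2norm (∂_{momDir j} f)) ^ 2 := mul_pow _ _ _
    _ ≤ C ^ 2 * (d * energy coordDir 1 f) := by gcongr; exact sum_l2norm_momDir_sq_le f
    _ = C ^ 2 * d * energy coordDir 1 f := (mul_assoc _ _ _).symm

theorem lineDeriv_posDir_wignerCLM (hW : IsBoundedSmooth W) (ε : ℝ) (j : Fin d) (f : PhaseFun d) :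
    ∂_{posDir j} (wignerCLM W ε f) = wignerCLM W ε (∂_{posDir j} f) +
      wignerCLM (fun x => fderiv ℝ W x (EuclideanSpace.single j 1)) ε f :=
  lineDeriv_fst_wignerCLM hW.hasTemperateGrowth ε _ (hW.fderiv_apply _).hasTemperateGrowth f

theorem lineDeriv_momDir_wignerCLM (hW : IsBoundedSmooth W) (ε : ℝ) (j : Fin d) (f : PhaseFun d) :
    ∂_{momDir j} (wignerCLM W ε f) = wignerCLM W ε (∂_{momDir j} f) :=
  lineDeriv_snd_wignerCLM hW.hasTemperateGrowth ε _ f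

theorem energy_lineDeriv_posDir_wignerCLM_le (hW : IsBoundedSmooth W) {m : ℕ} {ε C D : ℝ}
    (hC0 : 0 ≤ C) (hD0 : 0 ≤ D) (j : Fin d) (f : PhaseFun d)
    (hC : ∀ f, energy coordDir m (wignerCLM W ε f) ≤ C * energy coordDir (m + 1) f)
    (hD : energy coordDir m (wignerCLM (fun x => fderiv ℝ W x (EuclideanSpace.single j 1)) ε f) ≤
      D * energy coordDir (m + 1) f) :
    energy coordDir m (∂_{posDir j} (wignerCLM W ε f)) ≤
      (2 * C + 2 * D) * energy coordDir (m + 2) f := by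
  rw [lineDeriv_posDir_wignerCLM hW]
  calc _ ≤ 2 * energy coordDir m (wignerCLM W ε (∂_{posDir j} f)) + 2 * energy coordDir m
          (wignerCLM (fun x => fderiv ℝ W x (EuclideanSpace.single j 1)) ε f) :=
        energy_add_le _ _ _ _
    _ ≤ 2 * (C * energy coordDir (m + 2) f) + 2 * (D * energy coordDir (m + 2) f) := by
        gcongr
        · exact (hC _).trans (by gcongr; exact energy_lineDeriv_posDir_le _ _ _)
        · exact hD.trans (by gcongr; exact energy_le_succ _ _ _)
    _ = (2 * C + 2 * D) * energy coordDir (m + 2) f := by ring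

theorem exists_energy_wignerCLM_le (hW : IsBoundedSmooth W) (m : ℕ) :
    ∃ C, 0 ≤ C ∧ ∀ ε, 0 < ε → ∀ f,
      energy coordDir m (wignerCLM W ε f) ≤ C * energy coordDir (m + 1) f := by
  induction m generalizing W with
  | zero => exact exists_l2norm_wignerCLM_sq_le hW
  | succ m ih =>
    obtain ⟨A, hA0, hA⟩ := exists_l2norm_wignerCLM_sq_le hW
    obtain ⟨C, hC0, hC⟩ := ih hW
    choose D hD0 hD using fun j : Fin d => ih (hW.fderiv_apply (EuclideanSpace.single j 1))
    refine ⟨A + (∑ j, (2 * C + 2 * D j) + ∑ _j : Fin d, C), ?_, fun ε hε f => ?_⟩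
    · exact add_nonneg hA0 (add_nonneg (Finset.sum_nonneg fun j _ => by linarith [hD0 j])
        (Finset.sum_nonneg fun _ _ => hC0))
    rw [energy_succ_eq_sum_posDir_add_sum_momDir, add_mul, add_mul, Finset.sum_mul, Finset.sum_mul]
    gcongr with j _ j _
    · exact (hA ε hε f).trans
        (mul_le_mul_of_nonneg_left (energy_mono coordDir f (by omega)) hA0)
    · exact energy_lineDeriv_posDir_wignerCLM_le hW hC0 (hD0 j) j f (hC ε hε) (hD j ε hε f)
    · rw [lineDeriv_momDir_wignerCLM hW]
      exact (hC ε hε _).trans (by gcongr; exact energy_lineDeriv_momDir_le _ _ _)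

/-- The generator `-k · ∇ₓ + L_W^ε` of the Wigner evolution. -/
def wignerGen (W : Space d → ℂ) (ε : ℝ) : PhaseFun d →L[ℂ] PhaseFun d :=
  wignerCLM W ε - transportCLM

theorem wignerGen_apply (W : Space d → ℂ) (ε : ℝ) (f : PhaseFun d) :
    wignerGen W ε f = wignerCLM W ε f - transportCLM f := rfl

theorem lineDeriv_posDir_wignerGen (hW : IsBoundedSmooth W) (ε : ℝ) (j : Fin d)
    (f : PhaseFun d) : ∂_{posDir j} (wignerGen W ε f) = wignerGen W ε (∂_{posDir j} f) +
      wignerCLM (fun x => fderiv ℝ W x (EuclideanSpace.single j 1)) ε f := by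
  have hsnd : (((posDir j).2, 0) : Space d × Space d) = 0 := rfl
  rw [wignerGen_apply, wignerGen_apply, sub_eq_add_neg, LineDeriv.lineDerivOp_add,
    LineDeriv.lineDerivOp_neg, lineDeriv_transportCLM, hsnd, LineDeriv.lineDerivOp_left_zero,
    lineDeriv_posDir_wignerCLM hW]
  abel

theorem lineDeriv_momDir_wignerGen (hW : IsBoundedSmooth W) (ε : ℝ) (j : Fin d)
    (f : PhaseFun d) :
    ∂_{momDir j} (wignerGen W ε f) = wignerGen W ε (∂_{momDir j} f) + -∂_{posDir j} f := by
  have hsnd : ((momDir j).2, 0) = posDir j := rfl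
  rw [wignerGen_apply, wignerGen_apply, sub_eq_add_neg, LineDeriv.lineDerivOp_add,
    LineDeriv.lineDerivOp_neg, lineDeriv_transportCLM, hsnd, lineDeriv_momDir_wignerCLM hW]
  abel

theorem abs_energyDot_add_right_le (m : ℕ) (f g h : PhaseFun d) :
    |energyDot coordDir m f (g + h)| ≤
      |energyDot coordDir m f g| + (energy coordDir m f + energy coordDir m h) := by
  rw [energyDot_add_right]
  exact (abs_add_le _ _).trans (add_le_add_right (abs_energyDot_le _ _ _ _) _)

theorem re_l2inner_wignerGen_self {V : Space d → ℝ} (hV : IsAdmissiblePotential V) (ε : ℝ)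
    (f : PhaseFun d) : (l2inner f (wignerGen (fun x => (V x : ℂ)) ε f)).re = 0 := by
  rw [wignerGen_apply, l2inner_sub_right, Complex.sub_re, re_l2inner_transportCLM_self,
    re_l2inner_wignerCLM_self hV.isBoundedSmooth.hasTemperateGrowth, sub_zero]

-- The generator is skew-adjoint, so only its commutators with the derivatives contribute.
theorem exists_energyDot_wignerGen_le {V : Space d → ℝ} (hV : IsAdmissiblePotential V) (m : ℕ) :
    ∃ C, 0 ≤ C ∧ ∀ ε, 0 < ε → ∀ f, |energyDot coordDir m f (wignerGen (fun x => (V x : ℂ)) ε f)| ≤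
      C * energy coordDir m f := by
  have hW := hV.isBoundedSmooth
  induction m with
  | zero => exact ⟨0, le_rfl, fun ε _ f => by simp [energyDot, re_l2inner_wignerGen_self hV ε f]⟩
  | succ m ih =>
    obtain ⟨C, hC0, hC⟩ := ih
    choose D hD0 hD using fun j : Fin d =>
      exists_energy_wignerCLM_le (hW.fderiv_apply (EuclideanSpace.single j 1)) m
    refine ⟨∑ j, (C + (1 + D j)) + ∑ _j : Fin d, (C + (1 + 1)), ?_, fun ε hε f => ?_⟩
    · exact add_nonneg (Finset.sum_nonneg fun j _ => by linarith [hD0 j])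
        (Finset.sum_nonneg fun _ _ => by linarith)
    rw [energyDot_succ_eq_sum_posDir_add_sum_momDir, re_l2inner_wignerGen_self hV, mul_zero,
      zero_add, add_mul, Finset.sum_mul, Finset.sum_mul]
    refine (abs_add_le _ _).trans (add_le_add ?_ ?_) <;>
      refine (Finset.abs_sum_le_sum_abs _ _).trans (Finset.sum_le_sum fun j _ => ?_)
    · rw [lineDeriv_posDir_wignerGen hW, add_mul, add_mul, one_mul]
      refine (abs_energyDot_add_right_le m _ _ _).trans ?_
      gcongr
      · exact (hC ε hε _).trans (by gcongr; exact energy_lineDeriv_posDir_le _ _ _)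
      · exact energy_lineDeriv_posDir_le _ _ _
      · exact hD j ε hε f
    · rw [lineDeriv_momDir_wignerGen hW, add_mul, add_mul, one_mul]
      refine (abs_energyDot_add_right_le m _ _ _).trans ?_
      rw [energy_neg]
      gcongr
      · exact (hC ε hε _).trans (by gcongr; exact energy_lineDeriv_momDir_le _ _ _)
      · exact energy_lineDeriv_momDir_le _ _ _
      · exact energy_lineDeriv_posDir_le _ _ _

end WignerEnergy

section Curve

variable {E F : Type*} [NormedAddCommGroup E] [NormedSpace ℝ E] [NormedAddCommGroup F]
  [NormedSpace ℝ F]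

theorem continuousOn_curve_apply {X : Type*} [TopologicalSpace X] {S : Set X} {f : X → 𝓢(E, F)}
    {w : X → E} (hf : ContinuousOn f S) (hw : ContinuousOn w S) :
    ContinuousOn (fun q => f q (w q)) S :=
  continuous_eval.comp_continuousOn
    (((toBoundedContinuousFunctionCLM ℝ E F).continuous.comp_continuousOn hf).prodMk hw)

theorem continuous_eval_curve {X : Type*} [TopologicalSpace X] {f : X → 𝓢(E, F)}
    (hf : Continuous f) : Continuous fun q : X × E => f q.1 q.2 :=
  continuousOn_univ.1 (continuousOn_curve_apply (hf.comp continuous_fst).continuousOn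
    continuous_snd.continuousOn)

theorem hasDerivAt_comp_line (g : 𝓢(E, F)) (w v : E) (r : ℝ) :
    HasDerivAt (fun r : ℝ => g (w + r • v)) (∂_{v} g (w + r • v)) r := by
  have hline : HasDerivAt (fun r : ℝ => w + r • v) v r := by
    simpa using ((hasDerivAt_id r).smul_const v).const_add w
  exact g.differentiableAt.hasFDerivAt.comp_hasDerivAt r hline

/-- A continuous curve `f` of Schwartz functions which has, at every point of its domain, the time
derivative `G` on `[0, T]`, where `G` is again a continuous curve. -/
structure IsCurve (T : ℝ) (f G : ℝ → 𝓢(E, F)) : Prop where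
  continuous : Continuous f
  continuous_deriv : Continuous G
  hasDeriv : ∀ t ∈ Set.Icc 0 T, ∀ w, HasDerivWithinAt (fun s => f s w) (G t w) (Set.Icc 0 T) t

theorem hasDerivAt_intervalIntegral_line {G : ℝ → 𝓢(E, F)} (hG : Continuous G) (w v : E) (s : ℝ) :
    HasDerivAt (fun r : ℝ => ∫ τ in (0 : ℝ)..s, G τ (w + r • v))
      (∫ τ in (0 : ℝ)..s, ∂_{v} (G τ) w) 0 := by
  have hderiv : Continuous fun q : ℝ × ℝ => (∂_{v} (G q.2)) (w + q.1 • v) :=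
    (continuous_eval_curve ((LineDeriv.lineDerivOpCLM ℝ 𝓢(E, F) v).continuous.comp hG)).comp
      (continuous_snd.prodMk (continuous_const.add (continuous_fst.smul continuous_const)))
  have hval (r : ℝ) : Continuous fun τ => G τ (w + r • v) :=
    (continuous_eval_curve hG).comp (Continuous.prodMk_left _)
  obtain ⟨C, hC⟩ := (((isCompact_Icc (a := (-1 : ℝ)) (b := 1)).prod
    (isCompact_uIcc (a := (0 : ℝ)) (b := s))).exists_bound_of_continuousOn hderiv.continuousOn)
  simpa only [zero_smul, add_zero] using
    (intervalIntegral.hasDerivAt_integral_of_dominated_loc_of_deriv_le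
      (F := fun (r : ℝ) τ => G τ (w + r • v)) (F' := fun (r : ℝ) τ => ∂_{v} (G τ) (w + r • v))
      (x₀ := 0) (bound := fun _ => C) (Icc_mem_nhds (a := -1) (b := 1) (by norm_num) (by norm_num))
      (.of_forall fun r => (hval r).aestronglyMeasurable) ((hval 0).intervalIntegrable _ _)
      (hderiv.comp (Continuous.prodMk_right 0)).aestronglyMeasurable
      (.of_forall fun τ hτ r hr => hC (r, τ) ⟨hr, Set.uIoc_subset_uIcc hτ⟩)
      intervalIntegrable_const (.of_forall fun τ _ r _ => hasDerivAt_comp_line (G τ) w v r)).2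

namespace IsCurve

variable {T : ℝ} {f G f' G' : ℝ → 𝓢(E, F)}

theorem sub (h : IsCurve T f G) (h' : IsCurve T f' G') :
    IsCurve T (fun t => f t - f' t) (fun t => G t - G' t) :=
  ⟨h.continuous.sub h'.continuous, h.continuous_deriv.sub h'.continuous_deriv,
    fun t ht w => (h.hasDeriv t ht w).sub (h'.hasDeriv t ht w)⟩

theorem seminorm_sub_sub_smul_le (h : IsCurve T f G) {D : Set ℝ} (hD : Convex ℝ D)
    (hDT : D ⊆ Set.Icc 0 T) {k : ℕ} {t η : ℝ}
    (hη : ∀ τ ∈ D, SchwartzMap.seminorm ℝ k 0 (G τ - G t) ≤ η) (ht : t ∈ D) {s : ℝ} (hs : s ∈ D) :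
    SchwartzMap.seminorm ℝ k 0 (f s - f t - (s - t) • G t) ≤ η * |s - t| := by
  have hη0 : 0 ≤ η := (apply_nonneg _ _).trans (hη t ht)
  refine seminorm_le_bound ℝ k 0 _ (by positivity) fun w => ?_
  have hderiv (τ : ℝ) (hτ : τ ∈ D) : HasDerivWithinAt
      (fun τ => ‖w‖ ^ k • (f τ w - τ • G t w)) (‖w‖ ^ k • (G τ w - (1 : ℝ) • G t w)) D τ :=
    (((h.hasDeriv τ (hDT hτ) w).mono hDT).sub ((hasDerivWithinAt_id τ _).smul_const _)).const_smul _
  have hbound (τ : ℝ) (hτ : τ ∈ D) : ‖‖w‖ ^ k • (G τ w - (1 : ℝ) • G t w)‖ ≤ η := by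
    rw [one_smul, norm_smul, norm_pow, norm_norm]
    exact (norm_pow_mul_le_seminorm ℝ (G τ - G t) k w).trans (hη τ hτ)
  calc ‖w‖ ^ k * ‖iteratedFDeriv ℝ 0 (f s - f t - (s - t) • G t) w‖
      = ‖‖w‖ ^ k • (f s w - s • G t w) - ‖w‖ ^ k • (f t w - t • G t w)‖ := by
        rw [norm_iteratedFDeriv_zero, ← smul_sub, norm_smul, norm_pow, norm_norm]
        congr 2
        simp only [_root_.sub_apply, _root_.smul_apply, sub_smul]
        abel
    _ ≤ η * |s - t| := hD.norm_image_sub_le_of_norm_hasDerivWithin_le hderiv hbound ht hs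

theorem hasDerivWithinAt_toLp [MeasurableSpace E] [OpensMeasurableSpace E]
    [SecondCountableTopologyEither E F] {p : ℝ≥0∞} [Fact (1 ≤ p)] {μ : Measure E}
    [μ.HasTemperateGrowth] (h : IsCurve T f G) {t : ℝ} (ht : t ∈ Set.Icc 0 T) :
    HasDerivWithinAt (fun s => (f s).toLp p μ) ((G t).toLp p μ) (Set.Icc 0 T) t := by
  obtain ⟨k, C, hC0, hC⟩ := norm_toLp_le_seminorm ℝ F p μ (E := E)
  set P := (Finset.Iic ((k, 0) : ℕ × ℕ)).sup (schwartzSeminormFamily ℝ E F)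
  have hPcont : Continuous P :=
    Seminorm.continuous_finsetSup fun m _ => (schwartz_withSeminorms ℝ E F).continuous_seminorm m
  rw [hasDerivWithinAt_iff_isLittleO, Asymptotics.isLittleO_iff]
  intro c hc
  have hsmall : ∀ᶠ τ in 𝓝 t, P (G τ - G t) < c / (C + 1) := by
    have hdiff := hPcont.comp (h.continuous_deriv.sub (continuous_const (y := G t)))
    refine (hdiff.tendsto t).eventually_lt_const ?_
    simpa using by positivity
  obtain ⟨δ, hδ0, hδ⟩ := Metric.eventually_nhds_iff_ball.1 hsmall
  filter_upwards [inter_mem_nhdsWithin _ (Metric.ball_mem_nhds t hδ0)] with s hs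
  have hP : P (f s - f t - (s - t) • G t) ≤ c / (C + 1) * |s - t| := by
    refine Seminorm.finset_sup_apply_le (by positivity) fun ⟨i, j⟩ hij => ?_
    obtain rfl : j = 0 := Nat.le_zero.1 (Finset.mem_Iic.1 hij).2
    exact h.seminorm_sub_sub_smul_le ((convex_Icc 0 T).inter (convex_ball t δ))
      Set.inter_subset_left
      (fun τ hτ => (Seminorm.le_finset_sup_apply hij).trans (hδ τ hτ.2).le)
      ⟨ht, Metric.mem_ball_self hδ0⟩ hs
  calc ‖(f s).toLp p μ - (f t).toLp p μ - (s - t) • (G t).toLp p μ‖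
      = ‖(f s - f t - (s - t) • G t).toLp p μ‖ := by
        simp only [← toLpCLM_apply (𝕜 := ℝ), map_sub, map_smul]
    _ ≤ C * P (f s - f t - (s - t) • G t) := hC _
    _ ≤ C * (c / (C + 1) * |s - t|) := by gcongr
    _ = C / (C + 1) * c * ‖s - t‖ := by rw [Real.norm_eq_abs]; ring
    _ ≤ 1 * c * ‖s - t‖ := by
        gcongr
        exact div_le_one_of_le₀ (by linarith) (by positivity)
    _ = c * ‖s - t‖ := by rw [one_mul]

variable [CompleteSpace F]

theorem eq_add_integral (h : IsCurve T f G) {s : ℝ} (hs : s ∈ Set.Icc 0 T) (w : E) :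
    f s w = f 0 w + ∫ τ in (0 : ℝ)..s, G τ w := by
  have hf : Continuous fun τ => f τ w :=
    (continuous_eval_curve h.continuous).comp (Continuous.prodMk_left w)
  have hG : Continuous fun τ => G τ w :=
    (continuous_eval_curve h.continuous_deriv).comp (Continuous.prodMk_left w)
  have hderiv (τ : ℝ) (hτ : τ ∈ Set.Ioo 0 s) :
      HasDerivWithinAt (fun τ => f τ w) (G τ w) (Set.Ioi τ) τ :=
    (h.hasDeriv τ ⟨hτ.1.le, hτ.2.le.trans hs.2⟩ w).mono_of_mem_nhdsWithin
      (mem_nhdsWithin_of_mem_nhds (Icc_mem_nhds hτ.1 (hτ.2.trans_le hs.2)))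
  rw [intervalIntegral.integral_eq_sub_of_hasDeriv_right_of_le hs.1 hf.continuousOn hderiv
    (hG.intervalIntegrable _ _), add_sub_cancel]

theorem lineDeriv_eq_add_integral (h : IsCurve T f G) (v : E) {s : ℝ} (hs : s ∈ Set.Icc 0 T)
    (w : E) : ∂_{v} (f s) w = ∂_{v} (f 0) w + ∫ τ in (0 : ℝ)..s, ∂_{v} (G τ) w := by
  have hleft := hasDerivAt_comp_line (f s) w v 0
  simp only [h.eq_add_integral hs, zero_smul, add_zero] at hleft
  have hright := (hasDerivAt_comp_line (f 0) w v 0).add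
    (hasDerivAt_intervalIntegral_line h.continuous_deriv w v s)
  simp only [zero_smul, add_zero] at hright
  exact hleft.unique hright

theorem lineDeriv (h : IsCurve T f G) (v : E) :
    IsCurve T (fun t => ∂_{v} (f t)) (fun t => ∂_{v} (G t)) := by
  have hcont := (LineDeriv.lineDerivOpCLM ℝ 𝓢(E, F) v).continuous
  have hG : Continuous fun t => ∂_{v} (G t) := hcont.comp h.continuous_deriv
  refine ⟨hcont.comp h.continuous, hG, fun t ht w => ?_⟩
  have hGw : Continuous fun τ => ∂_{v} (G τ) w :=
    (continuous_eval_curve hG).comp (Continuous.prodMk_left w)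
  exact ((hGw.integral_hasStrictDerivAt 0 t).hasDerivAt.const_add (∂_{v} (f 0) w)).hasDerivWithinAt
    |>.congr (fun s hs => h.lineDeriv_eq_add_integral v hs w) (h.lineDeriv_eq_add_integral v ht w)

end IsCurve

end Curve

section CurveEnergy

variable {E H ι : Type*} [NormedAddCommGroup E] [NormedSpace ℝ E] [MeasureSpace E] [BorelSpace E]
  [SecondCountableTopology E] [(volume : Measure E).HasTemperateGrowth]
  [NormedAddCommGroup H] [InnerProductSpace ℂ H] {T : ℝ} {f G : ℝ → 𝓢(E, H)}

theorem exists_l2norm_le_of_isCompact {X : Type*} [TopologicalSpace X] {K : Set X}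
    (hK : IsCompact K) {u : X → 𝓢(E, H)} (hu : ContinuousOn u K) :
    ∃ C, 0 ≤ C ∧ ∀ t ∈ K, l2norm (u t) ≤ C := by
  obtain ⟨C, hC⟩ := hK.exists_bound_of_continuousOn
    ((toLpCLM ℂ H 2 volume).continuous.comp_continuousOn hu)
  exact ⟨max C 0, le_max_right _ _, fun t ht => (hC t ht).trans (le_max_left _ _)⟩

theorem IsCurve.hasDerivWithinAt_l2norm_sq (h : IsCurve T f G) {t : ℝ} (ht : t ∈ Set.Icc 0 T) :
    HasDerivWithinAt (fun s => l2norm (f s) ^ 2) (2 * (l2inner (f t) (G t)).re)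
      (Set.Icc 0 T) t := by
  have hLp := h.hasDerivWithinAt_toLp (p := 2) (μ := volume) ht
  have hre := Complex.reCLM.hasFDerivAt.comp_hasDerivWithinAt t (hLp.inner ℂ hLp)
  refine (hre.congr (fun s _ => l2norm_sq _) (l2norm_sq _)).congr_deriv ?_
  change (l2inner (f t) (G t) + l2inner (G t) (f t)).re = _
  rw [← l2inner_conj_symm (f t) (G t), Complex.add_re, Complex.conj_re, two_mul]

theorem IsCurve.hasDerivWithinAt_energy [CompleteSpace H] [Fintype ι] (e : ι → E) (m : ℕ)
    (h : IsCurve T f G) {t : ℝ} (ht : t ∈ Set.Icc 0 T) :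
    HasDerivWithinAt (fun s => energy e m (f s)) (energyDot e m (f t) (G t)) (Set.Icc 0 T) t := by
  induction m generalizing f G with
  | zero => exact h.hasDerivWithinAt_l2norm_sq ht
  | succ m ih =>
    exact (h.hasDerivWithinAt_l2norm_sq ht).add
      (HasDerivWithinAt.fun_sum fun a _ => ih (h.lineDeriv (e a)))

end CurveEnergy

section Gronwall

theorem monotoneOn_exp_mul {D : Set ℝ} (hD : Convex ℝ D) {c : ℝ} {u u' : ℝ → ℝ}
    (hu : ∀ t ∈ D, HasDerivWithinAt u (u' t) D t) (hu' : ∀ t ∈ D, 0 ≤ c * u t + u' t) :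
    MonotoneOn (fun t => Real.exp (c * t) * u t) D := by
  have hderiv (t : ℝ) (ht : t ∈ D) : HasDerivWithinAt (fun t => Real.exp (c * t) * u t)
      (Real.exp (c * t) * (c * u t + u' t)) D t := by
    have hexp : HasDerivAt (fun t => Real.exp (c * t)) (Real.exp (c * t) * c) t := by
      simpa using ((hasDerivAt_id t).const_mul c).exp
    exact (hexp.hasDerivWithinAt.mul (hu t ht)).congr_deriv (by ring)
  exact monotoneOn_of_hasDerivWithinAt_nonneg hD (fun t ht => (hderiv t ht).continuousWithinAt)
    (fun t ht => (hderiv t (interior_subset ht)).mono interior_subset)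
    (fun t ht => mul_nonneg (Real.exp_nonneg _) (hu' t (interior_subset ht)))

theorem le_exp_mul_of_abs_deriv_le {D : Set ℝ} (hD : Convex ℝ D) {C : ℝ} {u u' : ℝ → ℝ}
    (hu : ∀ t ∈ D, HasDerivWithinAt u (u' t) D t) (hu' : ∀ t ∈ D, |u' t| ≤ C * u t) {s t : ℝ}
    (hs : s ∈ D) (ht : t ∈ D) : u t ≤ Real.exp (C * |t - s|) * u s := by
  rcases le_total s t with hst | hts
  · have hmono := monotoneOn_exp_mul hD (c := -C) (fun τ hτ => (hu τ hτ).neg)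
      (fun τ hτ => by rw [Pi.neg_apply]; linarith [(abs_le.1 (hu' τ hτ)).2]) hs ht hst
    simp only [Pi.neg_apply, mul_neg, neg_le_neg_iff] at hmono
    calc u t = Real.exp (C * t) * (Real.exp (-C * t) * u t) := by
          rw [← mul_assoc, ← Real.exp_add]; simp
      _ ≤ Real.exp (C * t) * (Real.exp (-C * s) * u s) := by gcongr
      _ = Real.exp (C * |t - s|) * u s := by
          rw [abs_of_nonneg (sub_nonneg.2 hst), ← mul_assoc, ← Real.exp_add]; ring_nf
  · have hmono := monotoneOn_exp_mul hD (c := C) hu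
      (fun τ hτ => by linarith [(abs_le.1 (hu' τ hτ)).1]) ht hs hts
    calc u t = Real.exp (-C * t) * (Real.exp (C * t) * u t) := by
          rw [← mul_assoc, ← Real.exp_add]; simp
      _ ≤ Real.exp (-C * t) * (Real.exp (C * s) * u s) := by gcongr
      _ = Real.exp (C * |t - s|) * u s := by
          rw [abs_of_nonpos (sub_nonpos.2 hts), ← mul_assoc, ← Real.exp_add]; ring_nf

end Gronwall

section Stability

variable {V : Space d → ℝ} {T : ℝ}

/-- The generator of the Liouville flow: `∇W·∇ₖ f - k·∇ₓ f`. -/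
def liouvilleGen (W : Space d → ℂ) : PhaseFun d →L[ℂ] PhaseFun d := forceCLM W - transportCLM

theorem liouvilleGen_apply (W : Space d → ℂ) (f : PhaseFun d) :
    liouvilleGen W f = forceCLM W f - transportCLM f := rfl

theorem exists_energy_wigner_le (hV : IsAdmissiblePotential V) (T : ℝ) (m : ℕ) :
    ∃ C, 0 ≤ C ∧ ∀ ε, 0 < ε → ∀ f : ℝ → PhaseFun d,
      IsCurve T f (fun t => wignerGen (fun x => (V x : ℂ)) ε (f t)) →
      ∀ s ∈ Set.Icc 0 T, ∀ t ∈ Set.Icc 0 T,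
        energy coordDir m (f t) ≤ C * energy coordDir m (f s) := by
  obtain ⟨C, hC0, hC⟩ := exists_energyDot_wignerGen_le hV m
  refine ⟨Real.exp (C * T), Real.exp_nonneg _, fun ε hε f hf s hs t ht => ?_⟩
  calc energy coordDir m (f t) ≤ Real.exp (C * |t - s|) * energy coordDir m (f s) :=
        le_exp_mul_of_abs_deriv_le (convex_Icc 0 T)
          (fun τ hτ => hf.hasDerivWithinAt_energy coordDir m hτ) (fun τ _ => hC ε hε (f τ)) hs ht
    _ ≤ Real.exp (C * T) * energy coordDir m (f s) := by
        gcongr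
        · exact energy_nonneg _ _ _
        · simpa only [Real.dist_eq, sub_zero] using Real.dist_le_of_mem_Icc ht hs

theorem abs_re_l2inner_wignerGen_sub_liouvilleGen_le (hV : IsAdmissiblePotential V) (ε : ℝ)
    (f f₀ : PhaseFun d) :
    |2 * (l2inner (f - f₀)
        (wignerGen (fun x => (V x : ℂ)) ε f - liouvilleGen (fun x => (V x : ℂ)) f₀)).re| ≤
      l2norm (f - f₀) ^ 2 +
        l2norm (wignerCLM (fun x => (V x : ℂ)) ε f₀ - forceCLM (fun x => (V x : ℂ)) f₀) ^ 2 := by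
  set W : Space d → ℂ := fun x => (V x : ℂ) with hW
  have hsplit : wignerGen W ε f - liouvilleGen W f₀ =
      wignerGen W ε (f - f₀) + (wignerCLM W ε f₀ - forceCLM W f₀) := by
    rw [map_sub, wignerGen_apply, wignerGen_apply, liouvilleGen_apply]
    abel
  rw [hsplit, l2inner_add_right, Complex.add_re, hW, re_l2inner_wignerGen_self hV, zero_add]
  exact abs_two_mul_re_l2inner_le _ _

theorem exists_l2norm_wignerCLM_sub_forceCLM_sq_le (hV : IsAdmissiblePotential V)
    {f₀ G₀ : ℝ → PhaseFun d} (hf₀ : IsCurve T f₀ G₀) :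
    ∃ K, 0 ≤ K ∧ ∀ ε, 0 < ε → ∀ t ∈ Set.Icc 0 T,
      l2norm (wignerCLM (fun x => (V x : ℂ)) ε (f₀ t) - forceCLM (fun x => (V x : ℂ)) (f₀ t)) ^ 2 ≤
        K * ε ^ 2 := by
  have hW := hV.isBoundedSmooth
  obtain ⟨C, hC0, hC⟩ := hW.exists_lipschitz_fderiv
  choose K _ hK using fun j : Fin d => exists_l2norm_le_of_isCompact
    isCompact_Icc ((hf₀.lineDeriv (momDir j)).lineDeriv (momDir j)).continuous.continuousOn
  refine ⟨(C * ∑ j, K j) ^ 2, sq_nonneg _, fun ε hε t ht => ?_⟩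
  rw [← mul_pow, mul_right_comm]
  gcongr
  · exact l2norm_nonneg _
  · calc _ ≤ C * ε * ∑ j : Fin d, l2norm (∂_{momDir j} (∂_{momDir j} (f₀ t))) :=
          l2norm_wignerCLM_sub_forceCLM_le hW.hasTemperateGrowth
            (fun v => (hW.fderiv_apply v).hasTemperateGrowth) hC0 hC hε _
      _ ≤ C * ε * ∑ j, K j := by
          gcongr with j
          exact hK j t ht

theorem exists_l2norm_wigner_sub_liouville_le (hV : IsAdmissiblePotential V)
    {f₀ : ℝ → PhaseFun d}
    (hf₀ : IsCurve T f₀ (fun t => liouvilleGen (fun x => (V x : ℂ)) (f₀ t))) :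
    ∃ K, 0 ≤ K ∧ ∀ ε, 0 < ε → ∀ f : ℝ → PhaseFun d,
      IsCurve T f (fun t => wignerGen (fun x => (V x : ℂ)) ε (f t)) →
      ∀ s ∈ Set.Icc 0 T, ∀ t ∈ Set.Icc 0 T, l2norm (f t - f₀ t) ^ 2 ≤
        Real.exp T * (l2norm (f s - f₀ s) ^ 2 + K * ε ^ 2) := by
  obtain ⟨K, hK0, hK⟩ := exists_l2norm_wignerCLM_sub_forceCLM_sq_le hV hf₀
  refine ⟨K, hK0, fun ε hε f hf s hs t ht => ?_⟩
  have hderiv (τ : ℝ) (hτ : τ ∈ Set.Icc 0 T) :=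
    ((hf.sub hf₀).hasDerivWithinAt_l2norm_sq hτ).add_const (K * ε ^ 2)
  calc l2norm (f t - f₀ t) ^ 2 ≤ l2norm (f t - f₀ t) ^ 2 + K * ε ^ 2 :=
        le_add_of_nonneg_right (by positivity)
    _ ≤ Real.exp (1 * |t - s|) * (l2norm (f s - f₀ s) ^ 2 + K * ε ^ 2) :=
        le_exp_mul_of_abs_deriv_le (convex_Icc 0 T) hderiv
          (fun τ hτ => by
            rw [one_mul]
            exact (abs_re_l2inner_wignerGen_sub_liouvilleGen_le hV ε _ _).trans
              (add_le_add_right (hK ε hε τ hτ) _)) hs ht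
    _ ≤ Real.exp T * (l2norm (f s - f₀ s) ^ 2 + K * ε ^ 2) := by
        rw [one_mul]
        gcongr
        simpa only [Real.dist_eq, sub_zero] using Real.dist_le_of_mem_Icc ht hs

end Stability

section InitialData

theorem l2norm_eq_toReal (f : PhaseFun d) : l2norm f = (eLpNorm f 2 volume).toReal :=
  norm_toLp

theorem l2norm_iteratedLineDeriv_le {n : ℕ} {A : ℝ≥0} {f : PhaseFun d}
    (hf : eLpNorm (fun w => iteratedFDeriv ℝ n f w) 2 volume ≤ A) {v : Fin n → Space d × Space d}
    (hv : ∀ i, ‖v i‖ ≤ 1) : l2norm (∂^{v} f) ≤ A := by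
  rw [l2norm_eq_toReal]
  refine ENNReal.toReal_le_coe_of_le_coe ((eLpNorm_mono fun w => ?_).trans hf)
  rw [iteratedLineDerivOp_eq_iteratedFDeriv]
  exact (ContinuousMultilinearMap.le_opNorm _ _).trans (mul_le_of_le_one_right (norm_nonneg _)
    (Finset.prod_le_one (fun _ _ => norm_nonneg _) fun i _ => hv i))

theorem norm_coordDir_le_one (a : Fin d ⊕ Fin d) : ‖coordDir a‖ ≤ 1 := by
  rcases a with j | j <;> simp [coordDir, posDir, momDir, Prod.norm_def]

theorem exists_energy_iteratedLineDeriv_le (A : ℕ → ℝ≥0) (m n : ℕ) : ∃ C : ℝ, ∀ f : PhaseFun d,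
    (∀ j ≤ n + m, eLpNorm (fun w => iteratedFDeriv ℝ j f w) 2 volume ≤ A j) →
    ∀ v : Fin n → Space d × Space d, (∀ i, ‖v i‖ ≤ 1) → energy coordDir m (∂^{v} f) ≤ C := by
  induction m generalizing n with
  | zero =>
    exact ⟨A n ^ 2, fun f hf v hv => pow_le_pow_left₀ (l2norm_nonneg _)
      (l2norm_iteratedLineDeriv_le (hf n le_rfl) hv) 2⟩
  | succ m ih =>
    obtain ⟨C, hC⟩ := ih (n + 1)
    refine ⟨A n ^ 2 + ∑ _a : Fin d ⊕ Fin d, C, fun f hf v hv => add_le_add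
      (pow_le_pow_left₀ (l2norm_nonneg _) (l2norm_iteratedLineDeriv_le (hf n (by lia)) hv) 2)
      (Finset.sum_le_sum fun a _ => ?_)⟩
    have hcons : ∂_{coordDir a} (∂^{v} f) =
        ∂^{(Fin.cons (coordDir a) v : Fin (n + 1) → Space d × Space d)} f := by
      simp [LineDeriv.iteratedLineDerivOp_succ_left]
    rw [hcons]
    exact hC f (fun j hj => hf j (by lia)) _
      (Fin.cases (by simpa using norm_coordDir_le_one a) (by simpa using hv))

theorem ConvergesRegularly.exists_energy_le {u : ℝ → PhaseFun d} {u₀ : PhaseFun d}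
    (h : ConvergesRegularly u u₀) (m : ℕ) :
    ∃ C, ∀ᶠ ε in 𝓝[>] (0 : ℝ), energy coordDir m (u ε) ≤ C := by
  choose A hA using h.bounded
  obtain ⟨C, hC⟩ := exists_energy_iteratedLineDeriv_le (d := d) A m 0
  refine ⟨C, ?_⟩
  filter_upwards [(Finset.eventually_all (Finset.range (m + 1))).2 fun j _ => hA j] with ε hε
  simpa using hC (u ε) (fun j hj => hε j (Finset.mem_range.2 (by lia))) Fin.elim0 (by simp)

theorem ConvergesRegularly.tendsto_l2norm {u : ℝ → PhaseFun d} {u₀ : PhaseFun d}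
    (h : ConvergesRegularly u u₀) : Tendsto (fun ε => l2norm (u ε - u₀)) (𝓝[>] 0) (𝓝 0) := by
  simp only [l2norm_eq_toReal]
  exact (ENNReal.tendsto_toReal ENNReal.zero_ne_top).comp h.tendsto_L2

end InitialData

section Solutions

variable {V : Space d → ℝ} {T : ℝ} {f : ℝ → PhaseFun d}

theorem exists_continuous_eqOn_Icc (hT : 0 ≤ T) {X : Type*} [TopologicalSpace X] {f : ℝ → X}
    (hf : ContinuousOn f (Set.Icc 0 T)) :
    ∃ F : ℝ → X, Continuous F ∧ Set.EqOn F f (Set.Icc 0 T) :=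
  ⟨Set.IccExtend hT ((Set.Icc 0 T).domRestrict f),
    (continuousOn_iff_continuous_domRestrict.1 hf).Icc_extend',
    fun _ ht => Set.IccExtend_of_mem hT _ ht⟩

theorem SolvesWigner.exists_isCurve (hV : IsAdmissiblePotential V) {ε : ℝ} (hT : 0 ≤ T)
    (hf : SolvesWigner V ε T f) :
    ∃ F : ℝ → PhaseFun d, IsCurve T F (fun t => wignerGen (fun x => (V x : ℂ)) ε (F t)) ∧
      Set.EqOn F f (Set.Icc 0 T) := by
  obtain ⟨F, hF, hFf⟩ := exists_continuous_eqOn_Icc hT hf.continuousOn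
  refine ⟨F, ⟨hF, (wignerGen _ ε).continuous.comp hF, fun t ht w => ?_⟩, hFf⟩
  refine ((hf.equation t ht w.1 w.2).congr (fun s hs => congrArg (· w) (hFf hs))
    (congrArg (· w) (hFf ht))).congr_deriv ?_
  rw [hFf ht, wignerGen_apply, wignerOp_eq_wignerCLM hV.isBoundedSmooth.hasTemperateGrowth,
    ← transportCLM_apply, neg_add_eq_sub]
  rfl

theorem fderiv_ofReal_comp_single (hV : IsAdmissiblePotential V) (x : Space d) (j : Fin d) :
    fderiv ℝ (fun x => (V x : ℂ)) x (EuclideanSpace.single j 1) = ((gradient V x j : ℝ) : ℂ) := by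
  have hd : DifferentiableAt ℝ V x := hV.1.differentiable (by simp) x
  have hgradient : fderiv ℝ V x (EuclideanSpace.single j 1) = gradient V x j := by
    rw [gradient, ← InnerProductSpace.toDual_symm_apply, EuclideanSpace.inner_single_right]
    simp
  have hcomp : HasFDerivAt (fun x => (V x : ℂ)) (Complex.ofRealCLM.comp (fderiv ℝ V x)) x :=
    Complex.ofRealCLM.hasFDerivAt.comp x hd.hasFDerivAt
  rw [hcomp.fderiv, ← hgradient]
  rfl

theorem forceCLM_ofReal_apply (hV : IsAdmissiblePotential V) (f : PhaseFun d) (x k : Space d) :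
    forceCLM (fun x => (V x : ℂ)) f (x, k) = fderiv ℝ f (x, k) (0, gradient V x) := by
  rw [forceCLM_eq_sum, _root_.sum_apply, ← sum_smul_momDir, map_sum]
  refine Finset.sum_congr rfl fun j _ => ?_
  rw [mulOp_apply (hasTemperateGrowth_comp_fst
    (hV.isBoundedSmooth.fderiv_apply _).hasTemperateGrowth), lineDerivOp_apply_eq_fderiv, map_smul,
    Complex.real_smul, fderiv_ofReal_comp_single hV]

theorem SolvesLiouville.exists_isCurve (hV : IsAdmissiblePotential V) (hT : 0 ≤ T)
    (hf : SolvesLiouville V T f) :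
    ∃ F : ℝ → PhaseFun d, IsCurve T F (fun t => liouvilleGen (fun x => (V x : ℂ)) (F t)) ∧
      Set.EqOn F f (Set.Icc 0 T) := by
  obtain ⟨F, hF, hFf⟩ := exists_continuous_eqOn_Icc hT hf.continuousOn
  refine ⟨F, ⟨hF, (liouvilleGen _).continuous.comp hF, fun t ht w => ?_⟩, hFf⟩
  refine ((hf.equation t ht w.1 w.2).congr (fun s hs => congrArg (· w) (hFf hs))
    (congrArg (· w) (hFf ht))).congr_deriv ?_
  rw [hFf ht, liouvilleGen_apply, ← forceCLM_ofReal_apply hV, ← transportCLM_apply, neg_add_eq_sub]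
  rfl

end Solutions

section PlaneWave

/-- The plane wave `x ↦ e^{i p · x}`. -/
def planeWave (p x : Space d) : ℂ := Complex.exp (Complex.I * (⟪p, x⟫_ℝ : ℂ))

theorem norm_planeWave (p x : Space d) : ‖planeWave p x‖ = 1 := by
  rw [planeWave, mul_comm, Complex.norm_exp_ofReal_mul_I]

theorem planeWave_add (p x y : Space d) : planeWave p (x + y) = planeWave p x * planeWave p y := by
  rw [planeWave, planeWave, planeWave, ← Complex.exp_add, inner_add_right, Complex.ofReal_add,
    mul_add]

theorem conj_planeWave (p x : Space d) : (starRingEnd ℂ) (planeWave p x) = planeWave (-p) x := by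
  rw [planeWave, planeWave, ← Complex.exp_conj]
  simp

theorem contDiff_planeWave (p : Space d) : ContDiff ℝ ∞ (planeWave p) :=
  (contDiff_const.mul (Complex.ofRealCLM.contDiff.comp (innerSL ℝ p).contDiff)).cexp

/-- The logarithmic derivative `v ↦ i p · v` of the plane wave of frequency `p`. -/
def planeWaveDeriv (p : Space d) : Space d →L[ℝ] ℂ :=
  Complex.I • Complex.ofRealCLM.comp (innerSL ℝ p)

theorem planeWaveDeriv_apply (p v : Space d) :
    planeWaveDeriv p v = Complex.I * (⟪p, v⟫_ℝ : ℂ) := rfl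

theorem norm_planeWaveDeriv_le (p : Space d) : ‖planeWaveDeriv p‖ ≤ ‖p‖ := by
  refine ContinuousLinearMap.opNorm_le_bound _ (norm_nonneg _) fun v => ?_
  rw [planeWaveDeriv_apply, norm_mul, Complex.norm_I, one_mul, Complex.norm_real]
  exact norm_inner_le_norm p v

theorem hasFDerivAt_planeWave (p x : Space d) :
    HasFDerivAt (planeWave p) (planeWave p x • planeWaveDeriv p) x :=
  (planeWaveDeriv p).hasFDerivAt.cexp

theorem fderiv_planeWave (p x : Space d) :
    fderiv ℝ (planeWave p) x = planeWave p x • planeWaveDeriv p :=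
  (hasFDerivAt_planeWave p x).fderiv

theorem fderiv_planeWave_single (p x : Space d) (j : Fin d) :
    fderiv ℝ (planeWave p) x (EuclideanSpace.single j 1) =
      Complex.I * (p j : ℂ) * planeWave p x := by
  rw [fderiv_planeWave, _root_.smul_apply, planeWaveDeriv_apply, EuclideanSpace.inner_single_right,
    smul_eq_mul, mul_comm]
  simp

theorem norm_fderiv_planeWave_le (p x : Space d) : ‖fderiv ℝ (planeWave p) x‖ ≤ ‖p‖ := by
  rw [fderiv_planeWave, norm_smul, norm_planeWave, one_mul]
  exact norm_planeWaveDeriv_le p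

theorem norm_fderiv_planeWave_sub_le (p x y : Space d) :
    ‖fderiv ℝ (planeWave p) x - fderiv ℝ (planeWave p) y‖ ≤ ‖p‖ ^ 2 * ‖x - y‖ := by
  have hlipschitz : ‖planeWave p x - planeWave p y‖ ≤ ‖p‖ * ‖x - y‖ :=
    convex_univ.norm_image_sub_le_of_norm_fderiv_le (𝕜 := ℝ)
      (fun z _ => (hasFDerivAt_planeWave p z).differentiableAt)
      (fun z _ => norm_fderiv_planeWave_le p z) (Set.mem_univ y) (Set.mem_univ x)
  calc ‖fderiv ℝ (planeWave p) x - fderiv ℝ (planeWave p) y‖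
      = ‖planeWave p x - planeWave p y‖ * ‖planeWaveDeriv p‖ := by
        rw [fderiv_planeWave, fderiv_planeWave, ← norm_smul]
        exact congrArg _ (sub_smul _ _ _).symm
    _ ≤ (‖p‖ * ‖x - y‖) * ‖p‖ := by
        gcongr
        exact norm_planeWaveDeriv_le p
    _ = ‖p‖ ^ 2 * ‖x - y‖ := by ring

theorem isBoundedSmooth_planeWave (p : Space d) : IsBoundedSmooth (planeWave p) := by
  refine ⟨contDiff_planeWave p, fun n => ?_⟩
  induction n with
  | zero => exact ⟨1, fun x => by rw [norm_iteratedFDeriv_zero, norm_planeWave]⟩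
  | succ n ih =>
    obtain ⟨C, hC⟩ := ih
    let L : ℂ →L[ℝ] (Space d →L[ℝ] ℂ) :=
      (ContinuousLinearMap.toSpanSingleton ℂ (planeWaveDeriv p)).restrictScalars ℝ
    have hfderiv : fderiv ℝ (planeWave p) = L ∘ planeWave p := funext (fderiv_planeWave p)
    refine ⟨‖L‖ * C, fun x => ?_⟩
    rw [← norm_iteratedFDeriv_fderiv, hfderiv]
    refine (L.norm_iteratedFDeriv_comp_left (N := ∞) (contDiff_planeWave p).contDiffAt
      (mod_cast le_top)).trans ?_
    gcongr
    exact hC x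

theorem hasTemperateGrowth_planeWave (p : Space d) : (planeWave p).HasTemperateGrowth :=
  (isBoundedSmooth_planeWave p).hasTemperateGrowth

theorem hasTemperateGrowth_planeWave_fst (p : Space d) :
    (fun w : Space d × Space d => planeWave p w.1).HasTemperateGrowth :=
  hasTemperateGrowth_comp_fst (hasTemperateGrowth_planeWave p)

theorem planeWave_smul_two_pi_smul (p y : Space d) (c : ℝ) :
    planeWave p (c • ((2 * Real.pi) • y)) = (Real.fourierChar ⟪y, c • p⟫_ℝ : ℂ) := by
  rw [planeWave, Real.fourierChar_apply, inner_smul_right, inner_smul_right, inner_smul_right,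
    real_inner_comm]
  push_cast
  ring_nf

end PlaneWave

section PlaneWaveOperators

theorem mulOp_const_mul {E : Type*} [NormedAddCommGroup E] [NormedSpace ℝ E] {a : E → ℂ}
    (ha : a.HasTemperateGrowth) (c : ℂ) (f : 𝓢(E, ℂ)) :
    mulOp (fun w => c * a w) f = c • mulOp a f :=
  DFunLike.congr_fun (smulLeftCLM_smul ha c) f

theorem wignerCLM_const_mul {W : Space d → ℂ} (hW : W.HasTemperateGrowth) (c : ℂ) (ε : ℝ)
    (f : PhaseFun d) : wignerCLM (fun x => c * W x) ε f = c • wignerCLM W ε f := by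
  have hsymbol : wignerSymbol (fun x => c * W x) ε = fun w => c * wignerSymbol W ε w := by
    ext w
    simp only [wignerSymbol]
    ring
  rw [wignerCLM_apply, wignerCLM_apply, hsymbol,
    mulOp_const_mul (hasTemperateGrowth_wignerSymbol hW ε), map_smul, smul_comm]

theorem integrable_fourierChar_smul_slice (f : PhaseFun d) (x k : Space d) :
    Integrable fun y : Space d => Real.fourierChar ⟪y, k⟫_ℝ • f (x, y) := by
  simpa only [inner_neg_right, neg_neg] using!
    (Real.fourierIntegral_convergent_iff (-k)).2 ((slice x f).integrable (μ := volume))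

theorem wignerCLM_planeWave_apply (p : Space d) (ε : ℝ) (f : PhaseFun d) (x k : Space d) :
    wignerCLM (planeWave p) ε f (x, k) =
      Complex.I * (planeWave p x * momentumDiff ε f x k p) := by
  have hinversion (k : Space d) :
      f (x, k) = ∫ y, Real.fourierChar ⟪y, k⟫_ℝ • partialFourier f (x, y) := by
    rw [← partialFourierInv_apply, partialFourierInv_partialFourier]
  rw [wignerCLM_apply, _root_.smul_apply, partialFourierInv_apply, momentumDiff, hinversion,
    hinversion, ← integral_sub (integrable_fourierChar_smul_slice _ _ _)
      (integrable_fourierChar_smul_slice _ _ _), div_eq_mul_inv, mul_comm _ (ε : ℂ)⁻¹,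
    ← mul_assoc (planeWave p x), ← integral_const_mul, smul_eq_mul]
  congr 2
  ext y
  rw [mulOp_apply (hasTemperateGrowth_wignerSymbol (hasTemperateGrowth_planeWave p) ε),
    wignerSymbol, sub_eq_add_neg x, planeWave_add, planeWave_add, ← neg_smul,
    planeWave_smul_two_pi_smul, planeWave_smul_two_pi_smul, sub_eq_add_neg k, ← neg_smul,
    inner_add_right, inner_add_right, AddChar.map_add_eq_mul, AddChar.map_add_eq_mul]
  simp only [Circle.smul_def, Circle.coe_mul, smul_eq_mul]
  ring

theorem forceCLM_planeWave (p : Space d) (f : PhaseFun d) :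
    forceCLM (planeWave p) f = ∑ j : Fin d, (Complex.I * (p j : ℂ)) •
      mulOp (fun w => planeWave p w.1) (∂_{momDir j} f) := by
  rw [forceCLM_eq_sum]
  refine Finset.sum_congr rfl fun j _ => ?_
  simp only [fderiv_planeWave_single]
  exact mulOp_const_mul (hasTemperateGrowth_planeWave_fst p) _ _

theorem lineDeriv_posDir_wignerCLM_planeWave (p : Space d) (ε : ℝ) (j : Fin d) (f : PhaseFun d) :
    ∂_{posDir j} (wignerCLM (planeWave p) ε f) = wignerCLM (planeWave p) ε (∂_{posDir j} f) +
      (Complex.I * (p j : ℂ)) • wignerCLM (planeWave p) ε f := by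
  rw [lineDeriv_posDir_wignerCLM (isBoundedSmooth_planeWave p)]
  simp only [fderiv_planeWave_single]
  rw [wignerCLM_const_mul (hasTemperateGrowth_planeWave p)]

theorem lineDeriv_posDir_mulOp_planeWave (p : Space d) (j : Fin d) (f : PhaseFun d) :
    ∂_{posDir j} (mulOp (fun w => planeWave p w.1) f) =
      mulOp (fun w => planeWave p w.1) (∂_{posDir j} f) +
        (Complex.I * (p j : ℂ)) • mulOp (fun w => planeWave p w.1) f := by
  have hgrowth := hasTemperateGrowth_planeWave_fst p
  rw [lineDeriv_mulOp hgrowth (a' := fun w => Complex.I * (p j : ℂ) * planeWave p w.1)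
    ((Function.HasTemperateGrowth.const _).mul hgrowth), ← mulOp_const_mul hgrowth]
  intro w
  have hcomp : HasFDerivAt (fun w : Space d × Space d => planeWave p w.1)
      ((fderiv ℝ (planeWave p) w.1).comp (ContinuousLinearMap.fst ℝ _ _)) w :=
    HasFDerivAt.comp w (hasFDerivAt_planeWave p w.1).differentiableAt.hasFDerivAt
      (hasFDerivAt_fst (𝕜 := ℝ) (p := w))
  rw [hcomp.fderiv]
  exact fderiv_planeWave_single p w.1 j

theorem l2norm_mulOp_planeWave (p : Space d) (f : PhaseFun d) :
    l2norm (mulOp (fun w => planeWave p w.1) f) = l2norm f := by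
  rw [l2norm_eq_toReal, l2norm_eq_toReal]
  congr 1
  refine eLpNorm_congr_norm_ae (.of_forall fun w => ?_)
  rw [mulOp_apply (hasTemperateGrowth_planeWave_fst p), norm_mul, norm_planeWave, one_mul]

end PlaneWaveOperators

section FrequencyDecay

variable {p : Space d} {A : PhaseFun d → PhaseFun d}

theorem abs_coord_mul_norm_l2inner_le {j : Fin d} {f : PhaseFun d}
    (hA : ∂_{posDir j} (A f) = A (∂_{posDir j} f) + (Complex.I * (p j : ℂ)) • A f)
    (g : PhaseFun d) :
    |p j| * ‖l2inner g (A f)‖ ≤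
      ‖l2inner (∂_{posDir j} g) (A f)‖ + ‖l2inner g (A (∂_{posDir j} f))‖ := by
  have hparts : (Complex.I * (p j : ℂ)) * l2inner g (A f) =
      -l2inner (∂_{posDir j} g) (A f) - l2inner g (A (∂_{posDir j} f)) := by
    rw [← l2inner_lineDeriv_right, hA, l2inner_add_right, l2inner_smul_right]
    ring
  calc |p j| * ‖l2inner g (A f)‖ = ‖(Complex.I * (p j : ℂ)) * l2inner g (A f)‖ := by simp
    _ ≤ ‖l2inner (∂_{posDir j} g) (A f)‖ + ‖l2inner g (A (∂_{posDir j} f))‖ := by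
        rw [hparts, ← norm_neg (l2inner (∂_{posDir j} g) (A f))]
        exact norm_sub_le _ _

theorem norm_l2inner_le_of_energy_le {c : ℝ}
    (hbound : ∀ f B, energy coordDir 1 f ≤ B → l2norm (A f) ≤ c * √B) {f g : PhaseFun d} {B : ℝ}
    (hf : energy coordDir 1 f ≤ B) (hg : energy coordDir 1 g ≤ B) :
    ‖l2inner g (A f)‖ ≤ c * B := by
  have hB : 0 ≤ B := (energy_nonneg _ _ _).trans hf
  calc ‖l2inner g (A f)‖ ≤ l2norm g * l2norm (A f) := norm_l2inner_le _ _
    _ ≤ √B * (c * √B) := by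
        gcongr
        · exact l2norm_nonneg _
        · exact l2norm_le_sqrt_of_energy_le coordDir hg
        · exact hbound f B hf
    _ = c * (√B * √B) := by ring
    _ = c * B := by rw [Real.mul_self_sqrt hB]

theorem one_add_norm_pow_mul_norm_l2inner_le
    (hA : ∀ (j : Fin d) (f : PhaseFun d),
      ∂_{posDir j} (A f) = A (∂_{posDir j} f) + (Complex.I * (p j : ℂ)) • A f)
    {c : ℝ} (hbound : ∀ f B, energy coordDir 1 f ≤ B → l2norm (A f) ≤ c * √B) (n : ℕ) :
    ∀ {f g : PhaseFun d} {B : ℝ}, energy coordDir (n + 1) f ≤ B → energy coordDir (n + 1) g ≤ B →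
      (1 + ‖p‖) ^ n * ‖l2inner g (A f)‖ ≤ (1 + 2 * d) ^ n * c * B := by
  induction n with
  | zero =>
    intro f g B hf hg
    simpa using norm_l2inner_le_of_energy_le hbound hf hg
  | succ n ih =>
    intro f g B hf hg
    have hf' := (energy_le_succ coordDir _ f).trans hf
    have hg' := (energy_le_succ coordDir _ g).trans hg
    set a := (1 + ‖p‖) ^ n * ‖l2inner g (A f)‖ with ha
    set b := (1 + 2 * d) ^ n * c * B with hb
    have hcoord (j : Fin d) : |p j| * a ≤ 2 * b := by
      have hposDir_g := ih hf' ((energy_lineDeriv_posDir_le _ j g).trans hg)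
      have hposDir_f := ih ((energy_lineDeriv_posDir_le _ j f).trans hf) hg'
      have hparts := mul_le_mul_of_nonneg_left (abs_coord_mul_norm_l2inner_le (hA j f) g)
        (by positivity : 0 ≤ (1 + ‖p‖) ^ n)
      linarith
    have hfreq : ‖p‖ * a ≤ d * (2 * b) :=
      calc ‖p‖ * a ≤ (∑ j, |p j|) * a := by
            gcongr
            exact norm_le_sum_abs_coord p
        _ = ∑ j, |p j| * a := Finset.sum_mul ..
        _ ≤ ∑ _j : Fin d, 2 * b := Finset.sum_le_sum fun j _ => hcoord j
        _ = d * (2 * b) := by simp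
    calc (1 + ‖p‖) ^ (n + 1) * ‖l2inner g (A f)‖ = a + ‖p‖ * a := by rw [ha]; ring
      _ ≤ b + d * (2 * b) := add_le_add (ih hf' hg') hfreq
      _ = (1 + 2 * d) ^ (n + 1) * c * B := by rw [hb]; ring

variable (p)

theorem one_add_norm_pow_mul_wignerCLM_le {ε : ℝ} (hε : 0 < ε) (n : ℕ) {f g : PhaseFun d} {B : ℝ}
    (hf : energy coordDir (n + 1) f ≤ B) (hg : energy coordDir (n + 1) g ≤ B) :
    (1 + ‖p‖) ^ n * ‖l2inner g (wignerCLM (planeWave p) ε f)‖ ≤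
      (1 + 2 * d) ^ n * (‖p‖ * √d) * B := by
  refine one_add_norm_pow_mul_norm_l2inner_le (lineDeriv_posDir_wignerCLM_planeWave p ε)
    (fun f B hf => ?_) n hf hg
  rw [mul_assoc, ← Real.sqrt_mul (Nat.cast_nonneg d)]
  refine (l2norm_wignerCLM_le (hasTemperateGrowth_planeWave p) (norm_fderiv_planeWave_le p)
    hε f).trans ?_
  gcongr
  exact sum_l2norm_momDir_le_sqrt hf

theorem one_add_norm_pow_mul_mulOp_le (n : ℕ) {f g : PhaseFun d} {B : ℝ}
    (hf : energy coordDir (n + 1) f ≤ B) (hg : energy coordDir (n + 1) g ≤ B) :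
    (1 + ‖p‖) ^ n * ‖l2inner g (mulOp (fun w => planeWave p w.1) f)‖ ≤ (1 + 2 * d) ^ n * B := by
  have hdecay := one_add_norm_pow_mul_norm_l2inner_le (lineDeriv_posDir_mulOp_planeWave p)
    (c := 1) (fun f B hf => ?_) n hf hg
  · rwa [mul_one] at hdecay
  · rw [l2norm_mulOp_planeWave, one_mul]
    exact l2norm_le_sqrt_of_energy_le coordDir hf

end FrequencyDecay

section PlaneWaveConsistency

variable (p : Space d) {ε : ℝ}

theorem norm_l2inner_wignerCLM_planeWave_le (hε : 0 < ε) (f g : PhaseFun d) :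
    ‖l2inner g (wignerCLM (planeWave p) ε f)‖ ≤
      (‖p‖ * ∑ j : Fin d, l2norm (∂_{momDir j} g)) * l2norm f := by
  rw [l2inner_wignerCLM_right (hasTemperateGrowth_planeWave p), norm_neg]
  simp only [conj_planeWave]
  refine (norm_l2inner_le _ _).trans ?_
  gcongr
  · exact l2norm_nonneg _
  · rw [← norm_neg p]
    exact l2norm_wignerCLM_le (hasTemperateGrowth_planeWave (-p)) (norm_fderiv_planeWave_le (-p))
      hε g

theorem norm_l2inner_wignerCLM_sub_forceCLM_le (hε : 0 < ε) (f f₀ g g₀ : PhaseFun d) :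
    ‖l2inner g (wignerCLM (planeWave p) ε f) - l2inner g₀ (forceCLM (planeWave p) f₀)‖ ≤
      l2norm (g - g₀) * (‖p‖ * ∑ j : Fin d, l2norm (∂_{momDir j} f)) +
      (‖p‖ * ∑ j : Fin d, l2norm (∂_{momDir j} g₀)) * l2norm (f - f₀) +
      l2norm g₀ * (‖p‖ ^ 2 * ε * ∑ j : Fin d, l2norm (∂_{momDir j} (∂_{momDir j} f₀))) := by
  have hgrowth := hasTemperateGrowth_planeWave p
  have hsplit : l2inner g (wignerCLM (planeWave p) ε f) - l2inner g₀ (forceCLM (planeWave p) f₀) =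
      l2inner (g - g₀) (wignerCLM (planeWave p) ε f) +
      l2inner g₀ (wignerCLM (planeWave p) ε (f - f₀)) +
      l2inner g₀ (wignerCLM (planeWave p) ε f₀ - forceCLM (planeWave p) f₀) := by
    rw [l2inner_sub_left, l2inner_sub_right, map_sub, l2inner_sub_right]
    ring
  rw [hsplit]
  refine norm_add₃_le.trans (add_le_add (add_le_add ?_
    (norm_l2inner_wignerCLM_planeWave_le p hε _ _)) ?_)
  · refine (norm_l2inner_le _ _).trans ?_
    gcongr
    · exact l2norm_nonneg _
    · exact l2norm_wignerCLM_le hgrowth (norm_fderiv_planeWave_le p) hε f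
  · refine (norm_l2inner_le _ _).trans ?_
    gcongr
    · exact l2norm_nonneg _
    · exact l2norm_wignerCLM_sub_forceCLM_le hgrowth
        (fun j => ((isBoundedSmooth_planeWave p).fderiv_apply _).hasTemperateGrowth) (sq_nonneg _)
        (norm_fderiv_planeWave_sub_le p) hε f₀

end PlaneWaveConsistency

section DominatedConvergence

variable {α ι F : Type*} {l : Filter ι} [l.IsCountablyGenerated] [l.NeBot] {mα : MeasurableSpace α}
  {μ : Measure α} [NormedAddCommGroup F] {p : ℝ≥0∞} {A : ι → α → F} {A₀ : α → F} {b : α → ℝ}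

theorem ae_norm_le_of_tendsto (hbound : ∀ᶠ i in l, ∀ᵐ x ∂μ, ‖A i x‖ ≤ b x)
    (hlim : ∀ᵐ x ∂μ, Tendsto (fun i => A i x) l (𝓝 (A₀ x))) : ∀ᵐ x ∂μ, ‖A₀ x‖ ≤ b x := by
  obtain ⟨u, hu⟩ := l.exists_seq_tendsto
  obtain ⟨n₀, hn₀⟩ := eventually_atTop.1 (hu.eventually hbound)
  filter_upwards [hlim, ae_all_iff.2 fun n => ae_all_iff.2 (hn₀ n)] with x hx hb
  exact le_of_tendsto (hx.comp hu).norm (eventually_atTop.2 ⟨n₀, hb⟩)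

theorem memLp_of_tendsto_of_dominated (hb : MemLp b p μ)
    (hA : ∀ᶠ i in l, AEStronglyMeasurable (A i) μ) (hbound : ∀ᶠ i in l, ∀ᵐ x ∂μ, ‖A i x‖ ≤ b x)
    (hlim : ∀ᵐ x ∂μ, Tendsto (fun i => A i x) l (𝓝 (A₀ x))) : MemLp A₀ p μ := by
  obtain ⟨u, hu⟩ := l.exists_seq_tendsto
  obtain ⟨n₀, hn₀⟩ := eventually_atTop.1 (hu.eventually hA)
  refine hb.mono' (aestronglyMeasurable_of_tendsto_ae (u := atTop) (f := fun n => A (u (n + n₀)))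
    (fun n => hn₀ _ (Nat.le_add_left _ _)) ?_) (ae_norm_le_of_tendsto hbound hlim)
  filter_upwards [hlim] with x hx
  exact (tendsto_add_atTop_iff_nat n₀).2 (hx.comp hu)

theorem tendsto_eLpNorm_sub_of_dominated (hp₀ : p ≠ 0) (hp : p ≠ ⊤) (hb : MemLp b p μ)
    (hA : ∀ᶠ i in l, AEStronglyMeasurable (A i) μ) (hbound : ∀ᶠ i in l, ∀ᵐ x ∂μ, ‖A i x‖ ≤ b x)
    (hlim : ∀ᵐ x ∂μ, Tendsto (fun i => A i x) l (𝓝 (A₀ x))) :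
    Tendsto (fun i => eLpNorm (A i - A₀) p μ) l (𝓝 0) := by
  have hp' : 0 < p.toReal := ENNReal.toReal_pos hp₀ hp
  have hA₀ := memLp_of_tendsto_of_dominated hb hA hbound hlim
  have hlintegral : Tendsto (fun i => ∫⁻ x, ‖A i x - A₀ x‖ₑ ^ p.toReal ∂μ) l
      (𝓝 (∫⁻ _, 0 ∂μ)) := by
    refine tendsto_lintegral_filter_of_dominated_convergence'
      (fun x => ‖(2 : ℝ) • b x‖ₑ ^ p.toReal)
      (hA.mono fun i hi => (hi.sub hA₀.1).enorm.pow_const _) ?_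
      (lintegral_rpow_enorm_lt_top_of_eLpNorm_lt_top hp₀ hp (hb.const_smul (2 : ℝ)).2).ne ?_
    · filter_upwards [hbound] with i hi
      filter_upwards [hi, ae_norm_le_of_tendsto hbound hlim] with x hx hx₀
      gcongr
      refine enorm_le_iff_norm_le.2 ((norm_sub_le _ _).trans ((add_le_add hx hx₀).trans ?_))
      rw [smul_eq_mul, two_mul]
      exact le_abs_self _
    · filter_upwards [hlim] with x hx
      have hsub : Tendsto (fun i => ‖A i x - A₀ x‖ₑ) l (𝓝 0) := by
        simpa using (hx.sub_const (A₀ x)).enorm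
      simpa [hp'] using hsub.ennrpow_const p.toReal
  simp only [eLpNorm_eq_lintegral_rpow_enorm_toReal hp₀ hp, Pi.sub_apply]
  simpa [hp'] using hlintegral.ennrpow_const (1 / p.toReal)

end DominatedConvergence

section FourierTransform

variable {ι E F : Type*} {l : Filter ι} [NormedAddCommGroup E] [InnerProductSpace ℝ E]
  [FiniteDimensional ℝ E] [MeasurableSpace E] [BorelSpace E] [NormedAddCommGroup F]

section Uniform

variable [NormedSpace ℂ F] {h h' : E → F} {A : ι → E → F} {A₀ : E → F} {b : E → ℝ}

theorem fourier_sub (hh : Integrable h) (hh' : Integrable h') : 𝓕 (h - h') = 𝓕 h - 𝓕 h' := by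
  ext x
  simp only [Real.fourier_eq, Pi.sub_apply, smul_sub]
  exact integral_sub ((Real.fourierIntegral_convergent_iff x).2 hh)
    ((Real.fourierIntegral_convergent_iff x).2 hh')

theorem enorm_fourier_le (h : E → F) (x : E) : ‖𝓕 h x‖ₑ ≤ eLpNorm h 1 volume := by
  rw [Real.fourier_eq, eLpNorm_one_eq_lintegral_enorm]
  refine (enorm_integral_le_lintegral_enorm _).trans (le_of_eq ?_)
  simp only [← ofReal_norm, Circle.norm_smul]

theorem tendstoUniformly_fourier (hA : ∀ᶠ i in l, Integrable (A i)) (hA₀ : Integrable A₀)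
    (hlim : Tendsto (fun i => eLpNorm (A i - A₀) 1 volume) l (𝓝 0)) :
    TendstoUniformly (fun i => 𝓕 (A i)) (𝓕 A₀) l := by
  rw [← tendstoUniformlyOn_univ, EMetric.tendstoUniformlyOn_iff]
  intro δ hδ
  filter_upwards [hA, hlim.eventually_lt_const hδ] with i hi hlt x _
  rw [edist_comm, edist_eq_enorm_sub, ← Pi.sub_apply, ← fourier_sub hi hA₀]
  exact (enorm_fourier_le _ x).trans_lt hlt

theorem tendstoUniformly_fourier_of_dominated [l.IsCountablyGenerated] [l.NeBot]
    (hb : Integrable b) (hA : ∀ᶠ i in l, Integrable (A i))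
    (hbound : ∀ᶠ i in l, ∀ᵐ x, ‖A i x‖ ≤ b x)
    (hlim : ∀ᵐ x, Tendsto (fun i => A i x) l (𝓝 (A₀ x))) :
    TendstoUniformly (fun i => 𝓕 (A i)) (𝓕 A₀) l := by
  rw [← memLp_one_iff_integrable] at hb
  have hmeas := hA.mono fun i hi => hi.1
  exact tendstoUniformly_fourier hA
    (memLp_one_iff_integrable.1 (memLp_of_tendsto_of_dominated hb hmeas hbound hlim))
    (tendsto_eLpNorm_sub_of_dominated one_ne_zero ENNReal.one_ne_top hb hmeas hbound hlim)

end Uniform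

section Plancherel

variable [InnerProductSpace ℂ F] [CompleteSpace F] {h : E → F} {A : ι → E → F} {A₀ : E → F}
  {b : E → ℝ}

theorem fourier_toLp_ae_eq (hint : Integrable h) (hL2 : MemLp h 2) :
    (𝓕 (hL2.toLp h) : Lp F 2 (volume : Measure E)) =ᵐ[volume] 𝓕 h := by
  set H := hL2.toLp h
  have hcont : Continuous (𝓕 h) :=
    VectorFourier.fourierIntegral_continuous Real.continuous_fourierChar continuous_inner hint
  refine ae_eq_of_integral_contDiff_smul_eq
    ((Lp.memLp (𝓕 H)).locallyIntegrable (by norm_num)) hcont.locallyIntegrable fun φ hφ hφc => ?_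
  have hφc' : HasCompactSupport fun x => (φ x : ℂ) := hφc.comp_left Complex.ofReal_zero
  set Φ : 𝓢(E, ℂ) := hφc'.toSchwartzMap (Complex.ofRealCLM.contDiff.comp hφ)
  have hdistr : (𝓕 (H : 𝓢'(E, F))) Φ = ((𝓕 H : Lp F 2 (volume : Measure E)) : 𝓢'(E, F)) Φ := by
    rw [Lp.fourier_toTemperedDistribution_eq]
  rw [TemperedDistribution.fourier_apply, Lp.toTemperedDistribution_apply,
    Lp.toTemperedDistribution_apply] at hdistr
  have hflip : ∫ x, (𝓕 (Φ : E → ℂ)) x • h x = ∫ x, Φ x • 𝓕 h x := by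
    simpa using! VectorFourier.integral_fourierIntegral_smul_eq_flip (L := innerₗ E)
      Real.continuous_fourierChar continuous_inner Φ.integrable hint
  calc ∫ x, φ x • (𝓕 H : Lp F 2 (volume : Measure E)) x
      = ∫ x, Φ x • (𝓕 H : Lp F 2 (volume : Measure E)) x := rfl
    _ = ∫ x, 𝓕 Φ x • H x := hdistr.symm
    _ = ∫ x, (𝓕 (Φ : E → ℂ)) x • h x :=
        integral_congr_ae (hL2.coeFn_toLp.mono fun x hx => congrArg (𝓕 Φ x • ·) hx)
    _ = ∫ x, φ x • 𝓕 h x := hflip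

theorem eLpNorm_fourier (hint : Integrable h) (hL2 : MemLp h 2) :
    eLpNorm (𝓕 h) 2 volume = eLpNorm h 2 volume := by
  rw [← eLpNorm_congr_ae (fourier_toLp_ae_eq hint hL2), ← Lp.enorm_def, ← ofReal_norm,
    Lp.norm_fourier_eq, ofReal_norm, Lp.enorm_toLp]

theorem tendsto_eLpNorm_fourier_sub_of_dominated [l.IsCountablyGenerated] [l.NeBot]
    (hb₁ : Integrable b) (hb₂ : MemLp b 2) (hA : ∀ᶠ i in l, Integrable (A i))
    (hbound : ∀ᶠ i in l, ∀ᵐ x, ‖A i x‖ ≤ b x)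
    (hlim : ∀ᵐ x, Tendsto (fun i => A i x) l (𝓝 (A₀ x))) :
    Tendsto (fun i => eLpNorm (𝓕 (A i) - 𝓕 A₀) 2 volume) l (𝓝 0) := by
  have hmeas := hA.mono fun i hi => hi.1
  have hA₀ : Integrable A₀ := memLp_one_iff_integrable.1
    (memLp_of_tendsto_of_dominated (memLp_one_iff_integrable.2 hb₁) hmeas hbound hlim)
  have hA₀' := memLp_of_tendsto_of_dominated hb₂ hmeas hbound hlim
  refine (tendsto_eLpNorm_sub_of_dominated two_ne_zero ENNReal.ofNat_ne_top hb₂ hmeas hbound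
    hlim).congr' ?_
  filter_upwards [hA, hbound] with i hi hbi
  rw [← fourier_sub hi hA₀, eLpNorm_fourier (hi.sub hA₀) ((hb₂.mono' hi.1 hbi).sub hA₀')]

end Plancherel

end FourierTransform

section Weights

variable {E : Type*} [NormedAddCommGroup E]

theorem inv_one_add_norm_pow_le_one (x : E) (N : ℕ) : ((1 + ‖x‖) ^ N)⁻¹ ≤ 1 :=
  inv_le_one_of_one_le₀ (one_le_pow₀ (le_add_of_nonneg_right (norm_nonneg x)))

variable [NormedSpace ℝ E] [FiniteDimensional ℝ E]
  [MeasurableSpace E] [BorelSpace E] {μ : Measure E} [μ.IsAddHaarMeasure]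

theorem integrable_inv_one_add_norm_pow {N : ℕ} (hN : Module.finrank ℝ E < N) :
    Integrable (fun x : E => ((1 + ‖x‖) ^ N)⁻¹) μ := by
  refine (integrable_one_add_norm (Nat.cast_lt.2 hN)).congr (.of_forall fun x => ?_)
  simp only [Real.rpow_neg (by positivity : 0 ≤ 1 + ‖x‖), Real.rpow_natCast]

theorem memLp_two_inv_one_add_norm_pow {N : ℕ} (hN : Module.finrank ℝ E < N) :
    MemLp (fun x : E => ((1 + ‖x‖) ^ N)⁻¹) 2 μ := by
  rw [memLp_two_iff_integrable_sq (integrable_inv_one_add_norm_pow hN).1]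
  simp only [inv_pow, ← pow_mul]
  exact integrable_inv_one_add_norm_pow (by lia)

end Weights

section Curves

variable {X E F H ι : Type*} [TopologicalSpace X] [NormedAddCommGroup E] [NormedSpace ℝ E]
  [NormedAddCommGroup F] [NormedSpace ℝ F] [NormedAddCommGroup H] [InnerProductSpace ℂ H]
  {K : Set X}

theorem exists_one_add_norm_pow_mul_le_of_isCompact (hK : IsCompact K) {f : X → 𝓢(E, F)}
    (hf : ContinuousOn f K) (N : ℕ) :
    ∃ C, 0 ≤ C ∧ ∀ t ∈ K, ∀ w, (1 + ‖w‖) ^ N * ‖f t w‖ ≤ C := by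
  set P : Seminorm ℝ 𝓢(E, F) :=
    (Finset.Iic ((N, 0) : ℕ × ℕ)).sup fun m => SchwartzMap.seminorm ℝ m.1 m.2
  have hPcont : Continuous P := Seminorm.continuous_finsetSup fun m _ =>
    (schwartz_withSeminorms ℝ E F).continuous_seminorm m
  obtain ⟨C, hC⟩ := hK.exists_bound_of_continuousOn (hPcont.comp_continuousOn hf)
  refine ⟨2 ^ N * max C 0, by positivity, fun t ht w => ?_⟩
  calc (1 + ‖w‖) ^ N * ‖f t w‖ ≤ 2 ^ N * P (f t) := by
        simpa using one_add_le_sup_seminorm_apply (𝕜 := ℝ) (m := (N, 0)) le_rfl le_rfl (f t) w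
    _ ≤ 2 ^ N * max C 0 := by
        gcongr
        exact ((le_abs_self _).trans (hC t ht)).trans (le_max_left _ _)

variable [MeasureSpace E] [BorelSpace E] [SecondCountableTopology E]
  [(volume : Measure E).HasTemperateGrowth]

theorem continuous_energy [Fintype ι] (e : ι → E) (m : ℕ) :
    Continuous (energy e m : 𝓢(E, H) → ℝ) := by
  have hl2norm : Continuous (l2norm : 𝓢(E, H) → ℝ) := (toLpCLM ℂ H 2 volume).continuous.norm
  induction m with
  | zero => exact hl2norm.pow 2
  | succ m ih =>
    exact (hl2norm.pow 2).add (continuous_finsetSum _ fun a _ =>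
      ih.comp (LineDeriv.lineDerivOpCLM ℂ 𝓢(E, H) (e a)).continuous)

theorem exists_energy_le_of_isCompact [Fintype ι] (e : ι → E) (m : ℕ) (hK : IsCompact K)
    {f : X → 𝓢(E, H)} (hf : ContinuousOn f K) :
    ∃ B, 0 ≤ B ∧ ∀ t ∈ K, energy e m (f t) ≤ B := by
  obtain ⟨C, hC⟩ := hK.exists_bound_of_continuousOn ((continuous_energy e m).comp_continuousOn hf)
  exact ⟨max C 0, le_max_right _ _,
    fun t ht => ((le_abs_self _).trans (hC t ht)).trans (le_max_left _ _)⟩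

theorem continuousOn_l2inner {f g : X → 𝓢(E, H)} (hf : ContinuousOn f K)
    (hg : ContinuousOn g K) : ContinuousOn (fun t => l2inner (g t) (f t)) K :=
  ContinuousOn.inner ((toLpCLM ℂ H 2 volume).continuous.comp_continuousOn hg)
    ((toLpCLM ℂ H 2 volume).continuous.comp_continuousOn hf)

end Curves

section Integration

variable {A B F : Type*} {mA : MeasurableSpace A} {mB : MeasurableSpace B} {μ : Measure A}
  {ν : Measure B} [NormedAddCommGroup F] {K : Set B}

theorem ae_prod_restrict_snd_mem (hK : MeasurableSet K) :
    ∀ᵐ q ∂μ.prod (ν.restrict K), q.2 ∈ K :=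
  Measure.quasiMeasurePreserving_snd.ae (ae_restrict_mem hK)

theorem integrable_prod_restrict_of_norm_le [TopologicalSpace A] [TopologicalSpace B]
    [OpensMeasurableSpace (A × B)] [SecondCountableTopology (A × B)] [SFinite μ] [SFinite ν]
    [IsFiniteMeasure (ν.restrict K)] (hK : MeasurableSet K) {f : A × B → F}
    (hf : ContinuousOn f (Set.univ ×ˢ K)) {b : A → ℝ} (hb : Integrable b μ)
    (hbound : ∀ a, ∀ t ∈ K, ‖f (a, t)‖ ≤ b a) : Integrable f (μ.prod (ν.restrict K)) := by
  have hmeas : AEStronglyMeasurable f (μ.prod (ν.restrict K)) := by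
    rw [← μ.restrict_univ, Measure.prod_restrict]
    exact hf.aestronglyMeasurable (MeasurableSet.univ.prod hK)
  refine (hb.comp_fst (ν.restrict K)).mono' hmeas ?_
  filter_upwards [ae_prod_restrict_snd_mem hK] with q hq
  exact hbound q.1 q.2 hq

theorem mul_norm_setIntegral_le [NormedSpace ℝ F] {f : B → F} (hK : ν K < ⊤) {c C : ℝ}
    (hc : 0 ≤ c) (hf : ∀ t ∈ K, c * ‖f t‖ ≤ C) :
    c * ‖∫ t in K, f t ∂ν‖ ≤ C * ν.real K := by
  rw [← norm_smul_of_nonneg hc, ← integral_smul]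
  exact norm_setIntegral_le_of_norm_le_const hK fun t ht =>
    (norm_smul_of_nonneg hc (f t)).trans_le (hf t ht)

end Integration

section Marginal

variable {T : ℝ} {h g : ℝ → PhaseFun d}

theorem continuousOn_density (hh : ContinuousOn h (Set.Icc 0 T))
    (hg : ContinuousOn g (Set.Icc 0 T)) :
    ContinuousOn (fun q : (Space d × Space d) × ℝ => (starRingEnd ℂ) (g q.2 q.1) * h q.2 q.1)
      (Set.univ ×ˢ Set.Icc 0 T) := by
  have hsnd : Set.MapsTo Prod.snd (Set.univ ×ˢ Set.Icc 0 T : Set ((Space d × Space d) × ℝ))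
    (Set.Icc 0 T) := fun q hq => hq.2
  exact (Complex.continuous_conj.comp_continuousOn (continuousOn_curve_apply
    (hg.comp continuousOn_snd hsnd) continuousOn_fst)).mul
    (continuousOn_curve_apply (hh.comp continuousOn_snd hsnd) continuousOn_fst)

theorem exists_norm_density_le (hh : ContinuousOn h (Set.Icc 0 T))
    (hg : ContinuousOn g (Set.Icc 0 T)) (N : ℕ) :
    ∃ C, 0 ≤ C ∧ ∀ w : Space d × Space d, ∀ t ∈ Set.Icc 0 T,
      ‖(starRingEnd ℂ) (g t w) * h t w‖ ≤ C * (((1 + ‖w.1‖) ^ N)⁻¹ * ((1 + ‖w.2‖) ^ N)⁻¹) := by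
  obtain ⟨Ch, hCh0, hCh⟩ := exists_one_add_norm_pow_mul_le_of_isCompact isCompact_Icc hh N
  obtain ⟨Cg, hCg0, hCg⟩ := exists_one_add_norm_pow_mul_le_of_isCompact isCompact_Icc hg N
  refine ⟨Cg * Ch, by positivity, fun w t ht => ?_⟩
  rw [norm_mul, RCLike.norm_conj, ← mul_inv, ← div_eq_mul_inv, le_div_iff₀ (by positivity)]
  calc ‖g t w‖ * ‖h t w‖ * ((1 + ‖w.1‖) ^ N * (1 + ‖w.2‖) ^ N)
      ≤ ‖g t w‖ * ‖h t w‖ * ((1 + ‖w‖) ^ N * (1 + ‖w‖) ^ N) := by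
        gcongr
        exacts [norm_fst_le w, norm_snd_le w]
    _ = ((1 + ‖w‖) ^ N * ‖g t w‖) * ((1 + ‖w‖) ^ N * ‖h t w‖) := by ring
    _ ≤ Cg * Ch := mul_le_mul (hCg t ht w) (hCh t ht w) (by positivity) hCg0

/-- The density `conj(g) h` on phase space, integrated over the momentum and over `[0, T]`: its
marginal in position. The components of `liouvilleFlux` are of this form. -/
def marginal (T : ℝ) (h g : ℝ → PhaseFun d) (x : Space d) : ℂ :=
  ∫ q, (starRingEnd ℂ) (g q.2 (x, q.1)) * h q.2 (x, q.1) ∂(liouvilleMeasure d T)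

/-- The inverse Fourier transform of `marginal T h g`, written as an integral of `L²` pairings in
order to exploit their decay in the frequency. -/
def marginalTransform (T : ℝ) (h g : ℝ → PhaseFun d) (q : Space d) : ℂ :=
  ∫ t in Set.Icc 0 T, l2inner (g t) (mulOp (fun w => planeWave ((2 * Real.pi) • q) w.1) (h t))

theorem integrable_density (hh : ContinuousOn h (Set.Icc 0 T))
    (hg : ContinuousOn g (Set.Icc 0 T)) :
    Integrable (fun q : (Space d × Space d) × ℝ => (starRingEnd ℂ) (g q.2 q.1) * h q.2 q.1)
      ((volume : Measure (Space d × Space d)).prod (volume.restrict (Set.Icc 0 T))) := by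
  obtain ⟨C, -, hC⟩ := exists_norm_density_le hh hg (d + 1)
  have hweight : Integrable fun x : Space d => ((1 + ‖x‖) ^ (d + 1))⁻¹ :=
    integrable_inv_one_add_norm_pow (by simp)
  exact integrable_prod_restrict_of_norm_le measurableSet_Icc (continuousOn_density hh hg)
    ((hweight.mul_prod hweight).const_mul C) hC

theorem continuousOn_density_slice (hh : ContinuousOn h (Set.Icc 0 T))
    (hg : ContinuousOn g (Set.Icc 0 T)) (x : Space d) :
    ContinuousOn (fun q : Space d × ℝ => (starRingEnd ℂ) (g q.2 (x, q.1)) * h q.2 (x, q.1))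
      (Set.univ ×ˢ Set.Icc 0 T) :=
  (continuousOn_density hh hg).comp (f := fun q : Space d × ℝ => ((x, q.1), q.2))
    (by fun_prop) fun _ hq => ⟨trivial, hq.2⟩

theorem exists_integrable_norm_density_le (hh : ContinuousOn h (Set.Icc 0 T))
    (hg : ContinuousOn g (Set.Icc 0 T)) :
    ∃ b : Space d → ℝ, Integrable b ∧ ∀ x k, ∀ t ∈ Set.Icc 0 T,
      ‖(starRingEnd ℂ) (g t (x, k)) * h t (x, k)‖ ≤ b k := by
  obtain ⟨C, hC0, hC⟩ := exists_norm_density_le hh hg (d + 1)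
  refine ⟨fun k => C * ((1 + ‖k‖) ^ (d + 1))⁻¹,
    (integrable_inv_one_add_norm_pow (by simp)).const_mul C, fun x k t ht => ?_⟩
  exact (hC (x, k) t ht).trans (mul_le_mul_of_nonneg_left
    (mul_le_of_le_one_left (by positivity) (inv_one_add_norm_pow_le_one x _)) hC0)

theorem integrable_density_slice (hh : ContinuousOn h (Set.Icc 0 T))
    (hg : ContinuousOn g (Set.Icc 0 T)) (x : Space d) :
    Integrable (fun q : Space d × ℝ => (starRingEnd ℂ) (g q.2 (x, q.1)) * h q.2 (x, q.1))
      (liouvilleMeasure d T) := by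
  obtain ⟨b, hb, hbound⟩ := exists_integrable_norm_density_le hh hg
  exact integrable_prod_restrict_of_norm_le measurableSet_Icc (continuousOn_density_slice hh hg x)
    hb (hbound x)

theorem continuous_marginal (hh : ContinuousOn h (Set.Icc 0 T))
    (hg : ContinuousOn g (Set.Icc 0 T)) : Continuous (marginal T h g) := by
  obtain ⟨b, hb, hbound⟩ := exists_integrable_norm_density_le hh hg
  have hmem : ∀ᵐ q ∂(liouvilleMeasure d T), q.2 ∈ Set.Icc 0 T :=
    ae_prod_restrict_snd_mem measurableSet_Icc
  refine continuous_of_dominated (bound := fun q : Space d × ℝ => b q.1)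
    (fun x => (integrable_density_slice hh hg x).1) (fun x => ?_) (hb.comp_fst _) ?_
  · filter_upwards [hmem] with q hq using hbound x q.1 q.2 hq
  · filter_upwards [hmem] with q hq
    exact (continuousOn_density hh hg).comp_continuous (f := fun x => ((x, q.1), q.2))
      (by fun_prop) fun _ => ⟨trivial, hq⟩

theorem marginal_eq_integral_integral (hh : ContinuousOn h (Set.Icc 0 T))
    (hg : ContinuousOn g (Set.Icc 0 T)) (x : Space d) :
    marginal T h g x =
      ∫ k, ∫ t in Set.Icc 0 T, (starRingEnd ℂ) (g t (x, k)) * h t (x, k) :=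
  integral_prod _ (integrable_density_slice hh hg x)

theorem integrable_marginal (hh : ContinuousOn h (Set.Icc 0 T))
    (hg : ContinuousOn g (Set.Icc 0 T)) : Integrable (marginal T h g) :=
  (integrable_density hh hg).integral_prod_left.integral_prod_left.congr
    (.of_forall fun x => (marginal_eq_integral_integral hh hg x).symm)

theorem fourierChar_eq_planeWave (x q : Space d) :
    (Real.fourierChar ⟪x, q⟫_ℝ : ℂ) = planeWave ((2 * Real.pi) • q) x := by
  rw [planeWave, Real.fourierChar_apply, inner_smul_left, real_inner_comm]
  simp only [conj_trivial]
  push_cast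
  ring_nf

theorem l2inner_mulOp_planeWave_eq_integral (p : Space d) (f g : PhaseFun d) :
    l2inner g (mulOp (fun w => planeWave p w.1) f) =
      ∫ w, planeWave p w.1 * ((starRingEnd ℂ) (g w) * f w) := by
  simp only [l2inner_eq_integral, mulOp_apply (hasTemperateGrowth_planeWave_fst p)]
  exact integral_congr_ae (.of_forall fun w => mul_left_comm _ _ _)

theorem fourierInv_marginal (hh : ContinuousOn h (Set.Icc 0 T))
    (hg : ContinuousOn g (Set.Icc 0 T)) : 𝓕⁻ (marginal T h g) = marginalTransform T h g := by
  ext q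
  set p := (2 * Real.pi) • q
  have hint : Integrable (fun y : (Space d × Space d) × ℝ =>
      planeWave p y.1.1 * ((starRingEnd ℂ) (g y.2 y.1) * h y.2 y.1))
      ((volume : Measure (Space d × Space d)).prod (volume.restrict (Set.Icc 0 T))) :=
    (integrable_density hh hg).bdd_mul (c := 1)
      ((contDiff_planeWave p).continuous.comp
        (continuous_fst.comp continuous_fst)).aestronglyMeasurable
      (.of_forall fun y => (norm_planeWave p y.1.1).le)
  calc 𝓕⁻ (marginal T h g) q
      = ∫ x, ∫ k, ∫ t in Set.Icc 0 T,
          planeWave p x * ((starRingEnd ℂ) (g t (x, k)) * h t (x, k)) := by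
        simp only [Real.fourierInv_eq, Circle.smul_def, fourierChar_eq_planeWave, smul_eq_mul,
          marginal_eq_integral_integral hh hg, integral_const_mul, p]
    _ = ∫ w : Space d × Space d, ∫ t in Set.Icc 0 T,
          planeWave p w.1 * ((starRingEnd ℂ) (g t w) * h t w) :=
        (integral_prod _ hint.integral_prod_left).symm
    _ = ∫ t in Set.Icc 0 T, ∫ w : Space d × Space d,
          planeWave p w.1 * ((starRingEnd ℂ) (g t w) * h t w) := integral_integral_swap hint
    _ = marginalTransform T h g q := by
        simp only [marginalTransform, l2inner_mulOp_planeWave_eq_integral, p]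

theorem norm_le_norm_two_pi_smul {E : Type*} [NormedAddCommGroup E] [NormedSpace ℝ E] (q : E) :
    ‖q‖ ≤ ‖(2 * Real.pi) • q‖ := by
  rw [norm_smul_of_nonneg Real.two_pi_pos.le]
  exact le_mul_of_one_le_left (norm_nonneg _) (by linarith [Real.pi_gt_three])

theorem exists_marginalTransform_le (hh : ContinuousOn h (Set.Icc 0 T))
    (hg : ContinuousOn g (Set.Icc 0 T)) (n : ℕ) :
    ∃ C, ∀ q, (1 + ‖q‖) ^ n * ‖marginalTransform T h g q‖ ≤ C := by
  obtain ⟨Bh, -, hBh⟩ := exists_energy_le_of_isCompact coordDir (n + 1) isCompact_Icc hh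
  obtain ⟨Bg, -, hBg⟩ := exists_energy_le_of_isCompact coordDir (n + 1) isCompact_Icc hg
  refine ⟨(1 + 2 * d) ^ n * max Bh Bg * volume.real (Set.Icc 0 T), fun q =>
    mul_norm_setIntegral_le measure_Icc_lt_top (by positivity) fun t ht => ?_⟩
  refine le_trans ?_ (one_add_norm_pow_mul_mulOp_le ((2 * Real.pi) • q) n
    ((hBh t ht).trans (le_max_left _ _)) ((hBg t ht).trans (le_max_right _ _)))
  gcongr
  exact norm_le_norm_two_pi_smul q

theorem continuous_marginalTransform (hh : ContinuousOn h (Set.Icc 0 T))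
    (hg : ContinuousOn g (Set.Icc 0 T)) : Continuous (marginalTransform T h g) := by
  rw [← fourierInv_marginal hh hg, funext (Real.fourierInv_eq_fourier_neg (marginal T h g))]
  exact (VectorFourier.fourierIntegral_continuous Real.continuous_fourierChar continuous_inner
    (integrable_marginal hh hg)).comp continuous_neg

theorem integrable_mul_marginalTransform (hh : ContinuousOn h (Set.Icc 0 T))
    (hg : ContinuousOn g (Set.Icc 0 T)) {a : Space d → ℂ} (ha : Continuous a)
    (ha_le : ∀ q, ‖a q‖ ≤ 1 + ‖q‖) : Integrable fun q => a q * marginalTransform T h g q := by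
  obtain ⟨C, hC⟩ := exists_marginalTransform_le hh hg (d + 1 + 1)
  refine ((integrable_inv_one_add_norm_pow (N := d + 1) (by simp)).const_mul C).mono'
    (ha.mul (continuous_marginalTransform hh hg)).aestronglyMeasurable (.of_forall fun q => ?_)
  rw [norm_mul, ← div_eq_mul_inv, le_div_iff₀ (by positivity)]
  calc ‖a q‖ * ‖marginalTransform T h g q‖ * (1 + ‖q‖) ^ (d + 1)
      ≤ (1 + ‖q‖) * ‖marginalTransform T h g q‖ * (1 + ‖q‖) ^ (d + 1) := by
        gcongr
        exact ha_le q
    _ = (1 + ‖q‖) ^ (d + 1 + 1) * ‖marginalTransform T h g q‖ := by ring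
    _ ≤ C := hC q

theorem integrable_marginalTransform (hh : ContinuousOn h (Set.Icc 0 T))
    (hg : ContinuousOn g (Set.Icc 0 T)) : Integrable (marginalTransform T h g) := by
  simpa using integrable_mul_marginalTransform hh hg (a := fun _ => 1) continuous_const
    (fun q => by simp)

theorem integrable_norm_mul_marginalTransform (hh : ContinuousOn h (Set.Icc 0 T))
    (hg : ContinuousOn g (Set.Icc 0 T)) :
    Integrable fun q => ‖q‖ * ‖marginalTransform T h g q‖ := by
  simpa using (integrable_mul_marginalTransform hh hg (a := fun q => (‖q‖ : ℂ)) (by fun_prop)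
    (fun q => by simp)).norm

theorem marginal_eq_fourier (hh : ContinuousOn h (Set.Icc 0 T))
    (hg : ContinuousOn g (Set.Icc 0 T)) : marginal T h g = 𝓕 (marginalTransform T h g) := by
  have hint : Integrable (𝓕 (marginal T h g)) := by
    refine (integrable_marginalTransform hh hg).comp_neg.congr (.of_forall fun x => ?_)
    simp only [← fourierInv_marginal hh hg, Real.fourierInv_eq_fourier_neg, neg_neg]
  rw [← fourierInv_marginal hh hg]
  exact ((continuous_marginal hh hg).fourier_fourierInv_eq (integrable_marginal hh hg) hint).symm

theorem differentiable_marginal (hh : ContinuousOn h (Set.Icc 0 T))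
    (hg : ContinuousOn g (Set.Icc 0 T)) : Differentiable ℝ (marginal T h g) := by
  rw [marginal_eq_fourier hh hg]
  exact Real.differentiable_fourier (integrable_marginalTransform hh hg)
    (integrable_norm_mul_marginalTransform hh hg)

theorem fderiv_marginal_single (hh : ContinuousOn h (Set.Icc 0 T))
    (hg : ContinuousOn g (Set.Icc 0 T)) (x : Space d) (j : Fin d) :
    fderiv ℝ (marginal T h g) x (EuclideanSpace.single j 1) =
      𝓕 (fun q => -(2 * Real.pi * Complex.I * (q j : ℂ)) * marginalTransform T h g q) x := by
  have hnorm := integrable_norm_mul_marginalTransform hh hg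
  have hsmulRight : Integrable
      (VectorFourier.fourierSMulRight (innerSL ℝ) (marginalTransform T h g)) := by
    refine (hnorm.const_mul (2 * Real.pi * ‖innerSL ℝ (E := Space d)‖)).mono'
      (continuous_marginalTransform hh hg).aestronglyMeasurable.fourierSMulRight
      (.of_forall fun q => ?_)
    exact (VectorFourier.norm_fourierSMulRight_le _ _ _).trans_eq (mul_assoc _ _ _)
  rw [marginal_eq_fourier hh hg, Real.fderiv_fourier (integrable_marginalTransform hh hg) hnorm,
    Real.fourier_continuousLinearMap_apply hsmulRight]
  refine congrFun (congrArg 𝓕 (funext fun q => ?_)) x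
  have hinner : innerSL ℝ q (EuclideanSpace.single j (1 : ℝ)) = q j := by
    simp [innerSL_apply_apply, EuclideanSpace.inner_single_right]
  rw [VectorFourier.fourierSMulRight_apply, hinner, Complex.real_smul, smul_eq_mul]
  ring

end Marginal

section Liouville

variable {T : ℝ} {f g : ℝ → PhaseFun d}

theorem liouvilleFlux_eq_marginal (T : ℝ) (f g : ℝ → PhaseFun d) (j : Fin d) :
    liouvilleFlux T f g j = marginal T (fun t => ∂_{momDir j} (f t)) g := rfl

/-- The inverse Fourier transform of the Liouville representative, written as an integral of `L²`
pairings with the Liouville force operator whose potential is a plane wave. -/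
def liouvilleTransform (T : ℝ) (f g : ℝ → PhaseFun d) (q : Space d) : ℂ :=
  ∫ t in Set.Icc 0 T, l2inner (g t) (forceCLM (planeWave ((2 * Real.pi) • q)) (f t))

theorem continuousOn_lineDeriv_curve {K : Set ℝ} (hf : ContinuousOn f K)
    (v : Space d × Space d) : ContinuousOn (fun t => (∂_{v} (f t) : PhaseFun d)) K :=
  (LineDeriv.lineDerivOpCLM ℂ (PhaseFun d) v).continuous.comp_continuousOn hf

theorem integrable_liouvilleIntegrand (hf : ContinuousOn f (Set.Icc 0 T))
    (hg : ContinuousOn g (Set.Icc 0 T)) (j : Fin d) (x : Space d) :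
    Integrable (liouvilleIntegrand f g j x) (liouvilleMeasure d T) :=
  integrable_density_slice (continuousOn_lineDeriv_curve hf (momDir j)) hg x

theorem differentiable_liouvilleFlux (hf : ContinuousOn f (Set.Icc 0 T))
    (hg : ContinuousOn g (Set.Icc 0 T)) (j : Fin d) : Differentiable ℝ (liouvilleFlux T f g j) :=
  differentiable_marginal (continuousOn_lineDeriv_curve hf (momDir j)) hg

theorem l2inner_forceCLM_planeWave (q : Space d) (f g : PhaseFun d) :
    l2inner g (forceCLM (planeWave ((2 * Real.pi) • q)) f) =
      ∑ j : Fin d, (2 * Real.pi * Complex.I * (q j : ℂ)) *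
        l2inner g (mulOp (fun w => planeWave ((2 * Real.pi) • q) w.1) (∂_{momDir j} f)) := by
  rw [forceCLM_planeWave, l2inner_sum_right]
  refine Finset.sum_congr rfl fun j _ => ?_
  rw [l2inner_smul_right, PiLp.smul_apply, smul_eq_mul]
  push_cast
  ring

theorem liouvilleTransform_eq_sum (hf : ContinuousOn f (Set.Icc 0 T))
    (hg : ContinuousOn g (Set.Icc 0 T)) (q : Space d) :
    liouvilleTransform T f g q = ∑ j : Fin d, (2 * Real.pi * Complex.I * (q j : ℂ)) *
      marginalTransform T (fun t => ∂_{momDir j} (f t)) g q := by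
  have hcont : ∀ j : Fin d, ContinuousOn (fun t => l2inner (g t) (mulOp
      (fun w => planeWave ((2 * Real.pi) • q) w.1) (∂_{momDir j} (f t)))) (Set.Icc 0 T) := fun j =>
    continuousOn_l2inner ((mulOp _).continuous.comp_continuousOn
      (continuousOn_lineDeriv_curve hf (momDir j))) hg
  simp only [liouvilleTransform, marginalTransform, l2inner_forceCLM_planeWave]
  rw [integral_finsetSum _ fun j _ =>
    ((hcont j).integrableOn_compact isCompact_Icc).const_mul _]
  exact Finset.sum_congr rfl fun j _ => integral_const_mul _ _

theorem integrable_coord_mul_marginalTransform (hf : ContinuousOn f (Set.Icc 0 T))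
    (hg : ContinuousOn g (Set.Icc 0 T)) (j : Fin d) :
    Integrable fun q : Space d =>
      (2 * Real.pi * Complex.I * (q j : ℂ)) * marginalTransform T f g q := by
  have hcoord : ∀ q : Space d, ‖(q j : ℂ)‖ ≤ 1 + ‖q‖ := fun q => by
    rw [Complex.norm_real]
    exact (PiLp.norm_apply_le q j).trans (le_add_of_nonneg_left zero_le_one)
  simpa only [mul_assoc] using (integrable_mul_marginalTransform hf hg
    (a := fun q => (q j : ℂ)) (by fun_prop) hcoord).const_mul (2 * Real.pi * Complex.I)

theorem liouvilleRep_eq_fourier (hf : ContinuousOn f (Set.Icc 0 T))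
    (hg : ContinuousOn g (Set.Icc 0 T)) : liouvilleRep T f g = 𝓕 (liouvilleTransform T f g) := by
  ext x
  have hint := fun j : Fin d => integrable_coord_mul_marginalTransform
    (continuousOn_lineDeriv_curve hf (momDir j)) hg j
  have hsum : 𝓕 (liouvilleTransform T f g) x = ∑ j : Fin d,
      𝓕 (fun q => (2 * Real.pi * Complex.I * (q j : ℂ)) *
        marginalTransform T (fun t => ∂_{momDir j} (f t)) g q) x := by
    simp only [Real.fourier_eq, liouvilleTransform_eq_sum hf hg, Finset.smul_sum]
    exact integral_finsetSum _ fun j _ => (Real.fourierIntegral_convergent_iff x).2 (hint j)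
  rw [liouvilleRep, hsum, ← Finset.sum_neg_distrib]
  refine Finset.sum_congr rfl fun j _ => ?_
  rw [liouvilleFlux_eq_marginal, fderiv_marginal_single
    (continuousOn_lineDeriv_curve hf (momDir j)) hg, Real.fourier_eq, Real.fourier_eq,
    ← integral_neg]
  simp only [neg_mul, smul_neg, neg_neg]

end Liouville

section Wigner

variable {T ε : ℝ} {f g : ℝ → PhaseFun d}

theorem exists_shifted_density_le (hf : ContinuousOn f (Set.Icc 0 T))
    (hg : ContinuousOn g (Set.Icc 0 T)) (N : ℕ) :
    ∃ C, 0 ≤ C ∧ ∀ t ∈ Set.Icc 0 T, ∀ (w : Space d × Space d) (c : Space d),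
      ‖g t w‖ * ‖f t (w.1, w.2 + c)‖ ≤ C * (((1 + ‖c‖) ^ N)⁻¹ * ((1 + ‖w‖) ^ N)⁻¹) := by
  obtain ⟨Cf, hCf0, hCf⟩ := exists_one_add_norm_pow_mul_le_of_isCompact isCompact_Icc hf N
  obtain ⟨Cg, hCg0, hCg⟩ := exists_one_add_norm_pow_mul_le_of_isCompact isCompact_Icc hg (N + N)
  refine ⟨Cg * Cf, by positivity, fun t ht w c => ?_⟩
  rw [← mul_inv, ← div_eq_mul_inv, le_div_iff₀ (by positivity)]
  have hpeetre : 1 + ‖c‖ ≤ (1 + ‖w‖) * (1 + ‖(w.1, w.2 + c)‖) := by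
    have hc : ‖c‖ ≤ ‖w.2 + c‖ + ‖w.2‖ := by simpa using norm_sub_le (w.2 + c) w.2
    nlinarith [norm_snd_le w, norm_snd_le (w.1, w.2 + c), norm_nonneg w,
      norm_nonneg (w.1, w.2 + c)]
  calc ‖g t w‖ * ‖f t (w.1, w.2 + c)‖ * ((1 + ‖c‖) ^ N * (1 + ‖w‖) ^ N)
      ≤ ‖g t w‖ * ‖f t (w.1, w.2 + c)‖ *
        (((1 + ‖w‖) * (1 + ‖(w.1, w.2 + c)‖)) ^ N * (1 + ‖w‖) ^ N) := by gcongr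
    _ = ((1 + ‖w‖) ^ (N + N) * ‖g t w‖) *
        ((1 + ‖(w.1, w.2 + c)‖) ^ N * ‖f t (w.1, w.2 + c)‖) := by rw [mul_pow, pow_add]; ring
    _ ≤ Cg * Cf := mul_le_mul (hCg t ht w) (hCf t ht _) (by positivity) hCg0

theorem exists_wigner_density_le (hf : ContinuousOn f (Set.Icc 0 T))
    (hg : ContinuousOn g (Set.Icc 0 T)) (hε : 0 < ε) (N : ℕ) :
    ∃ C, ∀ t ∈ Set.Icc 0 T, ∀ (w : Space d × Space d) (p : Space d),
      ‖(starRingEnd ℂ) (g t w) * momentumDiff ε (f t) w.1 w.2 p‖ ≤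
        C * (((1 + ‖(ε / 2) • p‖) ^ N)⁻¹ * ((1 + ‖w‖) ^ N)⁻¹) := by
  obtain ⟨C, -, hC⟩ := exists_shifted_density_le hf hg N
  refine ⟨(C + C) / ε, fun t ht w p => ?_⟩
  have hplus := hC t ht w ((ε / 2) • p)
  have hminus := hC t ht w (-((ε / 2) • p))
  rw [norm_neg, ← sub_eq_add_neg] at hminus
  rw [norm_mul, RCLike.norm_conj, momentumDiff, norm_div, Complex.norm_real,
    Real.norm_of_nonneg hε.le, ← mul_div_assoc, div_mul_eq_mul_div]
  refine div_le_div_of_nonneg_right ?_ hε.le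
  calc ‖g t w‖ * ‖f t (w.1, w.2 + (ε / 2) • p) - f t (w.1, w.2 - (ε / 2) • p)‖
      ≤ ‖g t w‖ * (‖f t (w.1, w.2 + (ε / 2) • p)‖ + ‖f t (w.1, w.2 - (ε / 2) • p)‖) := by
        gcongr
        exact norm_sub_le _ _
    _ ≤ (C + C) * (((1 + ‖(ε / 2) • p‖) ^ N)⁻¹ * ((1 + ‖w‖) ^ N)⁻¹) := by
        rw [mul_add, add_mul]
        exact add_le_add hplus hminus

theorem wignerIntegrand_eq (ε : ℝ) (f g : ℝ → PhaseFun d) (x p : Space d)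
    (w : Space d × Space d) (t : ℝ) :
    wignerIntegrand ε f g x ((p, w), t) = planeWave p (-x) * (planeWave p w.1 *
      ((starRingEnd ℂ) (g t w) * momentumDiff ε (f t) w.1 w.2 p)) := by
  have hdef : wignerIntegrand ε f g x ((p, w), t) =
    planeWave p (w.1 - x) * (starRingEnd ℂ) (g t w) * momentumDiff ε (f t) w.1 w.2 p := rfl
  rw [hdef, sub_eq_add_neg, planeWave_add]
  ring

theorem norm_wignerIntegrand (ε : ℝ) (f g : ℝ → PhaseFun d) (x p : Space d)
    (w : Space d × Space d) (t : ℝ) :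
    ‖wignerIntegrand ε f g x ((p, w), t)‖ =
      ‖(starRingEnd ℂ) (g t w) * momentumDiff ε (f t) w.1 w.2 p‖ := by
  rw [wignerIntegrand_eq, norm_mul, norm_mul (planeWave p w.1), norm_planeWave, norm_planeWave,
    one_mul, one_mul]

theorem continuousOn_wignerIntegrand (hf : ContinuousOn f (Set.Icc 0 T))
    (hg : ContinuousOn g (Set.Icc 0 T)) (ε : ℝ) (x : Space d) :
    ContinuousOn (wignerIntegrand ε f g x) (Set.univ ×ˢ Set.Icc 0 T) := by
  have hsnd : Set.MapsTo Prod.snd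
    (Set.univ ×ˢ Set.Icc 0 T : Set ((Space d × Space d × Space d) × ℝ)) (Set.Icc 0 T) :=
    fun q hq => hq.2
  have hshift : ∀ c : ℝ, ContinuousOn (fun q : (Space d × Space d × Space d) × ℝ =>
      f q.2 (q.1.2.1, q.1.2.2 + c • q.1.1)) (Set.univ ×ˢ Set.Icc 0 T) := fun c =>
    continuousOn_curve_apply (hf.comp continuousOn_snd hsnd) (by fun_prop)
  have hconj : ContinuousOn (fun q : (Space d × Space d × Space d) × ℝ =>
      (starRingEnd ℂ) (g q.2 q.1.2)) (Set.univ ×ˢ Set.Icc 0 T) :=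
    Complex.continuous_conj.comp_continuousOn
      (continuousOn_curve_apply (hg.comp continuousOn_snd hsnd) (by fun_prop))
  have hexp : Continuous fun q : (Space d × Space d × Space d) × ℝ =>
      Complex.exp (Complex.I * (⟪q.1.1, q.1.2.1 - x⟫_ℝ : ℂ)) := by fun_prop
  refine ((hexp.continuousOn.mul hconj).mul
    (((hshift (ε / 2)).sub (hshift (-(ε / 2)))).div_const (ε : ℂ))).congr fun q _ => ?_
  simp only [wignerIntegrand, momentumDiff, neg_smul, ← sub_eq_add_neg, Prod.mk.eta,
    Pi.mul_apply, Pi.sub_apply]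

theorem integrable_wignerIntegrand (hf : ContinuousOn f (Set.Icc 0 T))
    (hg : ContinuousOn g (Set.Icc 0 T)) (hε : 0 < ε) (x : Space d) :
    Integrable (wignerIntegrand ε f g x) (wignerMeasure d T) := by
  obtain ⟨C, hC⟩ := exists_wigner_density_le hf hg hε (2 * d + 1)
  have hmomentum : Integrable fun p : Space d => ((1 + ‖p‖) ^ (2 * d + 1))⁻¹ :=
    integrable_inv_one_add_norm_pow (by simp; lia)
  have hphase : Integrable fun w : Space d × Space d => ((1 + ‖w‖) ^ (2 * d + 1))⁻¹ :=
    integrable_inv_one_add_norm_pow (by simp; lia)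
  refine integrable_prod_restrict_of_norm_le measurableSet_Icc
    (continuousOn_wignerIntegrand hf hg ε x)
    (((hmomentum.comp_smul (half_pos hε).ne').mul_prod hphase).const_mul C)
    fun ⟨p, w⟩ t ht => ?_
  rw [norm_wignerIntegrand]
  exact hC t ht w p

theorem integrable_wignerIntegrand_slice (hf : ContinuousOn f (Set.Icc 0 T))
    (hg : ContinuousOn g (Set.Icc 0 T)) (hε : 0 < ε) (x p : Space d) :
    Integrable (fun y : (Space d × Space d) × ℝ => wignerIntegrand ε f g x ((p, y.1), y.2))
      ((volume : Measure (Space d × Space d)).prod (volume.restrict (Set.Icc 0 T))) := by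
  obtain ⟨C, hC⟩ := exists_wigner_density_le hf hg hε (2 * d + 1)
  have hphase : Integrable fun w : Space d × Space d => ((1 + ‖w‖) ^ (2 * d + 1))⁻¹ :=
    integrable_inv_one_add_norm_pow (by simp; lia)
  refine integrable_prod_restrict_of_norm_le measurableSet_Icc
    ((continuousOn_wignerIntegrand hf hg ε x).comp
      (f := fun y : (Space d × Space d) × ℝ => ((p, y.1), y.2)) (by fun_prop)
      fun _ hy => ⟨trivial, hy.2⟩)
    (hphase.const_mul (C * ((1 + ‖(ε / 2) • p‖) ^ (2 * d + 1))⁻¹)) fun w t ht => ?_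
  rw [norm_wignerIntegrand, mul_assoc]
  exact hC t ht w p

/-- The contribution of the frequency `p` to the Wigner representative: the `L²` pairing of `g`
with the Wigner operator whose potential is the plane wave of frequency `p`, integrated
over `[0, T]`. -/
def wignerPairing (ε T : ℝ) (f g : ℝ → PhaseFun d) (p : Space d) : ℂ :=
  ∫ t in Set.Icc 0 T, l2inner (g t) (wignerCLM (planeWave p) ε (f t))

/-- The inverse Fourier transform of the Wigner representative: `wignerPairing` in the
normalisation `x ↦ e^{2πi q·x}` of characters that Mathlib's Fourier transform uses. -/
def wignerTransform (ε T : ℝ) (f g : ℝ → PhaseFun d) (q : Space d) : ℂ :=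
  wignerPairing ε T f g ((2 * Real.pi) • q)

theorem l2inner_wignerCLM_planeWave (p : Space d) (ε : ℝ) (f g : PhaseFun d) :
    l2inner g (wignerCLM (planeWave p) ε f) = Complex.I * ∫ w, planeWave p w.1 *
      ((starRingEnd ℂ) (g w) * momentumDiff ε f w.1 w.2 p) := by
  rw [l2inner_eq_integral, ← integral_const_mul]
  refine integral_congr_ae (.of_forall fun ⟨x, k⟩ => ?_)
  simp only [wignerCLM_planeWave_apply]
  ring

theorem integral_wignerIntegrand_frequency (hf : ContinuousOn f (Set.Icc 0 T))
    (hg : ContinuousOn g (Set.Icc 0 T)) (hε : 0 < ε) (x p : Space d) :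
    Complex.I * ∫ w : Space d × Space d, ∫ t in Set.Icc 0 T, wignerIntegrand ε f g x ((p, w), t) =
      planeWave p (-x) * wignerPairing ε T f g p := by
  rw [integral_integral_swap (integrable_wignerIntegrand_slice hf hg hε x p)]
  simp only [wignerIntegrand_eq, wignerPairing, l2inner_wignerCLM_planeWave, integral_const_mul]
  exact mul_left_comm _ _ _

theorem integrable_wignerPairing (hf : ContinuousOn f (Set.Icc 0 T))
    (hg : ContinuousOn g (Set.Icc 0 T)) (hε : 0 < ε) : Integrable (wignerPairing ε T f g) := by
  refine ((integrable_wignerIntegrand hf hg hε 0).integral_prod_left.integral_prod_left.const_mul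
    Complex.I).congr (.of_forall fun p => ?_)
  have hone : planeWave p (-0) = 1 := by simp [planeWave]
  exact (integral_wignerIntegrand_frequency hf hg hε 0 p).trans (by rw [hone, one_mul])

theorem integrable_wignerTransform (hf : ContinuousOn f (Set.Icc 0 T))
    (hg : ContinuousOn g (Set.Icc 0 T)) (hε : 0 < ε) : Integrable (wignerTransform ε T f g) :=
  (integrable_wignerPairing hf hg hε).comp_smul Real.two_pi_pos.ne'

theorem wignerRep_eq_integral (hf : ContinuousOn f (Set.Icc 0 T))
    (hg : ContinuousOn g (Set.Icc 0 T)) (hε : 0 < ε) (x : Space d) :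
    wignerRep ε T f g x =
      ((2 * Real.pi) ^ d)⁻¹ • ∫ p, planeWave p (-x) * wignerPairing ε T f g p := by
  have hint := integrable_wignerIntegrand hf hg hε x
  have hiterated : ∫ q, wignerIntegrand ε f g x q ∂(wignerMeasure d T) =
      ∫ p, ∫ w : Space d × Space d, ∫ t in Set.Icc 0 T, wignerIntegrand ε f g x ((p, w), t) :=
    (integral_prod _ hint).trans (integral_prod _ hint.integral_prod_left)
  simp only [wignerRep, hiterated, ← integral_wignerIntegrand_frequency hf hg hε,
    integral_const_mul, Complex.real_smul]
  push_cast
  ring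

theorem fourier_wignerTransform (ε T : ℝ) (f g : ℝ → PhaseFun d) (x : Space d) :
    𝓕 (wignerTransform ε T f g) x =
      ((2 * Real.pi) ^ d)⁻¹ • ∫ p, planeWave p (-x) * wignerPairing ε T f g p := by
  have hscale := Measure.integral_comp_smul volume
    (fun p : Space d => planeWave p (-x) * wignerPairing ε T f g p) (2 * Real.pi)
  rw [finrank_euclideanSpace_fin, abs_of_nonneg (by positivity)] at hscale
  rw [Real.fourier_eq, ← hscale]
  refine integral_congr_ae (.of_forall fun q => ?_)
  have hchar : (Real.fourierChar (-⟪q, x⟫_ℝ) : ℂ) = planeWave ((2 * Real.pi) • q) (-x) := by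
    rw [← fourierChar_eq_planeWave, inner_neg_left, real_inner_comm]
  exact congrArg (· * wignerTransform ε T f g q) hchar

theorem wignerRep_eq_fourier (hf : ContinuousOn f (Set.Icc 0 T))
    (hg : ContinuousOn g (Set.Icc 0 T)) (hε : 0 < ε) :
    wignerRep ε T f g = 𝓕 (wignerTransform ε T f g) :=
  funext fun x => (wignerRep_eq_integral hf hg hε x).trans (fourier_wignerTransform ε T f g x).symm

end Wigner

section Limit

variable {V : Space d → ℝ} {T : ℝ}

theorem exists_energy_solvesWigner_le (hV : IsAdmissiblePotential V) (hT : 0 ≤ T) (m : ℕ) :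
    ∃ C, 0 ≤ C ∧ ∀ ε, 0 < ε → ∀ f : ℝ → PhaseFun d, SolvesWigner V ε T f →
      ∀ s ∈ Set.Icc 0 T, ∀ t ∈ Set.Icc 0 T,
        energy coordDir m (f t) ≤ C * energy coordDir m (f s) := by
  obtain ⟨C, hC0, hC⟩ := exists_energy_wigner_le hV T m
  refine ⟨C, hC0, fun ε hε f hf s hs t ht => ?_⟩
  obtain ⟨F, hF, hFf⟩ := hf.exists_isCurve hV hT
  rw [← hFf hs, ← hFf ht]
  exact hC ε hε F hF s hs t ht

theorem exists_l2norm_solvesWigner_sub_le (hV : IsAdmissiblePotential V) (hT : 0 ≤ T)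
    {f₀ : ℝ → PhaseFun d} (hf₀ : SolvesLiouville V T f₀) :
    ∃ K, 0 ≤ K ∧ ∀ ε, 0 < ε → ∀ f : ℝ → PhaseFun d, SolvesWigner V ε T f →
      ∀ s ∈ Set.Icc 0 T, ∀ t ∈ Set.Icc 0 T, l2norm (f t - f₀ t) ^ 2 ≤
        Real.exp T * (l2norm (f s - f₀ s) ^ 2 + K * ε ^ 2) := by
  obtain ⟨F₀, hF₀, hFf₀⟩ := hf₀.exists_isCurve hV hT
  obtain ⟨K, hK0, hK⟩ := exists_l2norm_wigner_sub_liouville_le hV hF₀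
  refine ⟨K, hK0, fun ε hε f hf s hs t ht => ?_⟩
  obtain ⟨F, hF, hFf⟩ := hf.exists_isCurve hV hT
  rw [← hFf hs, ← hFf ht, ← hFf₀ hs, ← hFf₀ ht]
  exact hK ε hε F hF s hs t ht

/-- A family of curves of Schwartz functions which, at every time in `[0, T]`, converges in `L²`,
and whose derivatives are bounded in `L²` uniformly in time, for all small `ε > 0`. -/
structure ConvergesOnInterval (T : ℝ) (f : ℝ → ℝ → PhaseFun d) (f₀ : ℝ → PhaseFun d) : Prop where
  continuousOn : ∀ ε, 0 < ε → ContinuousOn (f ε) (Set.Icc 0 T)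
  continuousOn_limit : ContinuousOn f₀ (Set.Icc 0 T)
  bounded : ∀ m, ∃ B, ∀ᶠ ε in 𝓝[>] (0 : ℝ), ∀ t ∈ Set.Icc 0 T, energy coordDir m (f ε t) ≤ B
  tendsto : ∀ t ∈ Set.Icc 0 T, Tendsto (fun ε => l2norm (f ε t - f₀ t)) (𝓝[>] 0) (𝓝 0)

variable {f g : ℝ → ℝ → PhaseFun d} {f₀ g₀ : ℝ → PhaseFun d}

theorem ConvergesRegularly.convergesOnInterval {u : ℝ → PhaseFun d} {u₀ : PhaseFun d}
    (hu : ConvergesRegularly u u₀) (hV : IsAdmissiblePotential V) {s : ℝ} (hs : s ∈ Set.Icc 0 T)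
    (hf : ∀ ε, 0 < ε → SolvesWigner V ε T (f ε) ∧ f ε s = u ε)
    (hf₀ : SolvesLiouville V T f₀ ∧ f₀ s = u₀) : ConvergesOnInterval T f f₀ where
  continuousOn ε hε := (hf ε hε).1.continuousOn
  continuousOn_limit := hf₀.1.continuousOn
  bounded m := by
    obtain ⟨C, hC0, hC⟩ := exists_energy_solvesWigner_le hV (hs.1.trans hs.2) m
    obtain ⟨B, hB⟩ := hu.exists_energy_le m
    refine ⟨C * B, ?_⟩
    filter_upwards [hB, self_mem_nhdsWithin] with ε hBε (hε : 0 < ε) t ht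
    refine (hC ε hε _ (hf ε hε).1 s hs t ht).trans ?_
    rw [(hf ε hε).2]
    gcongr
  tendsto t ht := by
    obtain ⟨K, -, hK⟩ := exists_l2norm_solvesWigner_sub_le hV (hs.1.trans hs.2) hf₀.1
    have hid : Tendsto (fun ε : ℝ => ε) (𝓝[>] 0) (𝓝 0) := tendsto_id'.2 nhdsWithin_le_nhds
    have hlim : Tendsto (fun ε => √(Real.exp T * (l2norm (u ε - u₀) ^ 2 + K * ε ^ 2)))
        (𝓝[>] 0) (𝓝 0) := by
      simpa using (((hu.tendsto_l2norm.pow 2).add ((hid.pow 2).const_mul K)).const_mul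
        (Real.exp T)).sqrt
    refine squeeze_zero' (.of_forall fun ε => l2norm_nonneg _) ?_ hlim
    filter_upwards [self_mem_nhdsWithin] with ε (hε : 0 < ε)
    rw [← (hf ε hε).2, ← hf₀.2]
    exact Real.le_sqrt_of_sq_le (hK ε hε _ (hf ε hε).1 s hs t ht)

theorem one_add_norm_pow_mul_wignerCLM_le' (p : Space d) {ε : ℝ} (hε : 0 < ε) (n : ℕ)
    {f g : PhaseFun d} {B : ℝ} (hf : energy coordDir (n + 2) f ≤ B)
    (hg : energy coordDir (n + 2) g ≤ B) :
    (1 + ‖p‖) ^ n * ‖l2inner g (wignerCLM (planeWave p) ε f)‖ ≤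
      (1 + 2 * d) ^ (n + 1) * √d * B := by
  have hB : 0 ≤ B := (energy_nonneg _ _ _).trans hf
  refine le_of_mul_le_mul_left ?_ (by positivity : 0 < 1 + ‖p‖)
  calc (1 + ‖p‖) * ((1 + ‖p‖) ^ n * ‖l2inner g (wignerCLM (planeWave p) ε f)‖)
      = (1 + ‖p‖) ^ (n + 1) * ‖l2inner g (wignerCLM (planeWave p) ε f)‖ := by ring
    _ ≤ (1 + 2 * d) ^ (n + 1) * (‖p‖ * √d) * B :=
        one_add_norm_pow_mul_wignerCLM_le p hε (n + 1) hf hg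
    _ = ‖p‖ * ((1 + 2 * d) ^ (n + 1) * √d * B) := by ring
    _ ≤ (1 + ‖p‖) * ((1 + 2 * d) ^ (n + 1) * √d * B) := by
        gcongr
        exact le_add_of_nonneg_left zero_le_one

namespace ConvergesOnInterval

theorem exists_l2inner_wignerCLM_le (hf : ConvergesOnInterval T f f₀)
    (hg : ConvergesOnInterval T g g₀) (n : ℕ) :
    ∃ C, ∀ᶠ ε in 𝓝[>] (0 : ℝ), ∀ t ∈ Set.Icc 0 T, ∀ p,
      (1 + ‖p‖) ^ n * ‖l2inner (g ε t) (wignerCLM (planeWave p) ε (f ε t))‖ ≤ C := by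
  obtain ⟨Bf, hBf⟩ := hf.bounded (n + 2)
  obtain ⟨Bg, hBg⟩ := hg.bounded (n + 2)
  refine ⟨(1 + 2 * d) ^ (n + 1) * √d * max Bf Bg, ?_⟩
  filter_upwards [hBf, hBg, self_mem_nhdsWithin] with ε hBf hBg (hε : 0 < ε) t ht p
  exact one_add_norm_pow_mul_wignerCLM_le' p hε n ((hBf t ht).trans (le_max_left _ _))
    ((hBg t ht).trans (le_max_right _ _))

theorem exists_wignerTransform_le (hf : ConvergesOnInterval T f f₀)
    (hg : ConvergesOnInterval T g g₀) (n : ℕ) :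
    ∃ C, ∀ᶠ ε in 𝓝[>] (0 : ℝ), ∀ q,
      ‖wignerTransform ε T (f ε) (g ε) q‖ ≤ C * ((1 + ‖q‖) ^ n)⁻¹ := by
  obtain ⟨C, hC⟩ := hf.exists_l2inner_wignerCLM_le hg n
  refine ⟨C * volume.real (Set.Icc 0 T), hC.mono fun ε hε q => ?_⟩
  rw [← div_eq_mul_inv, le_div_iff₀' (by positivity)]
  refine mul_norm_setIntegral_le measure_Icc_lt_top (by positivity) fun t ht => ?_
  refine le_trans ?_ (hε t ht ((2 * Real.pi) • q))
  gcongr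
  exact norm_le_norm_two_pi_smul q

theorem tendsto_l2inner_wignerCLM (hf : ConvergesOnInterval T f f₀)
    (hg : ConvergesOnInterval T g g₀) (p : Space d) {t : ℝ} (ht : t ∈ Set.Icc 0 T) :
    Tendsto (fun ε => l2inner (g ε t) (wignerCLM (planeWave p) ε (f ε t))) (𝓝[>] 0)
      (𝓝 (l2inner (g₀ t) (forceCLM (planeWave p) (f₀ t)))) := by
  obtain ⟨B, hB⟩ := hf.bounded 1
  have hid : Tendsto (fun ε : ℝ => ε) (𝓝[>] 0) (𝓝 0) := tendsto_id'.2 nhdsWithin_le_nhds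
  have hlim : Tendsto (fun ε => l2norm (g ε t - g₀ t) * (‖p‖ * √(d * B)) +
      (‖p‖ * ∑ j : Fin d, l2norm (∂_{momDir j} (g₀ t))) * l2norm (f ε t - f₀ t) +
      l2norm (g₀ t) *
        (‖p‖ ^ 2 * ε * ∑ j : Fin d, l2norm (∂_{momDir j} (∂_{momDir j} (f₀ t)))))
      (𝓝[>] 0) (𝓝 0) := by
    simpa using (((hg.tendsto t ht).mul_const _).add ((hf.tendsto t ht).const_mul _)).add
      (((hid.const_mul (‖p‖ ^ 2)).mul_const _).const_mul (l2norm (g₀ t)))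
  rw [tendsto_iff_norm_sub_tendsto_zero]
  refine squeeze_zero' (.of_forall fun ε => norm_nonneg _) ?_ hlim
  filter_upwards [hB, self_mem_nhdsWithin] with ε hBε (hε : 0 < ε)
  refine (norm_l2inner_wignerCLM_sub_forceCLM_le p hε (f ε t) (f₀ t) (g ε t) (g₀ t)).trans ?_
  gcongr
  · exact l2norm_nonneg _
  · exact sum_l2norm_momDir_le_sqrt (hBε t ht)

theorem tendsto_wignerTransform (hf : ConvergesOnInterval T f f₀)
    (hg : ConvergesOnInterval T g g₀) (q : Space d) :
    Tendsto (fun ε => wignerTransform ε T (f ε) (g ε) q) (𝓝[>] 0)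
      (𝓝 (liouvilleTransform T f₀ g₀ q)) := by
  set p := (2 * Real.pi) • q
  obtain ⟨C, hC⟩ := hf.exists_l2inner_wignerCLM_le hg 0
  refine tendsto_integral_filter_of_dominated_convergence (fun _ => C) ?_ ?_
    (integrable_const C) (ae_restrict_of_forall_mem measurableSet_Icc
      fun t ht => hf.tendsto_l2inner_wignerCLM hg p ht)
  · filter_upwards [self_mem_nhdsWithin] with ε (hε : 0 < ε)
    exact (continuousOn_l2inner ((wignerCLM _ ε).continuous.comp_continuousOn
      (hf.continuousOn ε hε)) (hg.continuousOn ε hε)).aestronglyMeasurable measurableSet_Icc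
  · filter_upwards [hC] with ε hCε
    exact ae_restrict_of_forall_mem measurableSet_Icc fun t ht => by simpa using hCε t ht p

theorem wignerRep_eventuallyEq_fourier (hf : ConvergesOnInterval T f f₀)
    (hg : ConvergesOnInterval T g g₀) :
    (fun ε => wignerRep ε T (f ε) (g ε)) =ᶠ[𝓝[>] 0]
      fun ε => 𝓕 (wignerTransform ε T (f ε) (g ε)) := by
  filter_upwards [self_mem_nhdsWithin] with ε (hε : 0 < ε)
  exact wignerRep_eq_fourier (hf.continuousOn ε hε) (hg.continuousOn ε hε) hε

theorem eventually_integrable_wignerTransform (hf : ConvergesOnInterval T f f₀)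
    (hg : ConvergesOnInterval T g g₀) :
    ∀ᶠ ε in 𝓝[>] (0 : ℝ), Integrable (wignerTransform ε T (f ε) (g ε)) := by
  filter_upwards [self_mem_nhdsWithin] with ε (hε : 0 < ε)
  exact integrable_wignerTransform (hf.continuousOn ε hε) (hg.continuousOn ε hε) hε

theorem tendstoUniformly_wignerRep (hf : ConvergesOnInterval T f f₀)
    (hg : ConvergesOnInterval T g g₀) :
    TendstoUniformly (fun ε => wignerRep ε T (f ε) (g ε)) (liouvilleRep T f₀ g₀)
      (𝓝[>] (0 : ℝ)) := by
  obtain ⟨C, hC⟩ := hf.exists_wignerTransform_le hg (d + 1)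
  rw [liouvilleRep_eq_fourier hf.continuousOn_limit hg.continuousOn_limit]
  exact (tendstoUniformly_congr (hf.wignerRep_eventuallyEq_fourier hg)).2
    (tendstoUniformly_fourier_of_dominated
      ((integrable_inv_one_add_norm_pow (by simp)).const_mul C)
      (hf.eventually_integrable_wignerTransform hg) (hC.mono fun _ h => .of_forall h)
      (.of_forall (hf.tendsto_wignerTransform hg)))

theorem tendsto_eLpNorm_wignerRep_sub (hf : ConvergesOnInterval T f f₀)
    (hg : ConvergesOnInterval T g g₀) :
    Tendsto (fun ε => eLpNorm (wignerRep ε T (f ε) (g ε) - liouvilleRep T f₀ g₀) 2 volume)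
      (𝓝[>] (0 : ℝ)) (𝓝 0) := by
  obtain ⟨C, hC⟩ := hf.exists_wignerTransform_le hg (d + 1)
  rw [liouvilleRep_eq_fourier hf.continuousOn_limit hg.continuousOn_limit]
  refine (tendsto_eLpNorm_fourier_sub_of_dominated
    ((integrable_inv_one_add_norm_pow (by simp)).const_mul C)
    ((memLp_two_inv_one_add_norm_pow (by simp)).const_mul C)
    (hf.eventually_integrable_wignerTransform hg) (hC.mono fun _ h => .of_forall h)
    (.of_forall (hf.tendsto_wignerTransform hg))).congr' ?_
  filter_upwards [hf.wignerRep_eventuallyEq_fourier hg] with ε h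
  rw [h]

end ConvergesOnInterval

end Limit

end WignerLiouville

end

theorem mainTheorem2 (d : ℕ) (V : WignerLiouville.Space d → ℝ)
    (hV : WignerLiouville.IsAdmissiblePotential V) (T : ℝ) (hT : 0 < T)
    (fI gT : ℝ → WignerLiouville.PhaseFun d) (fI₀ gT₀ : WignerLiouville.PhaseFun d)
    (hfI : WignerLiouville.ConvergesRegularly fI fI₀)
    (hgT : WignerLiouville.ConvergesRegularly gT gT₀)
    (fb g : ℝ → ℝ → WignerLiouville.PhaseFun d) (fb₀ g₀ : ℝ → WignerLiouville.PhaseFun d)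
    (hfb : ∀ ε : ℝ, 0 < ε → WignerLiouville.SolvesWigner V ε T (fb ε) ∧ fb ε 0 = fI ε)
    (hg : ∀ ε : ℝ, 0 < ε → WignerLiouville.SolvesWigner V ε T (g ε) ∧ g ε T = gT ε)
    (hfb₀ : WignerLiouville.SolvesLiouville V T fb₀ ∧ fb₀ 0 = fI₀)
    (hg₀ : WignerLiouville.SolvesLiouville V T g₀ ∧ g₀ T = gT₀) :
    (∀ ε : ℝ, 0 < ε → ∀ x : WignerLiouville.Space d,
      Integrable (WignerLiouville.wignerIntegrand ε (fb ε) (g ε) x)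
        (WignerLiouville.wignerMeasure d T)) ∧
    (∀ (j : Fin d) (x : WignerLiouville.Space d),
      Integrable (WignerLiouville.liouvilleIntegrand fb₀ g₀ j x)
        (WignerLiouville.liouvilleMeasure d T)) ∧
    (∀ j : Fin d, Differentiable ℝ (WignerLiouville.liouvilleFlux T fb₀ g₀ j)) ∧
    TendstoUniformly
      (fun (ε : ℝ) (x : WignerLiouville.Space d) =>
        WignerLiouville.wignerRep ε T (fb ε) (g ε) x)
      (WignerLiouville.liouvilleRep T fb₀ g₀) (𝓝[>] (0 : ℝ)) ∧
    Tendsto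
      (fun ε : ℝ => eLpNorm (fun x : WignerLiouville.Space d =>
        WignerLiouville.wignerRep ε T (fb ε) (g ε) x - WignerLiouville.liouvilleRep T fb₀ g₀ x)
        2 volume) (𝓝[>] (0 : ℝ)) (𝓝 0) := by
  have hf := hfI.convergesOnInterval hV (Set.left_mem_Icc.2 hT.le) hfb hfb₀
  have hadjoint := hgT.convergesOnInterval hV (Set.right_mem_Icc.2 hT.le) hg hg₀
  exact ⟨fun ε hε x => WignerLiouville.integrable_wignerIntegrand
      (hf.continuousOn ε hε) (hadjoint.continuousOn ε hε) hε x,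
    fun j x => WignerLiouville.integrable_liouvilleIntegrand
      hf.continuousOn_limit hadjoint.continuousOn_limit j x,
    fun j => WignerLiouville.differentiable_liouvilleFlux
      hf.continuousOn_limit hadjoint.continuousOn_limit j,
    hf.tendstoUniformly_wignerRep hadjoint,
    hf.tendsto_eLpNorm_wignerRep_sub hadjoint⟩
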